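/- Fix $L,T>0$. Let $H=L^2\big((0,L),\tfrac{dx}{L-x}\big)$ with norm $\|u\|_H=\|(L-x)^{-1/2}u\|_{L^2(0,L)}$, and let $$V=\{u\in H^2_0(0,L):\ (L-x)^{-1}u_{xx}\in L^2(0,L)\},\qquad \|u\|_V=\|(L-x)^{-1}u_{xx}\|_{L^2(0,L)}.$$ (i) If $u,v\in L^2(0,T;V)$, then $uv_x\in L^1(0,T;H)$. The map $(u,v)\mapsto uv_x$ from $L^2(0,T;V)^2$ to $L^1(0,T;H)$ is continuous, and there is a constant $c>0$ such that for all $u,v\in L^2(0,T;V)$ $$\|uv_x\|_{L^1(0,T;H)}\le c\,\|u\|_{L^2(0,T;V)}\|v\|_{L^2(0,T;V)}.$$ (ii) Let $A$ be the operator $Au=u_{xxxxx}-u_{xxx}-u_x$ in $H$ with domain $$D(A)=\{u\in H^5(0,L)\cap H^2_0(0,L):\ u_{xx}(L)=0,\ u_{xxxxx}-u_{xxx}-u_x\in H\}.$$ Then $A$ generates a strongly continuous semigroup $(S(t))_{t\ge0}$ on $H$. For every $g\in L^1(0,T;H)$ the mild solution $$u(t)=\int_0^t S(t-s)g(s)\,ds,\qquad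 0\le t\le T,$$ of $$u_t+u_x+u_{xxx}-u_{xxxxx}=g\ \text{ in }(0,T)\times(0,L),\qquad u(t,0)=u(t,L)=u_x(t,0)=u_x(t,L)=u_{xx}(t,L)=0,\qquad u(0,\cdot)=0,$$ is well defined (the integral is a convergent Bochner integral in $H$) and belongs to $C([0,T];H)\cap L^2(0,T;V)$, and there is a constant $C>0$, independent of $g$, such that $$\|u\|_{L^\infty(0,T;H)}+\|u\|_{L^2(0,T;V)}\le C\,\|g\|_{L^1(0,T;H)}.$$ -/

import Mathlib

open MeasureTheory Set Filter Topology
open scoped ENNReal ContDiff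

noncomputable section

namespace Kawahara

/-- Lebesgue measure on the open interval `(0, L)`. -/
abbrev vol (L : ℝ) : Measure ℝ := volume.restrict (Ioo 0 L)

/-- The weighted measure `w(x) dx` on `(0, L)`. -/
abbrev weighted (L : ℝ) (w : ℝ → ℝ) : Measure ℝ :=
  (vol L).withDensity (fun x => ENNReal.ofReal (w x))

/-- The space `L²(0, L)`. -/
abbrev L2 (L : ℝ) : Type := Lp ℝ 2 (vol L)

/-- The space `H = L²((0, L), dx / (L - x))`. -/
abbrev H (L : ℝ) : Type := Lp ℝ 2 (weighted L (fun x => 1 / (L - x)))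

/-- The space `L²((0, L), dx / (L - x)²)`. -/
abbrev Z (L : ℝ) : Type := Lp ℝ 2 (weighted L (fun x => 1 / (L - x) ^ 2))

/-- `φ ∈ C_c^∞(0, L)`. -/
def IsTest (L : ℝ) (φ : ℝ → ℝ) : Prop :=
  ContDiff ℝ ∞ φ ∧ HasCompactSupport φ ∧ tsupport φ ⊆ Ioo 0 L

/-- `g` is the weak (distributional) derivative of `f` on `(0, L)`. -/
def HasWeakDeriv {L : ℝ} (f g : L2 L) : Prop :=
  ∀ φ : ℝ → ℝ, IsTest L φ → ∫ x, f x * deriv φ x ∂(vol L) = -∫ x, g x * φ x ∂(vol L)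

/-- The trace of `f` at the point `a ∈ [0, L]` is `c`: `f` has a representative that is continuous
on `[0, L]` and takes the value `c` at `a`. (Every `f ∈ H¹(0, L)` has exactly one
representative that is continuous on `[0, L]`.) -/
def HasTrace {L : ℝ} (f : L2 L) (a c : ℝ) : Prop :=
  ∃ g : ℝ → ℝ, ContinuousOn g (Icc 0 L) ∧ g =ᵐ[vol L] f ∧ g a = c

/-- `u ∈ H²₀(0, L)` with weak derivatives `u_x = u₁` and `u_xx = u₂`, that is, `u ∈ H²(0, L)` and
`u(0) = u(L) = u_x(0) = u_x(L) = 0`. -/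
structure IsH20 {L : ℝ} (u u₁ u₂ : L2 L) : Prop where
  weak₁ : HasWeakDeriv u u₁
  weak₂ : HasWeakDeriv u₁ u₂
  left₀ : HasTrace u 0 0
  right₀ : HasTrace u L 0
  left₁ : HasTrace u₁ 0 0
  right₁ : HasTrace u₁ L 0

/-! ### Facts needed to define the space `V` and its norm -/

theorem IsTest.continuous {L : ℝ} {φ : ℝ → ℝ} (h : IsTest L φ) : Continuous φ := h.1.continuous

theorem IsTest.continuous_deriv {L : ℝ} {φ : ℝ → ℝ} (h : IsTest L φ) : Continuous (deriv φ) :=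
  h.1.continuous_deriv (by simp)

theorem integrable_mul_of_compact {L : ℝ} (f : L2 L) {ψ : ℝ → ℝ} (hψ : Continuous ψ)
    (hc : HasCompactSupport ψ) : Integrable (fun x => f x * ψ x) (vol L) := by
  have hf : Integrable (f : ℝ → ℝ) (vol L) := (Lp.memLp f).integrable (by norm_num)
  obtain ⟨C, hC⟩ := hc.exists_bound_of_continuous hψ
  exact hf.mul_bdd hψ.aestronglyMeasurable (ae_of_all _ hC)

theorem HasWeakDeriv.add {L : ℝ} {f g f' g' : L2 L} (h : HasWeakDeriv f g)
    (h' : HasWeakDeriv f' g') : HasWeakDeriv (f + f') (g + g') := by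
  intro φ hφ
  have e1 : ∫ x, (f + f' : L2 L) x * deriv φ x ∂(vol L)
      = ∫ x, f x * deriv φ x + f' x * deriv φ x ∂(vol L) := by
    refine integral_congr_ae ?_
    filter_upwards [Lp.coeFn_add f f'] with x hx
    rw [hx, Pi.add_apply, add_mul]
  have e2 : ∫ x, (g + g' : L2 L) x * φ x ∂(vol L)
      = ∫ x, g x * φ x + g' x * φ x ∂(vol L) := by
    refine integral_congr_ae ?_
    filter_upwards [Lp.coeFn_add g g'] with x hx
    rw [hx, Pi.add_apply, add_mul]
  rw [e1, e2, integral_add (integrable_mul_of_compact f hφ.continuous_deriv hφ.2.1.deriv)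
    (integrable_mul_of_compact f' hφ.continuous_deriv hφ.2.1.deriv),
    integral_add (integrable_mul_of_compact g hφ.continuous hφ.2.1)
    (integrable_mul_of_compact g' hφ.continuous hφ.2.1), h φ hφ, h' φ hφ]
  ring

theorem HasWeakDeriv.smul {L : ℝ} {f g : L2 L} (c : ℝ) (h : HasWeakDeriv f g) :
    HasWeakDeriv (c • f) (c • g) := by
  intro φ hφ
  have e1 : ∫ x, (c • f : L2 L) x * deriv φ x ∂(vol L)
      = ∫ x, c * (f x * deriv φ x) ∂(vol L) := by
    refine integral_congr_ae ?_
    filter_upwards [Lp.coeFn_smul c f] with x hx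
    rw [hx, Pi.smul_apply, smul_eq_mul, mul_assoc]
  have e2 : ∫ x, (c • g : L2 L) x * φ x ∂(vol L)
      = ∫ x, c * (g x * φ x) ∂(vol L) := by
    refine integral_congr_ae ?_
    filter_upwards [Lp.coeFn_smul c g] with x hx
    rw [hx, Pi.smul_apply, smul_eq_mul, mul_assoc]
  rw [e1, e2, integral_const_mul, integral_const_mul, h φ hφ]
  ring

theorem HasWeakDeriv.zero {L : ℝ} : HasWeakDeriv (0 : L2 L) 0 := by
  simpa using HasWeakDeriv.smul (f := (0 : L2 L)) (g := 0) 0 (by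
    intro φ _
    have e : ∀ ψ : ℝ → ℝ, ∫ x, (0 : L2 L) x * ψ x ∂(vol L) = 0 := by
      intro ψ
      rw [integral_eq_zero_of_ae]
      filter_upwards [Lp.coeFn_zero ℝ 2 (vol L)] with x hx
      rw [hx, Pi.zero_apply, zero_mul]
    rw [e, e, neg_zero])

theorem HasTrace.add {L : ℝ} {f f' : L2 L} {a c c' : ℝ} (h : HasTrace f a c)
    (h' : HasTrace f' a c') : HasTrace (f + f') a (c + c') := by
  obtain ⟨g, hg, he, hv⟩ := h
  obtain ⟨g', hg', he', hv'⟩ := h'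
  refine ⟨g + g', hg.add hg', ?_, by simp [hv, hv']⟩
  exact (he.add he').trans (Lp.coeFn_add f f').symm

theorem HasTrace.smul {L : ℝ} {f : L2 L} {a c : ℝ} (k : ℝ) (h : HasTrace f a c) :
    HasTrace (k • f) a (k * c) := by
  obtain ⟨g, hg, he, hv⟩ := h
  refine ⟨k • g, hg.const_smul k, ?_, by simp [hv]⟩
  exact (he.const_smul k).trans (Lp.coeFn_smul k f).symm

theorem HasTrace.zero {L : ℝ} (a : ℝ) : HasTrace (0 : L2 L) a 0 :=
  ⟨0, continuousOn_const, (Lp.coeFn_zero ℝ 2 (vol L)).symm, rfl⟩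

theorem IsH20.zero {L : ℝ} : IsH20 (0 : L2 L) 0 0 :=
  ⟨.zero, .zero, .zero _, .zero _, .zero _, .zero _⟩

theorem IsH20.add {L : ℝ} {u u₁ u₂ v v₁ v₂ : L2 L} (h : IsH20 u u₁ u₂) (h' : IsH20 v v₁ v₂) :
    IsH20 (u + v) (u₁ + v₁) (u₂ + v₂) :=
  ⟨h.weak₁.add h'.weak₁, h.weak₂.add h'.weak₂, by simpa using h.left₀.add h'.left₀,
    by simpa using h.right₀.add h'.right₀, by simpa using h.left₁.add h'.left₁,
    by simpa using h.right₁.add h'.right₁⟩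

theorem IsH20.smul {L : ℝ} {u u₁ u₂ : L2 L} (k : ℝ) (h : IsH20 u u₁ u₂) :
    IsH20 (k • u) (k • u₁) (k • u₂) :=
  ⟨h.weak₁.smul k, h.weak₂.smul k, by simpa using h.left₀.smul k,
    by simpa using h.right₀.smul k, by simpa using h.left₁.smul k,
    by simpa using h.right₁.smul k⟩

/-- A test function of integral zero is the derivative of a test function. -/
theorem IsTest.exists_primitive {L : ℝ} {η : ℝ → ℝ} (hη : IsTest L η) (h0 : ∫ x, η x = 0) :
    ∃ φ, IsTest L φ ∧ deriv φ = η := by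
  obtain ⟨hd, hc, hs⟩ := hη
  rcases (tsupport η).eq_empty_or_nonempty with he | hne
  · have hz : η = 0 := tsupport_eq_empty_iff.1 he
    subst hz
    refine ⟨0, ⟨contDiff_const, HasCompactSupport.zero, ?_⟩, ?_⟩
    · rw [he]; exact empty_subset _
    · exact deriv_const' (0 : ℝ)
  have hcK : IsCompact (tsupport η) := hc
  obtain ⟨a, ha, hamin⟩ := hcK.exists_isMinOn hne continuousOn_id
  obtain ⟨b, hb, hbmax⟩ := hcK.exists_isMaxOn hne continuousOn_id
  have hlow : ∀ x, x < a → η x = 0 := by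
    intro x hx
    by_contra hne'
    exact absurd (hamin (subset_tsupport η hne')) (not_le.2 hx)
  have hhigh : ∀ x, b < x → η x = 0 := by
    intro x hx
    by_contra hne'
    exact absurd (hbmax (subset_tsupport η hne')) (not_le.2 hx)
  have hcont : Continuous η := hd.continuous
  have hint : Integrable η := hcont.integrable_of_hasCompactSupport hc
  set φ : ℝ → ℝ := fun x => ∫ t in Iic x, η t with hφ
  have hφ' : ∀ x, φ x = φ 0 + ∫ t in (0 : ℝ)..x, η t := by
    intro x
    rw [← intervalIntegral.integral_Iic_sub_Iic hint.integrableOn hint.integrableOn]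
    simp [hφ]
  have hder : ∀ x, HasDerivAt φ (η x) x := by
    intro x
    have h1 : HasDerivAt (fun y => φ 0 + ∫ t in (0 : ℝ)..y, η t) (η x) x :=
      (intervalIntegral.integral_hasDerivAt_right (hcont.intervalIntegrable _ _)
        (hcont.stronglyMeasurableAtFilter _ _) hcont.continuousAt).const_add _
    exact h1.congr_of_eventuallyEq (Eventually.of_forall hφ')
  have hderiv : deriv φ = η := funext fun x => (hder x).deriv
  have hleft : ∀ x, x < a → φ x = 0 := by
    intro x hx
    exact setIntegral_eq_zero_of_forall_eq_zero fun t ht => hlow t (lt_of_le_of_lt ht hx)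
  have hright : ∀ x, b < x → φ x = 0 := by
    intro x hx
    have h1 : ∫ t in Iic x, η t = ∫ t, η t := by
      refine setIntegral_eq_integral_of_forall_compl_eq_zero fun t ht => hhigh t ?_
      exact hx.trans (not_le.1 ht)
    exact h1.trans h0
  have hsub : tsupport φ ⊆ Icc a b := by
    refine closure_minimal ?_ isClosed_Icc
    intro x hx
    refine ⟨not_lt.1 fun h => hx (hleft x h), not_lt.1 fun h => hx (hright x h)⟩
  refine ⟨φ, ⟨?_, ?_, ?_⟩, hderiv⟩
  · rw [contDiff_infty_iff_deriv, hderiv]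
    exact ⟨fun x => (hder x).differentiableAt, hd⟩
  · exact HasCompactSupport.of_support_subset_isCompact isCompact_Icc
      ((subset_tsupport φ).trans hsub)
  · intro x hx
    have := hsub hx
    exact ⟨(hs ha).1.trans_le this.1, this.2.trans_lt (hs hb).2⟩

theorem vol_eq_zero_of_nonpos {L : ℝ} (hL : L ≤ 0) : vol L = 0 := by
  simp [vol, Ioo_eq_empty (not_lt.2 hL)]

theorem setIntegral_mul_test {L : ℝ} (f : ℝ → ℝ) {ψ : ℝ → ℝ} (hψ : IsTest L ψ) :
    ∫ x, f x * ψ x ∂(vol L) = ∫ x, ψ x * f x := by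
  rw [setIntegral_eq_integral_of_forall_compl_eq_zero]
  · simp only [mul_comm]
  · intro x hx
    rw [image_eq_zero_of_notMem_tsupport fun h => hx (hψ.2.2 h), mul_zero]

/-- An element of `L²(0, L)` whose weak derivative is zero is constant. -/
theorem HasWeakDeriv.ae_const {L : ℝ} {f : L2 L} (h : HasWeakDeriv f 0) :
    ∃ c : ℝ, ∀ᵐ x ∂(vol L), f x = c := by
  rcases le_or_gt L 0 with hL | hL
  · refine ⟨0, ?_⟩
    simp [vol_eq_zero_of_nonpos hL]
  have hz : ∀ φ, IsTest L φ → ∫ x, f x * deriv φ x ∂(vol L) = 0 := by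
    intro φ hφ
    rw [h φ hφ, neg_eq_zero]
    refine integral_eq_zero_of_ae ?_
    filter_upwards [Lp.coeFn_zero ℝ 2 (vol L)] with x hx
    rw [hx, Pi.zero_apply, zero_mul]
  let β : ContDiffBump (L / 2) := ⟨L / 8, L / 4, by positivity, by linarith⟩
  set ρ : ℝ → ℝ := β.normed volume with hρ
  have hρt : IsTest L ρ := by
    refine ⟨β.contDiff_normed, β.hasCompactSupport_normed, ?_⟩
    rw [β.tsupport_normed_eq]
    intro x hx
    rw [Metric.mem_closedBall, Real.dist_eq, abs_le] at hx
    constructor <;> simp only [β] at hx <;> linarith [hx.1, hx.2]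
  have hρ1 : ∫ x, ρ x = 1 := β.integral_normed
  set c : ℝ := ∫ x, f x * ρ x ∂(vol L) with hc
  refine ⟨c, ?_⟩
  have hfi : Integrable (f : ℝ → ℝ) (vol L) := (Lp.memLp f).integrable (by norm_num)
  have hloc : LocallyIntegrableOn (fun x => f x - c) (Ioo 0 L) volume := by
    have : IntegrableOn (fun x => f x - c) (Ioo 0 L) volume :=
      hfi.sub (integrable_const c)
    exact this.locallyIntegrableOn
  have key := isOpen_Ioo.ae_eq_zero_of_integral_contDiff_smul_eq_zero hloc (by
    intro ψ h1 h2 h3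
    have hψ : IsTest L ψ := ⟨h1, h2, h3⟩
    set m : ℝ := ∫ x, ψ x with hm
    have hψi : Integrable ψ := hψ.continuous.integrable_of_hasCompactSupport h2
    have hρi : Integrable ρ := hρt.continuous.integrable_of_hasCompactSupport hρt.2.1
    have hη : IsTest L (fun x => ψ x - m * ρ x) := by
      refine ⟨h1.sub (contDiff_const.mul hρt.1), h2.sub hρt.2.1.mul_left, ?_⟩
      refine (tsupport_sub ψ (fun x => m * ρ x)).trans (union_subset h3 ?_)
      exact (tsupport_mul_subset_right (f := fun _ => m) (g := ρ)).trans hρt.2.2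
    obtain ⟨φ, hφ, hφd⟩ := hη.exists_primitive (by
      rw [integral_sub hψi (hρi.const_mul m), integral_const_mul, hρ1, mul_one, sub_self])
    have e := hz φ hφ
    rw [hφd] at e
    have e1 : ∫ x, f x * (ψ x - m * ρ x) ∂(vol L)
        = (∫ x, f x * ψ x ∂(vol L)) - m * c := by
      rw [hc, ← integral_const_mul, ← integral_sub
        (integrable_mul_of_compact f hψ.continuous h2)
        ((integrable_mul_of_compact f hρt.continuous hρt.2.1).const_mul m)]
      congr 1
      ext x
      ring
    have e2 : ∫ x, c * ψ x ∂(vol L) = c * m := by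
      rw [setIntegral_mul_test (fun _ => c) hψ, integral_mul_const, hm, mul_comm]
    have e3 : ∫ x, (f x - c) * ψ x ∂(vol L) = 0 := by
      simp only [sub_mul]
      rw [integral_sub (integrable_mul_of_compact f hψ.continuous h2)
        ((hψi.const_mul c).mono_measure Measure.restrict_le_self), e2]
      linarith
    rw [setIntegral_mul_test (fun x => f x - c) hψ] at e3
    simpa [smul_eq_mul] using e3)
  rw [ae_restrict_iff' measurableSet_Ioo]
  filter_upwards [key] with x hx hmem
  exact sub_eq_zero.1 (hx hmem)

theorem HasWeakDeriv.eq_zero_of_trace {L : ℝ} {f : L2 L} (h : HasWeakDeriv f 0)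
    (h0 : HasTrace f 0 0) : f = 0 := by
  rcases le_or_gt L 0 with hL | hL
  · refine Lp.ext ?_
    simp [Filter.EventuallyEq, vol_eq_zero_of_nonpos hL]
  obtain ⟨c, hc⟩ := h.ae_const
  obtain ⟨g, hg, hgf, hg0⟩ := h0
  have hgc : g =ᵐ[vol L] fun _ => c := hgf.trans hc
  have hEq : EqOn g (fun _ => c) (Ioo 0 L) :=
    Measure.eqOn_open_of_ae_eq hgc isOpen_Ioo (hg.mono Ioo_subset_Icc_self) continuousOn_const
  have hEq' : EqOn g (fun _ => c) (Icc 0 L) :=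
    hEq.of_subset_closure hg continuousOn_const Ioo_subset_Icc_self
      (by rw [closure_Ioo hL.ne])
  have hc0 : c = 0 := by rw [← hg0]; exact (hEq' ⟨le_rfl, hL.le⟩).symm
  refine Lp.ext (Filter.EventuallyEq.trans ?_ (Lp.coeFn_zero ℝ 2 (vol L)).symm)
  filter_upwards [hc] with x hx
  simp [hx, hc0]

/-! ### The space `V` -/

/-- The set `{u ∈ H²₀(0, L) : u_xx ∈ L²(dx / (L - x)²)}`; its element `u` is stored together with
its (unique) weak derivatives, as the triple `(u, u_x, u_xx)`. -/
def VSub (L : ℝ) : Submodule ℝ (L2 L × L2 L × L2 L) where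
  carrier := {u | IsH20 u.1 u.2.1 u.2.2 ∧ MemLp u.2.2 2 (weighted L (fun x => 1 / (L - x) ^ 2))}
  add_mem' := by
    rintro u v ⟨hu, hu'⟩ ⟨hv, hv'⟩
    refine ⟨hu.add hv, (memLp_congr_ae ?_).2 (hu'.add hv')⟩
    exact (withDensity_absolutelyContinuous _ _).ae_le (Lp.coeFn_add _ _)
  zero_mem' := by
    refine ⟨IsH20.zero, (memLp_congr_ae ?_).2 MemLp.zero⟩
    exact (withDensity_absolutelyContinuous _ _).ae_le (Lp.coeFn_zero ℝ 2 (vol L))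
  smul_mem' := by
    rintro k u ⟨hu, hu'⟩
    refine ⟨hu.smul k, (memLp_congr_ae ?_).2 (hu'.const_smul k)⟩
    exact (withDensity_absolutelyContinuous _ _).ae_le (Lp.coeFn_smul k _)

/-- The space `V = {u ∈ H²₀(0, L) : u_xx ∈ L²(dx / (L - x)²)}`. -/
def V (L : ℝ) : Type := ↥(VSub L)

instance (L : ℝ) : AddCommGroup (V L) := inferInstanceAs (AddCommGroup ↥(VSub L))

instance (L : ℝ) : Module ℝ (V L) := inferInstanceAs (Module ℝ ↥(VSub L))

/-- `u ∈ V` as an element of `L²(0, L)`. -/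
def V.fn {L : ℝ} (u : V L) : L2 L := Subtype.val (p := (· ∈ VSub L)) u |>.1

/-- The weak derivative `u_x` of `u ∈ V`. -/
def V.dx {L : ℝ} (u : V L) : L2 L := Subtype.val (p := (· ∈ VSub L)) u |>.2.1

/-- The weak second derivative `u_xx` of `u ∈ V`. -/
def V.dxx {L : ℝ} (u : V L) : L2 L := Subtype.val (p := (· ∈ VSub L)) u |>.2.2

theorem V.isH20 {L : ℝ} (u : V L) : IsH20 u.fn u.dx u.dxx :=
  (Subtype.property (p := (· ∈ VSub L)) u).1

theorem V.memLp_dxx {L : ℝ} (u : V L) :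
    MemLp u.dxx 2 (weighted L (fun x => 1 / (L - x) ^ 2)) :=
  (Subtype.property (p := (· ∈ VSub L)) u).2

theorem V.dxx_add {L : ℝ} (u v : V L) : (u + v).dxx = u.dxx + v.dxx := rfl

theorem V.dxx_smul {L : ℝ} (k : ℝ) (u : V L) : (k • u).dxx = k • u.dxx := rfl

theorem V.ext {L : ℝ} {u v : V L} (h0 : u.fn = v.fn) (h1 : u.dx = v.dx) (h2 : u.dxx = v.dxx) :
    u = v :=
  Subtype.ext (p := (· ∈ VSub L)) (Prod.ext h0 (Prod.ext h1 h2))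

/-- The map `u ↦ u_xx` from `V` to `L²(dx / (L - x)²)`. -/
def V.wxx (L : ℝ) : V L →ₗ[ℝ] Z L where
  toFun u := u.memLp_dxx.toLp u.dxx
  map_add' u v := by
    rw [← MemLp.toLp_add u.memLp_dxx v.memLp_dxx, MemLp.toLp_eq_toLp_iff, V.dxx_add]
    exact (withDensity_absolutelyContinuous _ _).ae_le (Lp.coeFn_add _ _)
  map_smul' k u := by
    rw [RingHom.id_apply, ← MemLp.toLp_const_smul k u.memLp_dxx, MemLp.toLp_eq_toLp_iff,
      V.dxx_smul]
    exact (withDensity_absolutelyContinuous _ _).ae_le (Lp.coeFn_smul k _)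

theorem vol_absolutelyContinuous (L : ℝ) :
    vol L ≪ weighted L (fun x => 1 / (L - x) ^ 2) := by
  refine withDensity_absolutelyContinuous' (by fun_prop) ?_
  filter_upwards [ae_restrict_mem measurableSet_Ioo] with x hx
  have : 0 < L - x := sub_pos.2 hx.2
  rw [Ne, ENNReal.ofReal_eq_zero, not_le]
  positivity

theorem V.wxx_injective (L : ℝ) : Function.Injective (V.wxx L) := by
  rw [injective_iff_map_eq_zero]
  intro u hu
  have hH := u.isH20
  have h2 : u.dxx = 0 := by
    refine Lp.ext (Filter.EventuallyEq.trans ?_ (Lp.coeFn_zero ℝ 2 (vol L)).symm)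
    exact (vol_absolutelyContinuous L).ae_le ((MemLp.toLp_eq_toLp_iff u.memLp_dxx MemLp.zero).1
      (hu.trans (MemLp.toLp_zero _).symm))
  have hw₂ := hH.weak₂
  rw [h2] at hw₂
  have h1 := hw₂.eq_zero_of_trace hH.left₁
  have hw₁ := hH.weak₁
  rw [h1] at hw₁
  exact V.ext (hw₁.eq_zero_of_trace hH.left₀) h1 h2

/-- The norm `‖u‖_V = ‖(L - x)⁻¹ u_xx‖_{L²(0, L)}`. -/
instance (L : ℝ) : NormedAddCommGroup (V L) :=
  NormedAddCommGroup.induced (V L) (Z L) (V.wxx L) (V.wxx_injective L)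

instance (L : ℝ) : NormedSpace ℝ (V L) := NormedSpace.induced ℝ (V L) (Z L) (V.wxx L)

/-! ### The Kawahara operator, its semigroup and the mild solution -/

/-- The graph of the operator `A u = u_xxxxx - u_xxx - u_x` in `H`, with domain
`{u ∈ H⁵(0, L) ∩ H²₀(0, L) : u_xx(L) = 0, A u ∈ H}`: here `D j` is the weak derivative of `u` of
order `j`, and `f = A u`. -/
def KawaharaGraph {L : ℝ} (u f : H L) : Prop :=
  ∃ D : Fin 6 → L2 L, u =ᵐ[vol L] D 0 ∧
    (∀ j : Fin 5, HasWeakDeriv (D j.castSucc) (D j.succ)) ∧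
    IsH20 (D 0) (D 1) (D 2) ∧ HasTrace (D 2) L 0 ∧
    f =ᵐ[vol L] fun x => D 5 x - D 3 x - D 1 x

/-- A strongly continuous (`C₀`) semigroup `(S(t))_{t ≥ 0}` of bounded operators on `E`. The values
of `S` at negative times carry no information. -/
structure C0Semigroup (E : Type*) [NormedAddCommGroup E] [NormedSpace ℝ E] where
  /-- The operator `S(t)`. -/
  op : ℝ → E →L[ℝ] E
  op_zero : op 0 = ContinuousLinearMap.id ℝ E
  op_add : ∀ s t : ℝ, 0 ≤ s → 0 ≤ t → op (s + t) = (op s).comp (op t)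
  continuousOn_orbit : ∀ x : E, ContinuousOn (fun t => op t x) (Ici 0)

/-- The infinitesimal generator of `S` (as a graph) is the operator with graph `G`. -/
def C0Semigroup.IsGeneratedBy {E : Type*} [NormedAddCommGroup E] [NormedSpace ℝ E]
    (S : C0Semigroup E) (G : E → E → Prop) : Prop :=
  ∀ x y : E, Tendsto (fun t : ℝ => t⁻¹ • (S.op t x - x)) (𝓝[>] 0) (𝓝 y) ↔ G x y

/-- Duhamel's formula with initial value zero: `t ↦ ∫₀ᵗ S(t - s) g(s) ds`. -/
def C0Semigroup.duhamel {E : Type*} [NormedAddCommGroup E] [NormedSpace ℝ E]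
    (S : C0Semigroup E) (g : ℝ → E) (t : ℝ) : E :=
  ∫ s in (0 : ℝ)..t, S.op (t - s) (g s)

end Kawahara

end

/-! Part (ii) rests on one inequality on the domain of the operator: ⟪A u, u⟫ + (1/20) ‖u‖_V² ≤
(1/2) ‖u‖² in H (`KawaharaGraph.exists_coercive`). Write σ = 1/(L - x), so σ' = σ². Pairing in H
means multiplying by σ u, and integration by parts turns the fifth-order term formally into -∫ (5/2
σ² u_xx² - 15 σ⁴ u_x² + 60 σ⁶ u²). The middle sign is wrong, but adding exact derivatives completes
the form to a sum of squares, as in proofs of Hardy's inequality, and leaves a multiple of σ⁶ u² to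
spare. The third-order term is a square by the same device. The first-order term gives +1/2 ∫ σ² u²,
which is absorbed by the spare σ⁶ u² where σ ≥ 1 and by 1/2 σ u², the density of the H norm, where σ
≤ 1. The boundary terms vanish at L because u = u_x = u_xx = 0 there, and have a favourable sign at
0.

Hence A - 1/2 is dissipative. For μ > 1/2 the equation μ u - A u = f is a linear system of dimension
five with five boundary conditions, so the uniqueness given by dissipativity yields existence
(`boundaryMap_injective`, `kawaharaGraph_exists_resolvent`). The Yosida approximation then provides
the semigroup (`IsQuasiMDissipative.exists_semigroup`).

Integrating the inequality along orbits bounds S(t) x in L²(0,T;V) by ‖x‖ for regular data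
(`IsLiftedMultiplier.lintegral_orbit_le`). Minkowski's integral inequality carries this over to
Duhamel integrals with only the L¹(0,T;H) norm of g on the right. Since S(t) x need not lie in V for
general x, the estimate is made after applying J_μ = μ (μ - A)⁻¹, which maps H boundedly into V and
commutes with S, and a Cauchy argument in L²(0,T;V) removes J_μ (`exists_lift_duhamel`). These
bounds use only the generator, so they hold for every semigroup it generates.

Part (i) follows from pointwise decay at L: |v_x|² ≤ (L - x)³ ‖v‖_V² and |v|² ≤ (L - x)⁵ ‖v‖_V²
(`V.ae_bound`). Hence (u, v) ↦ u v_x is a bounded bilinear map V × V → H, and Hölder's inequality in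
time finishes. -/

noncomputable section

set_option linter.unusedSectionVars false

namespace Kawahara

/-! ### Quasi-m-dissipative operators in a Hilbert space -/

section Resolvent

variable {E : Type*} [NormedAddCommGroup E] [InnerProductSpace ℝ E]

/-- The graph `G` belongs to an operator `A` with `⟪A x, x⟫ ≤ κ ‖x‖²` such that `μ - A` is onto for
all `μ > κ`. -/
structure IsQuasiMDissipative (G : Submodule ℝ (E × E)) (κ : ℝ) : Prop where
  inner_le : ∀ p ∈ G, inner ℝ p.2 p.1 ≤ κ * ‖p.1‖ ^ 2
  exists_resolvent : ∀ μ, κ < μ → ∀ f, ∃ p ∈ G, μ • p.1 - p.2 = f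
  eq_zero_of_zero : ∀ y, ((0 : E), y) ∈ G → y = 0

namespace IsQuasiMDissipative

variable {G : Submodule ℝ (E × E)} {κ μ ν : ℝ}

/-- Pair μ x - A x with x: dissipativity bounds the result below by (μ - κ) ‖x‖², Cauchy–Schwarz
bounds it above. Uniqueness for the resolvent equation and the resolvent bound both come from here.
-/
theorem norm_le (h : IsQuasiMDissipative G κ) {p : E × E} (hp : p ∈ G) :
    (μ - κ) * ‖p.1‖ ≤ ‖μ • p.1 - p.2‖ := by
  rcases eq_or_ne p.1 0 with h0 | h0
  · simp [h0]
  have h1 := h.inner_le p hp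
  have h2 : inner ℝ (μ • p.1 - p.2) p.1 ≤ ‖μ • p.1 - p.2‖ * ‖p.1‖ := real_inner_le_norm _ _
  rw [inner_sub_left, real_inner_smul_left, real_inner_self_eq_norm_sq] at h2
  have h3 : 0 < ‖p.1‖ := norm_pos_iff.2 h0
  nlinarith

theorem eq_of_mem (h : IsQuasiMDissipative G κ) (hμ : κ < μ) {p q : E × E} (hp : p ∈ G)
    (hq : q ∈ G) (e : μ • p.1 - p.2 = μ • q.1 - q.2) : p.1 = q.1 := by
  have h1 := h.norm_le (μ := μ) (G.sub_mem hp hq)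
  have h2 : μ • (p - q).1 - (p - q).2 = 0 := by
    rw [Prod.fst_sub, Prod.snd_sub, smul_sub, ← sub_eq_zero.2 e]
    abel
  rw [h2, norm_zero] at h1
  have h3 : ‖(p - q).1‖ ≤ 0 := by
    by_contra h4
    exact absurd h1 (not_le.2 (mul_pos (sub_pos.2 hμ) (not_le.1 h4)))
  exact sub_eq_zero.1 (norm_le_zero_iff.1 h3)

/-- The resolvent `(μ - A)⁻¹`. -/
def resolvent (h : IsQuasiMDissipative G κ) (hμ : κ < μ) : E →L[ℝ] E :=
  LinearMap.mkContinuous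
    { toFun := fun f => (h.exists_resolvent μ hμ f).choose.1
      map_add' := fun f g => by
        have hf := (h.exists_resolvent μ hμ f).choose_spec
        have hg := (h.exists_resolvent μ hμ g).choose_spec
        have hfg := (h.exists_resolvent μ hμ (f + g)).choose_spec
        refine h.eq_of_mem hμ hfg.1 (G.add_mem hf.1 hg.1) (hfg.2.trans ?_)
        conv_lhs => rw [← hf.2, ← hg.2]
        rw [Prod.fst_add, Prod.snd_add, smul_add]
        abel
      map_smul' := fun c f => by
        have hf := (h.exists_resolvent μ hμ f).choose_spec
        have hcf := (h.exists_resolvent μ hμ (c • f)).choose_spec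
        refine h.eq_of_mem hμ hcf.1 (G.smul_mem c hf.1) (hcf.2.trans ?_)
        conv_lhs => rw [← hf.2]
        rw [Prod.smul_fst, Prod.smul_snd, smul_sub, smul_comm] }
    (μ - κ)⁻¹ (fun f => by
      have hf := (h.exists_resolvent μ hμ f).choose_spec
      have := h.norm_le (μ := μ) hf.1
      rw [hf.2] at this
      rw [inv_mul_eq_div, le_div_iff₀ (sub_pos.2 hμ), mul_comm]
      exact this)

theorem resolvent_mem (h : IsQuasiMDissipative G κ) (hμ : κ < μ) (f : E) :
    (h.resolvent hμ f, μ • h.resolvent hμ f - f) ∈ G := by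
  have hf := (h.exists_resolvent μ hμ f).choose_spec
  have e : h.resolvent hμ f = (h.exists_resolvent μ hμ f).choose.1 := rfl
  have e' : (h.resolvent hμ f, μ • h.resolvent hμ f - f)
      = (h.exists_resolvent μ hμ f).choose := by
    refine Prod.ext e ?_
    rw [e, sub_eq_iff_eq_add]
    exact sub_eq_iff_eq_add'.1 hf.2
  rw [e']
  exact hf.1

theorem resolvent_sub (h : IsQuasiMDissipative G κ) (hμ : κ < μ) {p : E × E} (hp : p ∈ G) :
    h.resolvent hμ (μ • p.1 - p.2) = p.1 :=
  h.eq_of_mem (p := (_, _)) hμ (h.resolvent_mem hμ (μ • p.1 - p.2)) hp (by simp)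

theorem norm_resolvent_le (h : IsQuasiMDissipative G κ) (hμ : κ < μ) (f : E) :
    (μ - κ) * ‖h.resolvent hμ f‖ ≤ ‖f‖ := by
  simpa using h.norm_le (μ := μ) (h.resolvent_mem hμ f)

/-- On the domain, μ (μ - A)⁻¹ differs from the identity by (μ - A)⁻¹ A. Both J_μ → 1 and the
formula A_n x = J_n A x come from this. -/
theorem smul_resolvent_fst (h : IsQuasiMDissipative G κ) (hμ : κ < μ) {p : E × E} (hp : p ∈ G) :
    μ • h.resolvent hμ p.1 = p.1 + h.resolvent hμ p.2 := by
  have := h.resolvent_sub hμ hp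
  rw [map_sub, map_smul] at this
  rw [← sub_eq_iff_eq_add, this]

/-- The resolvent identity R_μ = R_ν - (μ - ν) R_μ R_ν, used also with μ and ν exchanged, gives (μ -
ν)(R_μ R_ν - R_ν R_μ) = 0. -/
theorem resolvent_comm (h : IsQuasiMDissipative G κ) (hμ : κ < μ) (hν : κ < ν) :
    Commute (h.resolvent hμ) (h.resolvent hν) := by
  have key : ∀ {μ ν : ℝ} (hμ : κ < μ) (hν : κ < ν) (f : E),
      h.resolvent hμ f = h.resolvent hν f - (μ - ν) • h.resolvent hμ (h.resolvent hν f) := by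
    intro μ ν hμ hν f
    have h1 := h.smul_resolvent_fst hμ (h.resolvent_mem hν f)
    simp only [map_sub, map_smul] at h1
    rw [sub_smul, h1]
    abel
  rcases eq_or_ne μ ν with rfl | hne
  · exact Commute.refl _
  ext f
  have h1 := key hμ hν f
  have h2 := key hν hμ f
  rw [h1] at h2
  have h3 : (μ - ν) • (h.resolvent hμ (h.resolvent hν f) - h.resolvent hν (h.resolvent hμ f)) = 0 := by
    have h4 : (ν - μ) • h.resolvent hν (h.resolvent hμ f)
        = -((μ - ν) • h.resolvent hμ (h.resolvent hν f)) := by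
      have h5 : h.resolvent hν f + (ν - μ) • h.resolvent hν (h.resolvent hμ f)
          = h.resolvent hν f - (μ - ν) • h.resolvent hμ (h.resolvent hν f) := by
        conv_lhs => rw [h2, h1]
        abel
      rw [sub_eq_add_neg _ (_ • _)] at h5
      exact add_left_cancel h5
    rw [smul_sub, ← neg_neg ((μ - ν) • h.resolvent hμ (h.resolvent hν f)), ← h4, ← neg_sub ν μ,
      neg_smul]
    abel
  exact sub_eq_zero.1 ((smul_eq_zero.1 h3).resolve_left (sub_ne_zero.2 hne))

variable [CompleteSpace E]

/-- If f is orthogonal to the domain, then u = (μ - A)⁻¹ f is orthogonal to f, so μ ‖u‖² = ⟪A u, u⟫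
≤ κ ‖u‖² and u = 0. The graph then contains (0, -f), which forces f = 0. -/
theorem dense_domain (h : IsQuasiMDissipative G κ) :
    Dense {x : E | ∃ y, (x, y) ∈ G} := by
  let D : Submodule ℝ E := G.map (LinearMap.fst ℝ E E)
  have hD : (D : Set E) = {x : E | ∃ y, (x, y) ∈ G} := by
    ext x
    simp [D]
  rw [← hD]
  refine Submodule.dense_iff_topologicalClosure_eq_top.2
    (Submodule.topologicalClosure_eq_top_iff.2 ?_)
  rw [Submodule.eq_bot_iff]
  intro f hf
  have hμ : κ < κ + 1 := by linarith
  have hm := h.resolvent_mem hμ f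
  have h1 := (Submodule.mem_orthogonal' _ _).1 hf (h.resolvent hμ f)
    ⟨_, hm, rfl⟩
  have h2 := h.inner_le _ hm
  rw [inner_sub_left, real_inner_smul_left, real_inner_self_eq_norm_sq, h1] at h2
  have h3 : h.resolvent hμ f = 0 := by
    have : ‖h.resolvent hμ f‖ ^ 2 ≤ 0 := by linarith
    exact norm_eq_zero.1 (pow_eq_zero_iff (two_ne_zero) |>.1 (le_antisymm this (sq_nonneg _)))
  rw [h3, smul_zero, zero_sub] at hm
  exact neg_eq_zero.1 (h.eq_zero_of_zero _ hm)

end IsQuasiMDissipative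

/-- Strong convergence to zero of a bounded family of operators need only be checked on a dense
set. -/
theorem tendsto_zero_of_dense {F ι : Type*} [NormedAddCommGroup F] [NormedSpace ℝ F]
    {l : Filter ι} {P : ι → E →L[ℝ] F} {C : ℝ} (hP : ∀ i x, ‖P i x‖ ≤ C * ‖x‖) {D : Set E}
    (hD : Dense D) (h0 : ∀ x ∈ D, Tendsto (fun i => P i x) l (𝓝 0)) (x : E) :
    Tendsto (fun i => P i x) l (𝓝 0) := by
  rw [Metric.tendsto_nhds]
  intro ε hε
  have hC : 0 < |C| + 1 := by positivity
  obtain ⟨y, hy, hxy⟩ := hD.exists_dist_lt x (ε := ε / (2 * (|C| + 1))) (by positivity)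
  filter_upwards [(Metric.tendsto_nhds.1 (h0 y hy)) (ε / 2) (by positivity)] with i hi
  rw [dist_zero_right] at hi ⊢
  have h1 : ‖P i (x - y)‖ < ε / 2 := by
    refine (hP i (x - y)).trans_lt ?_
    rw [dist_eq_norm] at hxy
    calc C * ‖x - y‖ ≤ (|C| + 1) * ‖x - y‖ := by
          gcongr
          linarith [le_abs_self C]
      _ < (|C| + 1) * (ε / (2 * (|C| + 1))) := by gcongr
      _ = ε / 2 := by field_simp
  calc ‖P i x‖ = ‖P i (x - y) + P i y‖ := by rw [← map_add, sub_add_cancel]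
    _ ≤ _ := norm_add_le _ _
    _ < ε := by linarith

/-! ### The approximate identity J_μ. -/

namespace IsQuasiMDissipative

variable [CompleteSpace E] {G : Submodule ℝ (E × E)} {κ : ℝ}

theorem lt_seq (hκ : 0 ≤ κ) (n : ℕ) : κ < 2 * κ + n + 1 := by
  have : (0 : ℝ) ≤ n := n.cast_nonneg
  linarith

/-- The operators `J_μ = μ (μ - A)⁻¹` for `μ = 2 κ + n + 1`, which tend strongly to the identity. -/
def approxId (h : IsQuasiMDissipative G κ) (hκ : 0 ≤ κ) (n : ℕ) : E →L[ℝ] E :=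
  (2 * κ + n + 1) • h.resolvent (lt_seq hκ n)

/-- The term 2 κ in μ is there to make μ / (μ - κ) ≤ 2 for every n. -/
theorem norm_approxId_le (h : IsQuasiMDissipative G κ) (hκ : 0 ≤ κ) (n : ℕ) (x : E) :
    ‖h.approxId hκ n x‖ ≤ 2 * ‖x‖ := by
  have h1 := h.norm_resolvent_le (lt_seq hκ n) x
  have hn : (0 : ℝ) ≤ n := n.cast_nonneg
  rw [approxId, smul_apply, norm_smul, Real.norm_of_nonneg (by linarith)]
  nlinarith [norm_nonneg (h.resolvent (lt_seq hκ n) x)]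

theorem tendsto_approxId (h : IsQuasiMDissipative G κ) (hκ : 0 ≤ κ) (x : E) :
    Tendsto (fun n => h.approxId hκ n x) atTop (𝓝 x) := by
  rw [tendsto_iff_norm_sub_tendsto_zero, ← tendsto_zero_iff_norm_tendsto_zero]
  refine tendsto_zero_of_dense (P := fun n => h.approxId hκ n - ContinuousLinearMap.id ℝ E)
    (C := 3) (fun n x => ?_) h.dense_domain ?_ x
  · have := h.norm_approxId_le hκ n x
    have h2 : ‖h.approxId hκ n x - x‖ ≤ _ := norm_sub_le _ _
    simp only [sub_apply, ContinuousLinearMap.id_apply]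
    linarith
  · rintro x ⟨y, hy⟩
    rw [tendsto_zero_iff_norm_tendsto_zero]
    have hlim : Tendsto (fun n : ℕ => ‖y‖ / ((n : ℝ) + 1)) atTop (𝓝 0) :=
      tendsto_const_nhds.div_atTop
        (tendsto_atTop_add_const_right _ _ tendsto_natCast_atTop_atTop)
    refine squeeze_zero (fun _ => norm_nonneg _) (fun n => ?_) hlim
    have h1 := h.smul_resolvent_fst (lt_seq hκ n) hy
    have h2 := h.norm_resolvent_le (lt_seq hκ n) y
    have hn : (0 : ℝ) ≤ n := n.cast_nonneg
    simp only [sub_apply, ContinuousLinearMap.id_apply, approxId,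
      smul_apply] at h1 ⊢
    rw [h1, add_sub_cancel_left, le_div_iff₀ (by positivity)]
    nlinarith [norm_nonneg (h.resolvent (lt_seq hκ n) y)]

end IsQuasiMDissipative

end Resolvent

/-! ### Generation of contraction semigroups by the Yosida approximation -/

section Generation

variable {E : Type*} [NormedAddCommGroup E] [InnerProductSpace ℝ E] [CompleteSpace E]

open NormedSpace (exp)

theorem hasDerivAt_exp_smul_apply {W : Type*} [NormedAddCommGroup W] [NormedSpace ℝ W]
    [CompleteSpace W] (B : W →L[ℝ] W) (x : W) (t : ℝ) :
    HasDerivAt (fun t : ℝ => exp (t • B) x) (B (exp (t • B) x)) t := by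
  have := (hasDerivAt_exp_smul_const' B t).clm_apply (hasDerivAt_const t x)
  simpa using this

/-- The derivative of ‖e^{tB} x‖² is 2 ⟪B e^{tB} x, e^{tB} x⟫ ≤ 0. -/
theorem norm_exp_smul_apply_le {B : E →L[ℝ] E} (hB : ∀ x, inner ℝ (B x) x ≤ 0) {t : ℝ}
    (ht : 0 ≤ t) (x : E) : ‖exp (t • B) x‖ ≤ ‖x‖ := by
  have hd : ∀ t : ℝ, HasDerivAt (fun t : ℝ => ‖exp (t • B) x‖ ^ 2)
      (2 * inner ℝ (exp (t • B) x) (B (exp (t • B) x))) t :=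
    fun t => (hasDerivAt_exp_smul_apply B x t).norm_sq
  have hanti : Antitone (fun t : ℝ => ‖exp (t • B) x‖ ^ 2) :=
    antitone_of_hasDerivAt_nonpos hd fun t => by
      have := hB (exp (t • B) x)
      rw [real_inner_comm] at this
      simp only [Pi.zero_apply]
      linarith
  have h1 := hanti ht
  simp only [zero_smul, NormedSpace.exp_zero, one_apply_eq_self] at h1
  exact (sq_le_sq₀ (norm_nonneg _) (norm_nonneg _)).1 h1

/-- Interpolate by s ↦ e^{(t-s)C} e^{sB} x. As B and C commute, its derivative is e^{(t-s)C} e^{sB}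
(B x - C x), and both exponentials are contractions. -/
theorem norm_exp_smul_sub_le {B C : E →L[ℝ] E} (hB : ∀ x, inner ℝ (B x) x ≤ 0)
    (hC : ∀ x, inner ℝ (C x) x ≤ 0) (hBC : Commute B C) {t : ℝ} (ht : 0 ≤ t) (x : E) :
    ‖exp (t • B) x - exp (t • C) x‖ ≤ t * ‖B x - C x‖ := by
  set g : ℝ → E := fun s => exp ((t - s) • C) (exp (s • B) x) with hg
  have hd : ∀ s, HasDerivAt g (exp ((t - s) • C) (exp (s • B) (B x - C x))) s := by
    intro s
    have h1 : HasDerivAt (fun s : ℝ => exp ((t - s) • C)) (-(exp ((t - s) • C) * C)) s := by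
      have := (hasDerivAt_exp_smul_const C (t - s)).scomp s ((hasDerivAt_id s).const_sub t)
      rw [neg_one_smul] at this
      exact this
    have h2 : HasDerivAt (fun s : ℝ => exp (s • B) x) ((exp (s • B) * B) x) s := by
      have := (hasDerivAt_exp_smul_const B s).clm_apply (hasDerivAt_const s x)
      simpa using this
    have h3 := h1.clm_apply h2
    have hcomm : C (exp (s • B) x) = exp (s • B) (C x) := by
      have : Commute C (exp (s • B)) := ((hBC.symm.smul_right s)).exp_right
      exact congrArg (fun T : E →L[ℝ] E => T x) this.eq
    have e : (-(exp ((t - s) • C) * C)) (exp (s • B) x) + exp ((t - s) • C) ((exp (s • B) * B) x)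
        = exp ((t - s) • C) (exp (s • B) (B x - C x)) := by
      change -(exp ((t - s) • C) (C (exp (s • B) x))) + exp ((t - s) • C) (exp (s • B) (B x)) = _
      rw [hcomm, map_sub, map_sub]
      abel
    rw [e] at h3
    exact h3
  have h1 := norm_image_sub_le_of_norm_deriv_le_segment' (f := g) (a := 0) (b := t)
    (C := ‖B x - C x‖) (fun s _ => (hd s).hasDerivWithinAt) (fun s hs => ?_) t ⟨ht, le_rfl⟩
  · simpa [hg, mul_comm] using h1
  · exact (norm_exp_smul_apply_le hC (by linarith [hs.2]) _).trans
      (norm_exp_smul_apply_le hB hs.1 _)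

/-! ### The Yosida approximation and its limit semigroup. -/

namespace IsQuasiMDissipative

variable {G : Submodule ℝ (E × E)}

/-- The Yosida approximation `A_n = μ (J_μ - 1)`, `μ = n + 1`, of a dissipative operator. -/
def yosida (h : IsQuasiMDissipative G 0) (n : ℕ) : E →L[ℝ] E :=
  ((n : ℝ) + 1) • (h.approxId le_rfl n - 1)

/-- For κ = 0 each J_n is a contraction, hence ⟪J_n x, x⟫ ≤ ‖x‖². -/
theorem inner_yosida_le (h : IsQuasiMDissipative G 0) (n : ℕ) (x : E) :
    inner ℝ (h.yosida n x) x ≤ 0 := by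
  have h1 := h.norm_resolvent_le (lt_seq le_rfl n) x
  have h2 := real_inner_le_norm (h.approxId le_rfl n x) x
  have h3 : ‖h.approxId le_rfl n x‖ ≤ ‖x‖ := by
    rw [approxId, smul_apply, norm_smul, Real.norm_of_nonneg (by positivity)]
    simpa using h1
  simp only [yosida, smul_apply, sub_apply,
    one_apply_eq_self, real_inner_smul_left, inner_sub_left,
    real_inner_self_eq_norm_sq]
  have h4 : inner ℝ (h.approxId le_rfl n x) x - ‖x‖ ^ 2 ≤ 0 := by
    nlinarith [norm_nonneg x]
  have hn : (0 : ℝ) ≤ (n : ℝ) + 1 := by positivity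
  exact mul_nonpos_of_nonneg_of_nonpos hn h4

theorem yosida_comm (h : IsQuasiMDissipative G 0) (n m : ℕ) :
    Commute (h.yosida n) (h.yosida m) := by
  have h1 : Commute (h.approxId le_rfl n) (h.approxId le_rfl m) :=
    ((h.resolvent_comm (lt_seq le_rfl n) (lt_seq le_rfl m)).smul_left _).smul_right _
  exact (((h1.sub_left (Commute.one_left _)).sub_right (Commute.one_right _)).smul_left _).smul_right _

theorem yosida_apply (h : IsQuasiMDissipative G 0) (n : ℕ) {x y : E} (hxy : (x, y) ∈ G) :
    h.yosida n x = h.approxId le_rfl n y := by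
  have h1 := h.smul_resolvent_fst (lt_seq le_rfl n) hxy
  simp only [yosida, approxId, smul_apply, sub_apply,
    one_apply_eq_self] at h1 ⊢
  rw [h1, add_sub_cancel_left]
  simp

/-- On the domain the difference for indices n and m is at most t ‖J_n A x - J_m A x‖, which tends
to zero; contractivity and density give the rest. -/
theorem cauchySeq_exp_yosida (h : IsQuasiMDissipative G 0) {t : ℝ} (ht : 0 ≤ t) (x : E) :
    CauchySeq fun n => exp (t • h.yosida n) x := by
  rw [cauchySeq_iff_tendsto_dist_atTop_0]
  simp only [dist_eq_norm]
  rw [← tendsto_zero_iff_norm_tendsto_zero]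
  refine tendsto_zero_of_dense
    (P := fun k : ℕ × ℕ => exp (t • h.yosida k.1) - exp (t • h.yosida k.2))
    (C := 2) (fun k x => ?_) h.dense_domain ?_ x
  · have h1 := norm_exp_smul_apply_le (h.inner_yosida_le k.1) ht x
    have h2 := norm_exp_smul_apply_le (h.inner_yosida_le k.2) ht x
    have h3 := norm_sub_le (exp (t • h.yosida k.1) x) (exp (t • h.yosida k.2) x)
    simp only [sub_apply]
    linarith
  · rintro x ⟨y, hy⟩
    have hc := cauchySeq_iff_tendsto_dist_atTop_0.1 (h.tendsto_approxId le_rfl y).cauchySeq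
    rw [tendsto_zero_iff_norm_tendsto_zero]
    refine squeeze_zero (fun _ => norm_nonneg _) (fun k => ?_) (by simpa using hc.const_mul t)
    have := norm_exp_smul_sub_le (h.inner_yosida_le k.1) (h.inner_yosida_le k.2)
      (h.yosida_comm _ _) ht x
    rwa [h.yosida_apply _ hy, h.yosida_apply _ hy, ← dist_eq_norm (h.approxId le_rfl k.1 y)] at this

theorem exists_tendsto_exp_yosida (h : IsQuasiMDissipative G 0) (t : ℝ) :
    ∃ f : E → E, Tendsto (fun n x => exp ((max t 0) • h.yosida n) x) atTop (𝓝 f) := by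
  choose f hf using fun x => cauchySeq_tendsto_of_complete
    (h.cauchySeq_exp_yosida (le_max_right t 0) x)
  exact ⟨f, tendsto_pi_nhds.2 hf⟩

/-- The limit `e^{t A}` of the semigroups `e^{t A_n}` generated by the Yosida approximations. -/
def expLim (h : IsQuasiMDissipative G 0) (t : ℝ) : E →L[ℝ] E :=
  continuousLinearMapOfTendsto (fun n => exp ((max t 0) • h.yosida n))
    (h.exists_tendsto_exp_yosida t).choose_spec

theorem tendsto_expLim_max (h : IsQuasiMDissipative G 0) (t : ℝ) (x : E) :
    Tendsto (fun n => exp ((max t 0) • h.yosida n) x) atTop (𝓝 (h.expLim t x)) :=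
  tendsto_pi_nhds.1 (h.exists_tendsto_exp_yosida t).choose_spec x

theorem tendsto_expLim (h : IsQuasiMDissipative G 0) {t : ℝ} (ht : 0 ≤ t) (x : E) :
    Tendsto (fun n => exp (t • h.yosida n) x) atTop (𝓝 (h.expLim t x)) := by
  simpa [max_eq_left ht] using h.tendsto_expLim_max t x

theorem norm_expLim_le (h : IsQuasiMDissipative G 0) (t : ℝ) (x : E) :
    ‖h.expLim t x‖ ≤ ‖x‖ :=
  le_of_tendsto (h.tendsto_expLim_max t x).norm
    (Eventually.of_forall fun n =>
      norm_exp_smul_apply_le (h.inner_yosida_le n) (le_max_right _ _) x)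

theorem expLim_zero (h : IsQuasiMDissipative G 0) : h.expLim 0 = ContinuousLinearMap.id ℝ E := by
  ext x
  refine tendsto_nhds_unique (h.tendsto_expLim le_rfl x) ?_
  simp

theorem expLim_add (h : IsQuasiMDissipative G 0) {s t : ℝ} (hs : 0 ≤ s) (ht : 0 ≤ t) :
    h.expLim (s + t) = (h.expLim s).comp (h.expLim t) := by
  ext x
  refine tendsto_nhds_unique (h.tendsto_expLim (add_nonneg hs ht) x) ?_
  have h1 := h.tendsto_expLim hs (h.expLim t x)
  have h2 : Tendsto (fun n => exp (s • h.yosida n) (exp (t • h.yosida n) x - h.expLim t x)) atTop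
      (𝓝 0) := by
    rw [tendsto_zero_iff_norm_tendsto_zero]
    refine squeeze_zero (fun _ => norm_nonneg _)
      (fun n => norm_exp_smul_apply_le (h.inner_yosida_le n) hs _) ?_
    exact tendsto_iff_norm_sub_tendsto_zero.1 (h.tendsto_expLim ht x)
  have h3 := h2.add h1
  rw [zero_add] at h3
  refine h3.congr fun n => ?_
  have e : exp ((s + t) • h.yosida n) = exp (s • h.yosida n) * exp (t • h.yosida n) := by
    rw [add_smul]
    let _ : NormedAlgebra ℚ (E →L[ℝ] E) := NormedAlgebra.restrictScalars ℚ ℝ _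
    exact NormedSpace.exp_add_of_commute
      (((Commute.refl (h.yosida n)).smul_left s).smul_right t)
  rw [e, map_sub, sub_add_cancel]
  rfl

/-- Limit of the same identity for the bounded operators A_n; the integrands e^{s A_n} J_n A x are
dominated by 2 ‖A x‖. -/
theorem expLim_sub_eq_integral (h : IsQuasiMDissipative G 0) {x y : E} (hxy : (x, y) ∈ G) {t : ℝ}
    (ht : 0 ≤ t) : h.expLim t x - x = ∫ s in (0 : ℝ)..t, h.expLim s y := by
  have e : ∀ n, exp (t • h.yosida n) x - x
      = ∫ s in (0 : ℝ)..t, exp (s • h.yosida n) (h.yosida n x) := by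
    intro n
    have hd : ∀ s : ℝ, HasDerivAt (fun s : ℝ => exp (s • h.yosida n) x)
        (exp (s • h.yosida n) (h.yosida n x)) s := fun s => by
      have := (hasDerivAt_exp_smul_const (h.yosida n) s).clm_apply (hasDerivAt_const s x)
      simpa using this
    have hcont : Continuous fun s : ℝ => exp (s • h.yosida n) (h.yosida n x) :=
      continuous_iff_continuousAt.2 fun s => (hasDerivAt_exp_smul_apply _ _ s).continuousAt
    rw [intervalIntegral.integral_eq_sub_of_hasDerivAt (fun s _ => hd s)
      (hcont.intervalIntegrable _ _)]
    simp
  refine tendsto_nhds_unique ((h.tendsto_expLim ht x).sub_const x) ?_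
  simp only [e]
  refine intervalIntegral.tendsto_integral_filter_of_dominated_convergence (fun _ => 2 * ‖y‖)
    (Eventually.of_forall fun n => ?_) (Eventually.of_forall fun n => ?_) (by simp) ?_
  · have hcont : Continuous fun s : ℝ => exp (s • h.yosida n) (h.yosida n x) :=
      continuous_iff_continuousAt.2 fun s => (hasDerivAt_exp_smul_apply _ _ s).continuousAt
    exact hcont.aestronglyMeasurable
  · refine ae_of_all _ fun s hs => ?_
    rw [uIoc_of_le ht] at hs
    refine (norm_exp_smul_apply_le (h.inner_yosida_le n) hs.1.le _).trans ?_
    rw [h.yosida_apply n hxy]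
    exact h.norm_approxId_le le_rfl n y
  · refine ae_of_all _ fun s hs => ?_
    rw [uIoc_of_le ht] at hs
    have h1 := h.tendsto_expLim hs.1.le y
    have h2 : Tendsto (fun n => exp (s • h.yosida n) (h.yosida n x - y)) atTop (𝓝 0) := by
      rw [tendsto_zero_iff_norm_tendsto_zero]
      refine squeeze_zero (fun _ => norm_nonneg _)
        (fun n => norm_exp_smul_apply_le (h.inner_yosida_le n) hs.1.le _) ?_
      simp only [h.yosida_apply _ hxy]
      exact tendsto_iff_norm_sub_tendsto_zero.1 (h.tendsto_approxId le_rfl y)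
    have h3 := h2.add h1
    rw [zero_add] at h3
    refine h3.congr fun n => ?_
    rw [map_sub, sub_add_cancel]

/-- On the domain the approximating orbits are Lipschitz with constant 2 ‖A x‖, uniformly in n. -/
theorem continuous_expLim (h : IsQuasiMDissipative G 0) (x : E) :
    Continuous fun t => h.expLim t x := by
  rw [continuous_iff_continuousAt]
  intro t
  rw [ContinuousAt, tendsto_iff_norm_sub_tendsto_zero, ← tendsto_zero_iff_norm_tendsto_zero]
  refine tendsto_zero_of_dense (P := fun s => h.expLim s - h.expLim t)
    (C := 2) (fun s x => ?_) h.dense_domain ?_ x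
  · have h1 := h.norm_expLim_le s x
    have h2 := h.norm_expLim_le t x
    have h3 := norm_sub_le (h.expLim s x) (h.expLim t x)
    simp only [sub_apply]
    linarith
  · rintro x ⟨y, hy⟩
    have key : ∀ s, ‖h.expLim s x - h.expLim t x‖ ≤ 2 * ‖y‖ * |s - t| := by
      intro s
      refine le_of_tendsto ((h.tendsto_expLim_max s x).sub (h.tendsto_expLim_max t x)).norm
        (Eventually.of_forall fun n => ?_)
      have h1 := (convex_Ici (0 : ℝ)).norm_image_sub_le_of_norm_hasDerivWithin_le
        (f := fun s : ℝ => exp (s • h.yosida n) x) (C := 2 * ‖y‖)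
        (f' := fun s => exp (s • h.yosida n) (h.yosida n x))
        (fun s _ => HasDerivAt.hasDerivWithinAt (by
          have := (hasDerivAt_exp_smul_const (h.yosida n) s).clm_apply (hasDerivAt_const s x)
          simpa using this)) (fun s hs => by
          refine (norm_exp_smul_apply_le (h.inner_yosida_le n) hs _).trans ?_
          rw [h.yosida_apply n hy]
          exact h.norm_approxId_le le_rfl n y) (le_max_right t 0) (le_max_right s 0)
      refine h1.trans ?_
      gcongr
      rw [Real.norm_eq_abs]
      exact abs_max_sub_max_le_abs s t 0
    rw [tendsto_zero_iff_norm_tendsto_zero]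
    refine squeeze_zero (fun _ => norm_nonneg _) key ?_
    have : Continuous fun s => 2 * ‖y‖ * |s - t| := by fun_prop
    simpa using this.tendsto t

/-- The contraction semigroup generated by an m-dissipative operator. -/
def semigroup (h : IsQuasiMDissipative G 0) : C0Semigroup E where
  op := h.expLim
  op_zero := h.expLim_zero
  op_add _ _ hs ht := h.expLim_add hs ht
  continuousOn_orbit x := (h.continuous_expLim x).continuousOn

end IsQuasiMDissipative

/-- If the generator of `S` extends a quasi-m-dissipative operator and `‖S(t)‖ ≤ 1`, it is equal
to that operator. -/
theorem isGeneratedBy_of_forall_mem {G : Submodule ℝ (E × E)} (h : IsQuasiMDissipative G 0)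
    (S : C0Semigroup E) (hS : ∀ t x, 0 ≤ t → ‖S.op t x‖ ≤ ‖x‖)
    (hG : ∀ x y, (x, y) ∈ G → Tendsto (fun t : ℝ => t⁻¹ • (S.op t x - x)) (𝓝[>] 0) (𝓝 y)) :
    S.IsGeneratedBy fun x y => (x, y) ∈ G := by
  refine fun x y => ⟨fun hxy => ?_, hG x y⟩
  -- Choose x' in the domain with x' - A x' = x - y. For z = x - x' the difference quotients of S(t)
  -- z then tend to z itself, whereas contractivity gives ⟪S(t) z - z, z⟫ ≤ 0; hence ‖z‖² ≤ 0.
  obtain ⟨⟨x', y'⟩, hp, hp'⟩ := h.exists_resolvent 1 one_pos (x - y)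
  simp only [one_smul] at hp'
  have e : y - y' = x - x' := by
    rw [sub_eq_sub_iff_add_eq_add] at hp' ⊢
    rw [add_comm y, hp']
  have h1 : Tendsto (fun t : ℝ => t⁻¹ • (S.op t (x - x') - (x - x'))) (𝓝[>] 0) (𝓝 (y - y')) := by
    refine (hxy.sub (hG _ _ hp)).congr fun t => ?_
    rw [← smul_sub, map_sub, sub_sub_sub_comm]
  rw [e] at h1
  have h2 : Tendsto (fun t : ℝ => inner ℝ (t⁻¹ • (S.op t (x - x') - (x - x'))) (x - x')) (𝓝[>] 0)
      (𝓝 (inner ℝ (x - x') (x - x'))) := h1.inner tendsto_const_nhds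
  have h3 : inner ℝ (x - x') (x - x') ≤ 0 := by
    refine le_of_tendsto h2 ?_
    filter_upwards [self_mem_nhdsWithin] with t ht
    rw [real_inner_smul_left, inner_sub_left, real_inner_self_eq_norm_sq]
    refine mul_nonpos_of_nonneg_of_nonpos (inv_nonneg.2 (le_of_lt ht)) ?_
    have h4 := real_inner_le_norm (S.op t (x - x')) (x - x')
    have h5 := hS t (x - x') (le_of_lt ht)
    nlinarith [norm_nonneg (x - x')]
  have h6 : x = x' := sub_eq_zero.1 (by
    rw [real_inner_self_eq_norm_sq] at h3
    exact norm_eq_zero.1 (pow_eq_zero_iff two_ne_zero |>.1 (le_antisymm h3 (sq_nonneg _))))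
  subst h6
  have h7 : y = y' := by simpa using hp'.symm
  rw [h7]
  exact hp

theorem IsQuasiMDissipative.isGeneratedBy_semigroup {G : Submodule ℝ (E × E)}
    (h : IsQuasiMDissipative G 0) : h.semigroup.IsGeneratedBy fun x y => (x, y) ∈ G := by
  refine isGeneratedBy_of_forall_mem h _ (fun t x _ => h.norm_expLim_le t x) fun x y hxy => ?_
  have hd : HasDerivAt (fun t => ∫ s in (0 : ℝ)..t, h.expLim s y) y 0 := by
    have := intervalIntegral.integral_hasDerivAt_right
      ((h.continuous_expLim y).intervalIntegrable 0 0)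
      ((h.continuous_expLim y).stronglyMeasurableAtFilter _ _) (h.continuous_expLim y).continuousAt
    rwa [h.expLim_zero] at this
  have h1 := hd.hasDerivWithinAt (s := Ioi 0)
  rw [hasDerivWithinAt_iff_tendsto_slope' (by simp)] at h1
  refine h1.congr' ?_
  filter_upwards [self_mem_nhdsWithin] with t ht
  rw [slope_def_module, intervalIntegral.integral_same, sub_zero, sub_zero,
    ← h.expLim_sub_eq_integral hxy (le_of_lt ht)]
  rfl

/-- The semigroup `e^{κ t} S(t)`. -/
def C0Semigroup.scale (S : C0Semigroup E) (κ : ℝ) : C0Semigroup E where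
  op t := Real.exp (κ * t) • S.op t
  op_zero := by simp [S.op_zero]
  op_add s t hs ht := by
    ext x
    simp [S.op_add s t hs ht, mul_add, Real.exp_add, mul_smul]
    rw [smul_comm]
  continuousOn_orbit x := by
    have := S.continuousOn_orbit x
    simp only [smul_apply]
    fun_prop

theorem C0Semigroup.tendsto_op_zero (S : C0Semigroup E) (x : E) :
    Tendsto (fun t => S.op t x) (𝓝[>] 0) (𝓝 x) := by
  have h1 := (S.continuousOn_orbit x) 0 self_mem_Ici
  rw [ContinuousWithinAt, S.op_zero] at h1
  exact h1.mono_left (nhdsWithin_mono _ Ioi_subset_Ici_self)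

theorem C0Semigroup.tendsto_scale (S : C0Semigroup E) (κ : ℝ) {x y : E}
    (h : Tendsto (fun t : ℝ => t⁻¹ • (S.op t x - x)) (𝓝[>] 0) (𝓝 y)) :
    Tendsto (fun t : ℝ => t⁻¹ • ((S.scale κ).op t x - x)) (𝓝[>] 0) (𝓝 (y + κ • x)) := by
  have h1 : Tendsto (fun t : ℝ => t⁻¹ * (Real.exp (κ * t) - 1)) (𝓝[>] 0) (𝓝 κ) := by
    have hd : HasDerivAt (fun t : ℝ => Real.exp (κ * t)) κ 0 := by
      have := ((hasDerivAt_id (0 : ℝ)).const_mul κ).exp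
      simpa using this
    have h1 := hd.hasDerivWithinAt (s := Ioi 0)
    rw [hasDerivWithinAt_iff_tendsto_slope' (by simp)] at h1
    refine h1.congr fun t => ?_
    rw [slope_def_field, div_eq_inv_mul]
    simp
  have h2 := h.add (h1.smul (S.tendsto_op_zero x))
  refine h2.congr fun t => ?_
  simp only [C0Semigroup.scale, smul_apply]
  rw [mul_smul, ← smul_add, sub_smul, one_smul]
  congr 1
  abel

/-- A quasi-m-dissipative operator in a Hilbert space generates a strongly continuous semigroup. -/
theorem IsQuasiMDissipative.exists_semigroup {G : Submodule ℝ (E × E)} {κ : ℝ}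
    (h : IsQuasiMDissipative G κ) :
    ∃ S : C0Semigroup E, S.IsGeneratedBy fun x y => (x, y) ∈ G := by
  -- `G'` is the graph of A - κ, which is dissipative; the factor e^{κ t} afterwards restores A.
  let φ : E × E →ₗ[ℝ] E × E :=
    (LinearMap.fst ℝ E E).prod (LinearMap.snd ℝ E E + κ • LinearMap.fst ℝ E E)
  let G' : Submodule ℝ (E × E) := G.comap φ
  have hG' : ∀ x y, (x, y) ∈ G' ↔ (x, y + κ • x) ∈ G := fun x y => Iff.rfl
  have h' : IsQuasiMDissipative G' 0 := by
    refine ⟨?_, ?_, ?_⟩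
    · rintro ⟨x, y⟩ hp
      have := h.inner_le _ ((hG' x y).1 hp)
      rw [inner_add_left, real_inner_smul_left, real_inner_self_eq_norm_sq] at this
      dsimp only at this ⊢
      linarith
    · intro μ hμ f
      obtain ⟨⟨x, y⟩, hp, hpf⟩ := h.exists_resolvent (μ + κ) (by linarith) f
      refine ⟨(x, y - κ • x), ?_, ?_⟩
      · rw [hG']
        simpa using hp
      · rw [← hpf]
        simp only [add_smul]
        abel
    · intro y hy
      exact h.eq_zero_of_zero y (by simpa using (hG' 0 y).1 hy)
  refine ⟨h'.semigroup.scale κ, fun x y => ⟨fun hxy => ?_, fun hxy => ?_⟩⟩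
  -- For the converse, multiply by e^{-κ t} again to return to the contraction semigroup, whose
  -- generator is known.
  · have e : (h'.semigroup.scale κ).scale (-κ) = h'.semigroup := by
      simp only [C0Semigroup.scale, smul_smul, ← Real.exp_add]
      simp
    have h1 := C0Semigroup.tendsto_scale _ (-κ) hxy
    rw [e] at h1
    have h2 := (hG' _ _).1 ((h'.isGeneratedBy_semigroup _ _).1 h1)
    simpa using h2
  · have h1 : (x, y - κ • x) ∈ G' := by
      rw [hG']
      simpa using hxy
    simpa using C0Semigroup.tendsto_scale _ κ ((h'.isGeneratedBy_semigroup _ _).2 h1)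

end Generation

/-! ### Orbits of a semigroup with quasi-m-dissipative generator -/

section Orbit

variable {E : Type*} [NormedAddCommGroup E] [InnerProductSpace ℝ E] [CompleteSpace E]

namespace C0Semigroup

variable {G : Submodule ℝ (E × E)} {κ : ℝ} {S : C0Semigroup E}

/-- S(t) commutes with the difference quotients at zero, hence with the generator. -/
theorem IsGeneratedBy.op_mem (hS : S.IsGeneratedBy fun x y => (x, y) ∈ G) {x y : E}
    (hxy : (x, y) ∈ G) {t : ℝ} (ht : 0 ≤ t) : (S.op t x, S.op t y) ∈ G := by
  refine (hS _ _).1 ?_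
  have h1 := ((S.op t).continuous.tendsto y).comp ((hS x y).2 hxy)
  refine h1.congr' ?_
  filter_upwards [self_mem_nhdsWithin] with h hh
  have e : S.op h (S.op t x) = S.op t (S.op h x) := by
    have h1 := S.op_add h t (le_of_lt hh) ht
    rw [add_comm, S.op_add t h ht (le_of_lt hh)] at h1
    exact congrArg (fun T : E →L[ℝ] E => T x) h1.symm
  simp [e]

/-- Only the right derivative is needed: the comparison theorem in `energy_le` is one-sided. -/
theorem IsGeneratedBy.hasDerivWithinAt (hS : S.IsGeneratedBy fun x y => (x, y) ∈ G) {x y : E}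
    (hxy : (x, y) ∈ G) {t : ℝ} (ht : 0 ≤ t) :
    HasDerivWithinAt (fun t => S.op t x) (S.op t y) (Ici t) t := by
  rw [← hasDerivWithinAt_Ioi_iff_Ici, hasDerivWithinAt_iff_tendsto_slope' self_notMem_Ioi]
  have h1 := (hS _ _).2 (hS.op_mem hxy ht)
  have h2 : Tendsto (fun r : ℝ => r - t) (𝓝[>] t) (𝓝[>] 0) := by
    refine tendsto_nhdsWithin_iff.2 ⟨?_, ?_⟩
    · have : Tendsto (fun r : ℝ => r - t) (𝓝 t) (𝓝 (t - t)) :=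
        (continuous_id.sub continuous_const).tendsto t
      rw [sub_self] at this
      exact this.mono_left nhdsWithin_le_nhds
    · filter_upwards [self_mem_nhdsWithin] with r hr
      exact sub_pos.2 (mem_Ioi.1 hr)
  refine (h1.comp h2).congr' ?_
  filter_upwards [self_mem_nhdsWithin] with r hr
  have h3 := S.op_add (r - t) t (sub_nonneg.2 (le_of_lt hr)) ht
  rw [sub_add_cancel] at h3
  simp only [Function.comp_apply, slope_def_module, h3, ContinuousLinearMap.comp_apply]

/-- With the integrating factor e^{-2κt} the left side is continuous in t and has nonpositive right
derivative. The function q leaves room for the coercive term. -/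
theorem IsGeneratedBy.energy_le (hS : S.IsGeneratedBy fun x y => (x, y) ∈ G) {x y : E}
    (hxy : (x, y) ∈ G) {q : ℝ → ℝ} (hq : Continuous q)
    (hle : ∀ t, 0 ≤ t → 2 * inner ℝ (S.op t y) (S.op t x) + q t ≤ 2 * κ * ‖S.op t x‖ ^ 2)
    {t : ℝ} (ht : 0 ≤ t) :
    Real.exp (-(2 * κ) * t) * ‖S.op t x‖ ^ 2 + ∫ r in (0 : ℝ)..t, Real.exp (-(2 * κ) * r) * q r
      ≤ ‖x‖ ^ 2 := by
  have hq' : Continuous fun r => Real.exp (-(2 * κ) * r) * q r := by fun_prop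
  have hint : ∀ r, HasDerivAt (fun t => ∫ r in (0 : ℝ)..t, Real.exp (-(2 * κ) * r) * q r)
      (Real.exp (-(2 * κ) * r) * q r) r := fun r =>
    intervalIntegral.integral_hasDerivAt_right (hq'.intervalIntegrable _ _)
      (hq'.stronglyMeasurableAtFilter _ _) hq'.continuousAt
  have hexp : ∀ r : ℝ, HasDerivAt (fun t : ℝ => Real.exp (-(2 * κ) * t))
      (Real.exp (-(2 * κ) * r) * (-(2 * κ))) r := fun r => by
    simpa using ((hasDerivAt_id r).const_mul (-(2 * κ))).exp
  have hcont : ContinuousOn (fun t => S.op t x) (Icc 0 t) :=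
    (S.continuousOn_orbit x).mono Icc_subset_Ici_self
  have key := image_le_of_deriv_right_le_deriv_boundary (a := 0) (b := t)
    (f := fun t => Real.exp (-(2 * κ) * t) * ‖S.op t x‖ ^ 2
      + ∫ r in (0 : ℝ)..t, Real.exp (-(2 * κ) * r) * q r)
    (f' := fun r => Real.exp (-(2 * κ) * r) * (-(2 * κ)) * ‖S.op r x‖ ^ 2
      + Real.exp (-(2 * κ) * r) * (2 * inner ℝ (S.op r x) (S.op r y))
      + Real.exp (-(2 * κ) * r) * q r) ?_ ?_ (B := fun _ => ‖x‖ ^ 2) (B' := fun _ => 0) ?_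
      continuousOn_const (fun _ _ => hasDerivWithinAt_const _ _ _) ?_
      (right_mem_Icc.2 ht)
  · exact key
  · refine ContinuousOn.add (by fun_prop) ?_
    exact fun r _ => (hint r).continuousAt.continuousWithinAt
  · intro r hr
    exact ((hexp r).hasDerivWithinAt.mul (hS.hasDerivWithinAt hxy hr.1).norm_sq).add
      (hint r).hasDerivWithinAt
  · simp [S.op_zero]
  · intro r hr
    have h1 := hle r hr.1
    rw [real_inner_comm] at h1
    have h2 := Real.exp_pos (-(2 * κ) * r)
    have h3 : Real.exp (-(2 * κ) * r) * (-(2 * κ)) * ‖S.op r x‖ ^ 2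
      + Real.exp (-(2 * κ) * r) * (2 * inner ℝ (S.op r x) (S.op r y))
      + Real.exp (-(2 * κ) * r) * q r = Real.exp (-(2 * κ) * r) *
        (2 * inner ℝ (S.op r x) (S.op r y) + q r - 2 * κ * ‖S.op r x‖ ^ 2) := by ring
    rw [h3]
    exact mul_nonpos_of_nonneg_of_nonpos h2.le (by linarith)

/-- The energy inequality with q = 0 on the domain, extended by density. It depends on the generator
alone, not on how S was constructed. -/
theorem IsGeneratedBy.norm_op_le (hS : S.IsGeneratedBy fun x y => (x, y) ∈ G)
    (hG : IsQuasiMDissipative G κ) {t : ℝ} (ht : 0 ≤ t) (x : E) :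
    ‖S.op t x‖ ≤ Real.exp (κ * t) * ‖x‖ := by
  refine hG.dense_domain.induction (P := fun x => ‖S.op t x‖ ≤ Real.exp (κ * t) * ‖x‖) ?_
    (isClosed_le (by fun_prop) (by fun_prop)) x
  rintro x ⟨y, hxy⟩
  have h1 := hS.energy_le (κ := κ) hxy (q := fun _ => 0) continuous_const (fun t ht => by
    have := hG.inner_le _ (hS.op_mem hxy ht)
    dsimp only at this
    linarith) ht
  simp only [mul_zero, intervalIntegral.integral_zero, add_zero] at h1
  have e : Real.exp (-(2 * κ) * t) = (Real.exp (κ * t) ^ 2)⁻¹ := by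
    rw [← Real.exp_nat_mul, ← Real.exp_neg]
    congr 1
    push_cast
    ring
  rw [e, inv_mul_le_iff₀ (by positivity), ← mul_pow] at h1
  exact (sq_le_sq₀ (norm_nonneg _) (by positivity)).1 h1

theorem IsGeneratedBy.norm_op_le_of_le (hS : S.IsGeneratedBy fun x y => (x, y) ∈ G)
    (hG : IsQuasiMDissipative G κ) (hκ : 0 ≤ κ) {t T : ℝ} (ht : 0 ≤ t) (hT : t ≤ T) (x : E) :
    ‖S.op t x‖ ≤ Real.exp (κ * T) * ‖x‖ := by
  refine (hS.norm_op_le hG ht x).trans ?_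
  gcongr

theorem IsGeneratedBy.op_resolvent (hS : S.IsGeneratedBy fun x y => (x, y) ∈ G)
    (hG : IsQuasiMDissipative G κ) {μ : ℝ} (hμ : κ < μ) {t : ℝ} (ht : 0 ≤ t) (x : E) :
    S.op t (hG.resolvent hμ x) = hG.resolvent hμ (S.op t x) := by
  have h1 := hG.resolvent_sub hμ (hS.op_mem (hG.resolvent_mem hμ x) ht)
  have e : μ • S.op t (hG.resolvent hμ x) - S.op t (μ • hG.resolvent hμ x - x) = S.op t x := by
    rw [map_sub, map_smul, sub_sub_cancel]
  rw [← e]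
  exact h1.symm

/-- Strong continuity and the locally uniform operator bound give joint continuity, the source of
joint measurability of the Duhamel kernel. -/
theorem IsGeneratedBy.continuous_uncurry (hS : S.IsGeneratedBy fun x y => (x, y) ∈ G)
    (hG : IsQuasiMDissipative G κ) : Continuous fun p : ℝ × E => S.op (max p.1 0) p.2 := by
  have horb : ∀ x, Continuous fun t : ℝ => S.op (max t 0) x := fun x =>
    (S.continuousOn_orbit x).comp_continuous (by fun_prop) fun t => le_max_right t 0
  rw [continuous_iff_continuousAt]
  rintro ⟨t, x⟩
  rw [ContinuousAt, tendsto_iff_norm_sub_tendsto_zero]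
  have h1 : Tendsto (fun p : ℝ × E => Real.exp (κ * (max p.1 0)) * ‖p.2 - x‖
      + ‖S.op (max p.1 0) x - S.op (max t 0) x‖) (𝓝 (t, x)) (𝓝 0) := by
    have hc : Continuous (fun p : ℝ × E => Real.exp (κ * (max p.1 0)) * ‖p.2 - x‖
      + ‖S.op (max p.1 0) x - S.op (max t 0) x‖) := by
      have := (horb x).comp (continuous_fst (X := ℝ) (Y := E))
      have h3 : Continuous (fun p : ℝ × E => S.op (max p.1 0) x) := this
      fun_prop
    simpa using hc.tendsto (t, x)
  refine squeeze_zero (fun _ => norm_nonneg _) (fun p => ?_) h1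
  calc ‖S.op (max p.1 0) p.2 - S.op (max t 0) x‖
      = ‖S.op (max p.1 0) (p.2 - x) + (S.op (max p.1 0) x - S.op (max t 0) x)‖ := by
        rw [map_sub]; abel_nf
    _ ≤ _ := norm_add_le _ _
    _ ≤ _ := by
        gcongr
        exact hS.norm_op_le hG (le_max_right _ _) _

end C0Semigroup

end Orbit

/-! ### Minkowski's integral inequality -/

/-- Write the square of the inner integral as a double integral, exchange the order by Tonelli, and
apply Cauchy–Schwarz in t to F(t, s) F(t, s'). -/
theorem lintegral_sq_lintegral_le {α β : Type*} [MeasurableSpace α] [MeasurableSpace β]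
    {μ : Measure α} {ν : Measure β} [SFinite μ] [SFinite ν] {F : α → β → ℝ≥0∞}
    (hF : Measurable (Function.uncurry F)) :
    ∫⁻ t, (∫⁻ s, F t s ∂ν) ^ 2 ∂μ ≤ (∫⁻ s, (∫⁻ t, F t s ^ 2 ∂μ) ^ (1 / 2 : ℝ) ∂ν) ^ 2 := by
  have hFt : ∀ t, Measurable (F t) := fun t => hF.comp measurable_prodMk_left
  have hFs : ∀ s, Measurable fun t => F t s := fun s => hF.comp measurable_prodMk_right
  have hA : Measurable fun s => (∫⁻ t, F t s ^ 2 ∂μ) ^ (1 / 2 : ℝ) :=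
    (Measurable.lintegral_prod_left' (f := fun p : α × β => F p.1 p.2 ^ 2)
      (hF.pow_const 2)).pow_const _
  have hm2 : Measurable fun p : α × β => F p.1 p.2 := hF
  have e1 : ∀ t, (∫⁻ s, F t s ∂ν) ^ 2 = ∫⁻ s, ∫⁻ s', F t s * F t s' ∂ν ∂ν := by
    intro t
    simp_rw [lintegral_const_mul _ (hFt t)]
    rw [lintegral_mul_const _ (hFt t), sq]
  have hm3 : Measurable fun p : α × β => ∫⁻ s', F p.1 p.2 * F p.1 s' ∂ν := by
    refine Measurable.lintegral_prod_right' (f := fun q : (α × β) × β => F q.1.1 q.1.2 * F q.1.1 q.2) ?_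
    exact (hm2.comp measurable_fst).mul
      (hm2.comp ((measurable_fst.comp measurable_fst).prodMk measurable_snd))
  calc ∫⁻ t, (∫⁻ s, F t s ∂ν) ^ 2 ∂μ = ∫⁻ t, ∫⁻ s, ∫⁻ s', F t s * F t s' ∂ν ∂ν ∂μ := by
        simp_rw [e1]
    _ = ∫⁻ s, ∫⁻ t, ∫⁻ s', F t s * F t s' ∂ν ∂μ ∂ν := by
        rw [lintegral_lintegral_swap]
        exact hm3.aemeasurable
    _ = ∫⁻ s, ∫⁻ s', ∫⁻ t, F t s * F t s' ∂μ ∂ν ∂ν := by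
        refine lintegral_congr fun s => ?_
        rw [lintegral_lintegral_swap]
        exact (((hFs s).comp measurable_fst).mul hm2).aemeasurable
    _ ≤ ∫⁻ s, ∫⁻ s', (∫⁻ t, F t s ^ 2 ∂μ) ^ (1 / 2 : ℝ) * (∫⁻ t, F t s' ^ 2 ∂μ) ^ (1 / 2 : ℝ)
          ∂ν ∂ν := by
        refine lintegral_mono fun s => lintegral_mono fun s' => ?_
        have := ENNReal.lintegral_mul_le_Lp_mul_Lq μ (p := 2) (q := 2) (by constructor <;> norm_num)
          (hFs s).aemeasurable (hFs s').aemeasurable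
        simpa using this
    _ = _ := by
        simp_rw [lintegral_const_mul _ hA]
        rw [lintegral_mul_const _ hA, sq]

/-! ### Mild solutions -/

section Duhamel

variable {E : Type*} [NormedAddCommGroup E] [InnerProductSpace ℝ E] [CompleteSpace E]

namespace C0Semigroup

variable {G : Submodule ℝ (E × E)} {κ T : ℝ} {S : C0Semigroup E} {g : ℝ → E}

/-- The integrand of Duhamel's formula, extended by zero to all times. -/
def kernel (S : C0Semigroup E) (g : ℝ → E) (t s : ℝ) : E :=
  if s < t then S.op (max (t - s) 0) (g s) else 0

/-- The clamp max (t - s) 0 changes nothing where s < t; it avoids the meaningless values of S at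
negative times, so that joint continuity applies. -/
theorem IsGeneratedBy.stronglyMeasurable_kernel (hS : S.IsGeneratedBy fun x y => (x, y) ∈ G)
    (hG : IsQuasiMDissipative G κ) (hg : StronglyMeasurable g) :
    StronglyMeasurable (Function.uncurry (S.kernel g)) := by
  have h1 : StronglyMeasurable fun p : ℝ × ℝ => (p.1 - p.2, g p.2) :=
    (by fun_prop : Continuous fun p : ℝ × ℝ => p.1 - p.2).stronglyMeasurable.prodMk
      (hg.comp_measurable measurable_snd)
  exact StronglyMeasurable.ite (measurableSet_lt measurable_snd measurable_fst)
    ((hS.continuous_uncurry hG).comp_stronglyMeasurable h1) stronglyMeasurable_const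

theorem IsGeneratedBy.norm_kernel_le (hS : S.IsGeneratedBy fun x y => (x, y) ∈ G)
    (hG : IsQuasiMDissipative G κ) (hκ : 0 ≤ κ) {t s : ℝ} (hs : 0 ≤ s) (ht : t ≤ T) :
    ‖S.kernel g t s‖ ≤ Real.exp (κ * T) * ‖g s‖ := by
  unfold kernel
  split_ifs with h
  · rw [max_eq_left (sub_nonneg.2 h.le)]
    exact hS.norm_op_le_of_le hG hκ (sub_nonneg.2 h.le) (by linarith) _
  · rw [norm_zero]
    positivity

theorem IsGeneratedBy.integrable_kernel (hS : S.IsGeneratedBy fun x y => (x, y) ∈ G)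
    (hG : IsQuasiMDissipative G κ) (hκ : 0 ≤ κ) (hg : StronglyMeasurable g)
    (hgi : Integrable g (vol T)) {t : ℝ} (ht : t ≤ T) : Integrable (S.kernel g t) (vol T) := by
  refine (hgi.norm.const_mul (Real.exp (κ * T))).mono'
    ((hS.stronglyMeasurable_kernel hG hg).comp_measurable
      measurable_prodMk_left).aestronglyMeasurable ?_
  filter_upwards [ae_restrict_mem measurableSet_Ioo] with s hs
  exact hS.norm_kernel_le hG hκ hs.1.le ht

theorem intervalIntegrable_of_kernel {t : ℝ} (ht : t ∈ Icc 0 T)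
    (h : Integrable (S.kernel g t) (vol T)) :
    IntervalIntegrable (fun s => S.op (t - s) (g s)) volume 0 t := by
  rw [intervalIntegrable_iff_integrableOn_Ioo_of_le ht.1]
  have h1 : IntegrableOn (S.kernel g t) (Ioo 0 t) :=
    IntegrableOn.mono_set h (Ioo_subset_Ioo_right ht.2)
  refine h1.congr_fun (fun s hs => ?_) measurableSet_Ioo
  simp [kernel, hs.2, hs.2.le]

/-- Extension by zero makes the domain of integration independent of t, as dominated convergence and
Minkowski's inequality require. -/
theorem duhamel_eq_integral_kernel {t : ℝ} (ht : t ∈ Icc 0 T) :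
    S.duhamel g t = ∫ s, S.kernel g t s ∂(vol T) := by
  have h1 : ∫ s in Ioo 0 T, S.kernel g t s = ∫ s in Ioo 0 t, S.kernel g t s := by
    refine (setIntegral_eq_of_subset_of_forall_sdiff_eq_zero measurableSet_Ioo
      (Ioo_subset_Ioo_right ht.2) fun s hs => ?_)
    have : ¬ s < t := fun h => hs.2 ⟨hs.1.1, h⟩
    simp [kernel, this]
  rw [h1, duhamel, intervalIntegral.integral_of_le ht.1, integral_Ioc_eq_integral_Ioo]
  refine setIntegral_congr_fun measurableSet_Ioo fun s hs => ?_
  simp [kernel, hs.2, hs.2.le]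

theorem IsGeneratedBy.continuousOn_duhamel (hS : S.IsGeneratedBy fun x y => (x, y) ∈ G)
    (hG : IsQuasiMDissipative G κ) (hκ : 0 ≤ κ) (hg : StronglyMeasurable g)
    (hgi : Integrable g (vol T)) : ContinuousOn (S.duhamel g) (Icc 0 T) := by
  have h1 : ContinuousOn (fun t => ∫ s, S.kernel g t s ∂(vol T)) (Icc 0 T) := by
    intro t ht
    refine continuousWithinAt_of_dominated (bound := fun s => Real.exp (κ * T) * ‖g s‖) ?_ ?_
      (hgi.norm.const_mul _) ?_
    · exact Eventually.of_forall fun t => ((hS.stronglyMeasurable_kernel hG hg).comp_measurable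
        measurable_prodMk_left).aestronglyMeasurable
    · filter_upwards [self_mem_nhdsWithin] with t ht
      filter_upwards [ae_restrict_mem measurableSet_Ioo] with s hs
      exact hS.norm_kernel_le hG hκ hs.1.le ht.2
    -- As a function of t the kernel can jump only at t = s, so for fixed t a single value of s is
    -- lost.
    · have hne : ∀ᵐ s ∂(vol T), s ≠ t := Measure.ae_ne _ _
      filter_upwards [hne] with s hs
      refine ContinuousAt.continuousWithinAt ?_
      rcases lt_or_gt_of_ne hs with h | h
      · have h2 : ContinuousAt (fun t => S.op (max (t - s) 0) (g s)) t := by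
          have := (hS.continuous_uncurry hG).comp
            (by fun_prop : Continuous fun t : ℝ => (t - s, g s))
          exact this.continuousAt
        refine h2.congr ?_
        filter_upwards [lt_mem_nhds h] with r hr
        simp [kernel, hr]
      · refine (continuousAt_const (y := (0 : E))).congr ?_
        filter_upwards [gt_mem_nhds h] with r hr
        simp [kernel, not_lt.2 (le_of_lt hr)]
  exact h1.congr fun t ht => duhamel_eq_integral_kernel ht

theorem IsGeneratedBy.norm_duhamel_le (hS : S.IsGeneratedBy fun x y => (x, y) ∈ G)
    (hG : IsQuasiMDissipative G κ) (hκ : 0 ≤ κ)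
    (hgi : Integrable g (vol T)) {t : ℝ} (ht : t ∈ Icc 0 T) :
    ‖S.duhamel g t‖ ≤ Real.exp (κ * T) * ∫ s, ‖g s‖ ∂(vol T) := by
  rw [duhamel_eq_integral_kernel ht, ← integral_const_mul]
  refine norm_integral_le_of_norm_le (hgi.norm.const_mul _) ?_
  filter_upwards [ae_restrict_mem measurableSet_Ioo] with s hs
  exact hS.norm_kernel_le hG hκ hs.1.le ht.2

end C0Semigroup

/-! ### Coercive operators and maps into the energy space. -/

variable {V : Type*} [NormedAddCommGroup V] [NormedSpace ℝ V]

/-- Coercivity: the domain of the operator with graph `G` embeds in `V`, and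
`⟪A x, x⟫ + ε ‖x‖_V² ≤ κ ‖x‖²`. -/
def IsCoercive (G : Submodule ℝ (E × E)) (κ ε : ℝ) (ι : V →L[ℝ] E) : Prop :=
  ∀ p ∈ G, ∃ v : V, ι v = p.1 ∧ inner ℝ p.2 p.1 + ε * ‖v‖ ^ 2 ≤ κ * ‖p.1‖ ^ 2

variable {G : Submodule ℝ (E × E)} {κ ε T : ℝ} {S : C0Semigroup E} {ι : V →L[ℝ] E}

/-- The resolvent takes values in the domain, hence in the image of V. The lift is linear because ι
is injective, and bounded because ε ‖P x‖² ≤ κ ‖R x‖² - ⟪μ R x - x, R x⟫, where R is the resolvent.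
-/
theorem IsCoercive.exists_lift_resolvent (hV : IsCoercive G κ ε ι) (hι : Function.Injective ι)
    (hG : IsQuasiMDissipative G κ) (hε : 0 < ε) {μ : ℝ} (hμ : κ < μ) :
    ∃ P : E →L[ℝ] V, ∀ x, ι (P x) = hG.resolvent hμ x := by
  choose v hv hv' using fun x => hV _ (hG.resolvent_mem hμ x)
  dsimp only at hv hv'
  set R := hG.resolvent hμ with hR
  set K : ℝ := (|κ| * ‖R‖ ^ 2 + (|μ| * ‖R‖ + 1) * ‖R‖) / ε with hK
  have hK0 : 0 ≤ K := by positivity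
  refine ⟨LinearMap.mkContinuous
    { toFun := v
      map_add' := fun x y => hι (by simp [hv])
      map_smul' := fun c x => hι (by simp [hv]) } (√K) fun x => ?_, hv⟩
  change ‖v x‖ ≤ _
  have h1 : ‖R x‖ ≤ ‖R‖ * ‖x‖ := R.le_opNorm x
  have h2 : ‖μ • R x - x‖ ≤ (|μ| * ‖R‖ + 1) * ‖x‖ := by
    refine (norm_sub_le _ _).trans ?_
    rw [norm_smul, Real.norm_eq_abs, add_mul, one_mul, mul_assoc]
    gcongr
  have h3 : -(‖μ • R x - x‖ * ‖R x‖) ≤ inner ℝ (μ • R x - x) (R x) :=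
    neg_le_of_abs_le (abs_real_inner_le_norm _ _)
  have h4 : ‖μ • R x - x‖ * ‖R x‖ ≤ ((|μ| * ‖R‖ + 1) * ‖x‖) * (‖R‖ * ‖x‖) := by gcongr
  have h5 : κ * ‖R x‖ ^ 2 ≤ |κ| * (‖R‖ * ‖x‖) ^ 2 := by
    gcongr
    exact le_abs_self κ
  have h6 : ‖v x‖ ^ 2 ≤ (√K * ‖x‖) ^ 2 := by
    rw [mul_pow, Real.sq_sqrt hK0, hK, div_mul_eq_mul_div, le_div_iff₀ hε]
    have := hv' x
    nlinarith
  exact (sq_le_sq₀ (norm_nonneg _) (by positivity)).1 h6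

/-- `Q` is an operator into `V` commuting with the semigroup whose values lie in the domain of the
generator. -/
structure IsLiftedMultiplier (S : C0Semigroup E) (G : Submodule ℝ (E × E)) (ι : V →L[ℝ] E)
    (Q : E →L[ℝ] V) : Prop where
  op_comm : ∀ t x, 0 ≤ t → ι (Q (S.op t x)) = S.op t (ι (Q x))
  mem_domain : ∀ x, ∃ y, (ι (Q x), y) ∈ G

/-- Needed for the Cauchy estimate, which applies the smoothing bound to a difference of two
multipliers. -/
theorem IsLiftedMultiplier.sub {Q Q' : E →L[ℝ] V} (h : IsLiftedMultiplier S G ι Q)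
    (h' : IsLiftedMultiplier S G ι Q') : IsLiftedMultiplier S G ι (Q - Q') where
  op_comm t x ht := by simp [h.op_comm t x ht, h'.op_comm t x ht]
  mem_domain x := by
    obtain ⟨y, hy⟩ := h.mem_domain x
    obtain ⟨y', hy'⟩ := h'.mem_domain x
    exact ⟨y - y', by simpa using G.sub_mem hy hy'⟩

/-- Energy inequality for the orbit of ι (Q x), which starts in the domain, with q(t) = 2 ε ‖Q S(t)
x‖². Passing through the bounded operator Q makes q continuous. -/
theorem IsLiftedMultiplier.lintegral_orbit_le (hV : IsCoercive G κ ε ι)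
    (hι : Function.Injective ι) (hG : IsQuasiMDissipative G κ) (hκ : 0 ≤ κ) (hε : 0 < ε)
    (hS : S.IsGeneratedBy fun x y => (x, y) ∈ G) {Q : E →L[ℝ] V} (hT : 0 ≤ T)
    (hQ : IsLiftedMultiplier S G ι Q) (x : E) :
    ∫⁻ t, ‖Q (S.op (max t 0) x)‖ₑ ^ 2 ∂(vol T)
      ≤ ENNReal.ofReal (Real.exp (2 * κ * T) / (2 * ε)) * ‖ι (Q x)‖ₑ ^ 2 := by
  have horb : Continuous fun t : ℝ => S.op (max t 0) x :=
    (hS.continuous_uncurry hG).comp (by fun_prop : Continuous fun t : ℝ => (t, x))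
  obtain ⟨y, hy⟩ := hQ.mem_domain x
  have h1 := hS.energy_le (κ := κ) hy (q := fun t => 2 * ε * ‖Q (S.op (max t 0) x)‖ ^ 2)
    (by fun_prop) (fun t ht => by
      obtain ⟨v, hv, hv'⟩ := hV _ (hS.op_mem hy ht)
      have e : v = Q (S.op (max t 0) x) := hι (by
        rw [hv, max_eq_left ht, hQ.op_comm t x ht])
      rw [← e]
      dsimp only at hv'
      linarith) hT
  have h2 : 0 ≤ Real.exp (-(2 * κ) * T) * ‖S.op T (ι (Q x))‖ ^ 2 := by positivity
  have hc : Continuous fun t => ‖Q (S.op (max t 0) x)‖ ^ 2 := by fun_prop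
  have h3 : ∫ r in (0 : ℝ)..T, ‖Q (S.op (max r 0) x)‖ ^ 2
      ≤ Real.exp (2 * κ * T) / (2 * ε) * ‖ι (Q x)‖ ^ 2 := by
    -- On [0, T] the weight e^{-2κr} is at least e^{-2κT}, as κ ≥ 0.
    have h4 : ∫ r in (0 : ℝ)..T, Real.exp (-(2 * κ) * T) * (2 * ε) * ‖Q (S.op (max r 0) x)‖ ^ 2
        ≤ ∫ r in (0 : ℝ)..T, Real.exp (-(2 * κ) * r) * (2 * ε * ‖Q (S.op (max r 0) x)‖ ^ 2) := by
      refine intervalIntegral.integral_mono_on hT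
        (Continuous.intervalIntegrable (by fun_prop) _ _)
        (Continuous.intervalIntegrable (by fun_prop) _ _) fun r hr => ?_
      rw [mul_assoc]
      refine mul_le_mul_of_nonneg_right (Real.exp_le_exp.2 ?_) (by positivity)
      have := mul_le_mul_of_nonneg_left hr.2 (by positivity : 0 ≤ 2 * κ)
      linarith
    rw [intervalIntegral.integral_const_mul] at h4
    have h5 := (h4.trans (le_of_add_le_of_nonneg_right h1 h2 : _ ≤ ‖ι (Q x)‖ ^ 2))
    have h6 : Real.exp (-(2 * κ) * T) * Real.exp (2 * κ * T) = 1 := by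
      rw [← Real.exp_add]
      simp
    rw [div_mul_eq_mul_div, le_div_iff₀ (by positivity)]
    calc (∫ r in (0 : ℝ)..T, ‖Q (S.op (max r 0) x)‖ ^ 2) * (2 * ε)
        = Real.exp (2 * κ * T) * (Real.exp (-(2 * κ) * T) * (2 * ε)
          * ∫ r in (0 : ℝ)..T, ‖Q (S.op (max r 0) x)‖ ^ 2) := by
          linear_combination (-(∫ r in (0 : ℝ)..T, ‖Q (S.op (max r 0) x)‖ ^ 2) * (2 * ε)) * h6
      _ ≤ _ := by gcongr
  rw [intervalIntegral.integral_of_le hT, integral_Ioc_eq_integral_Ioo] at h3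
  have e : ∀ t, ‖Q (S.op (max t 0) x)‖ₑ ^ 2 = ENNReal.ofReal (‖Q (S.op (max t 0) x)‖ ^ 2) :=
    fun t => by rw [ENNReal.ofReal_pow (norm_nonneg _), ofReal_norm]
  simp only [e]
  rw [← ofReal_norm, ← ENNReal.ofReal_pow (norm_nonneg _), ← ENNReal.ofReal_mul (by positivity),
    ← ofReal_integral_eq_lintegral_ofReal]
  · exact ENNReal.ofReal_le_ofReal h3
  · exact (hc.integrableOn_Icc (a := 0) (b := T)).mono_set Ioo_subset_Icc_self
  · exact ae_of_all _ fun t => by positivity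

end Duhamel

/-! ### Mild solutions in L²(0,T;V). -/

section MildRegularity

variable {E : Type*} [NormedAddCommGroup E] [InnerProductSpace ℝ E] [CompleteSpace E]
  {V : Type*} [NormedAddCommGroup V] [NormedSpace ℝ V]
  {G : Submodule ℝ (E × E)} {κ ε T : ℝ} {S : C0Semigroup E} {ι : V →L[ℝ] E} {g : ℝ → E}

/-- Minkowski's integral inequality moves the L² norm in t inside the s-integral, where the orbit
estimate applies to each g(s). The bound involves only ι (Q (g s)), so it survives as Q runs through
the lifts of J_n, whose norms into V are not controlled. -/
theorem IsLiftedMultiplier.eLpNorm_duhamel_le [CompleteSpace V] (hV : IsCoercive G κ ε ι)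
    (hι : Function.Injective ι) (hG : IsQuasiMDissipative G κ) (hκ : 0 ≤ κ) (hε : 0 < ε)
    (hS : S.IsGeneratedBy fun x y => (x, y) ∈ G) {Q : E →L[ℝ] V} (hT : 0 ≤ T)
    (hQ : IsLiftedMultiplier S G ι Q) (hg : StronglyMeasurable g) (hgi : Integrable g (vol T)) :
    eLpNorm (fun t => Q (S.duhamel g t)) 2 (vol T)
      ≤ ENNReal.ofReal (Real.exp (2 * κ * T) / (2 * ε)) ^ (1 / 2 : ℝ)
        * ∫⁻ s, ‖ι (Q (g s))‖ₑ ∂(vol T) := by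
  set K := ENNReal.ofReal (Real.exp (2 * κ * T) / (2 * ε)) with hK
  have hm : Measurable (Function.uncurry fun t s => ‖Q (S.kernel g t s)‖ₑ) :=
    (Q.continuous.comp_stronglyMeasurable (hS.stronglyMeasurable_kernel hG hg)).enorm
  have h1 : ∀ t ∈ Ioo 0 T, ‖Q (S.duhamel g t)‖ₑ ≤ ∫⁻ s, ‖Q (S.kernel g t s)‖ₑ ∂(vol T) := by
    intro t ht
    rw [C0Semigroup.duhamel_eq_integral_kernel (Ioo_subset_Icc_self ht),
      ← Q.integral_comp_comm (hS.integrable_kernel hG hκ hg hgi ht.2.le)]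
    exact enorm_integral_le_lintegral_enorm _
  have h2 : ∀ s ∈ Ioo 0 T, (∫⁻ t, ‖Q (S.kernel g t s)‖ₑ ^ 2 ∂(vol T))
      ≤ K * ‖ι (Q (g s))‖ₑ ^ 2 := by
    intro s hs
    refine le_trans ?_ (hQ.lintegral_orbit_le hV hι hG hκ hε hS hT (g s))
    -- The kernel vanishes for t ≤ s; the rest is the orbit of g(s) delayed by s.
    have e1 : ∫⁻ t, ‖Q (S.kernel g t s)‖ₑ ^ 2 ∂(vol T)
        ≤ ∫⁻ t in Ioo s T, ‖Q (S.op (max (t - s) 0) (g s))‖ₑ ^ 2 := by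
      rw [← lintegral_indicator measurableSet_Ioo, ← lintegral_indicator measurableSet_Ioo]
      refine lintegral_mono fun t => ?_
      by_cases h : s < t
      · by_cases h' : t < T
        · simp [indicator, hs.1.trans h, h, h', C0Semigroup.kernel]
        · simp [indicator, h']
      · simp [indicator, h, C0Semigroup.kernel]
    refine e1.trans ?_
    have e2 : ∫⁻ t in Ioo s T, ‖Q (S.op (max (t - s) 0) (g s))‖ₑ ^ 2
        = ∫⁻ t in Ioo 0 (T - s), ‖Q (S.op (max t 0) (g s))‖ₑ ^ 2 := by
      have := (measurePreserving_sub_right (volume : Measure ℝ) s).setLIntegral_comp_preimage_emb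
        (MeasurableEquiv.subRight s).measurableEmbedding
        (fun t => ‖Q (S.op (max t 0) (g s))‖ₑ ^ 2) (Ioo 0 (T - s))
      simpa using this
    rw [e2]
    exact lintegral_mono_set (Ioo_subset_Ioo_right (by linarith [hs.1]))
  have h3 : ∫⁻ t, ‖Q (S.duhamel g t)‖ₑ ^ 2 ∂(vol T)
      ≤ (K ^ (1 / 2 : ℝ) * ∫⁻ s, ‖ι (Q (g s))‖ₑ ∂(vol T)) ^ 2 := by
    calc ∫⁻ t, ‖Q (S.duhamel g t)‖ₑ ^ 2 ∂(vol T)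
        ≤ ∫⁻ t, (∫⁻ s, ‖Q (S.kernel g t s)‖ₑ ∂(vol T)) ^ 2 ∂(vol T) := by
          refine lintegral_mono_ae ?_
          filter_upwards [ae_restrict_mem measurableSet_Ioo] with t ht
          gcongr
          exact h1 t ht
      _ ≤ _ := lintegral_sq_lintegral_le hm
      _ ≤ _ := by
          gcongr
          have hmeas : Measurable fun s => ‖ι (Q (g s))‖ₑ :=
            ((ι.comp Q).continuous.comp_stronglyMeasurable hg).enorm
          rw [← lintegral_const_mul _ hmeas]
          refine lintegral_mono_ae ?_
          filter_upwards [ae_restrict_mem measurableSet_Ioo] with s hs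
          calc (∫⁻ t, ‖Q (S.kernel g t s)‖ₑ ^ 2 ∂(vol T)) ^ (1 / 2 : ℝ)
              ≤ (K * ‖ι (Q (g s))‖ₑ ^ 2) ^ (1 / 2 : ℝ) := by
                gcongr
                exact h2 s hs
            _ = _ := by
                rw [ENNReal.mul_rpow_of_nonneg _ _ (by norm_num), ← ENNReal.rpow_natCast,
                  ← ENNReal.rpow_mul]
                norm_num
  rw [eLpNorm_eq_lintegral_rpow_enorm_toReal (by norm_num) (by norm_num)]
  simp only [ENNReal.toReal_ofNat, ENNReal.rpow_ofNat]
  calc _ ≤ ((K ^ (1 / 2 : ℝ) * ∫⁻ s, ‖ι (Q (g s))‖ₑ ∂(vol T)) ^ 2) ^ (1 / 2 : ℝ) := by gcongr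
    _ = _ := by
      rw [← ENNReal.rpow_natCast, ← ENNReal.rpow_mul]
      norm_num

theorem tendsto_lintegral_approxId (hG : IsQuasiMDissipative G κ) (hκ : 0 ≤ κ)
    (hgi : Integrable g (vol T)) :
    Tendsto (fun n => ∫⁻ s, ‖hG.approxId hκ n (g s) - g s‖ₑ ∂(vol T)) atTop (𝓝 0) := by
  have h1 := tendsto_lintegral_of_dominated_convergence' (μ := vol T)
    (F := fun n s => ‖hG.approxId hκ n (g s) - g s‖ₑ) (f := fun _ => 0)
    (fun s => ENNReal.ofReal 3 * ‖g s‖ₑ) (fun n => ?_) (fun n => ae_of_all _ fun s => ?_) ?_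
    (ae_of_all _ fun s => ?_)
  · simpa using h1
  · exact (((hG.approxId hκ n).continuous.comp_aestronglyMeasurable
      hgi.aestronglyMeasurable).sub hgi.aestronglyMeasurable).enorm
  · dsimp only
    rw [← ofReal_norm, ← ofReal_norm, ← ENNReal.ofReal_mul (by norm_num)]
    refine ENNReal.ofReal_le_ofReal ((norm_sub_le _ _).trans ?_)
    linarith [hG.norm_approxId_le hκ n (g s)]
  · rw [lintegral_const_mul'' _ hgi.aestronglyMeasurable.enorm]
    exact ENNReal.mul_ne_top ENNReal.ofReal_ne_top hgi.hasFiniteIntegral.ne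
  · have := tendsto_iff_norm_sub_tendsto_zero.1 (hG.tendsto_approxId hκ (g s))
    have h2 := ENNReal.tendsto_ofReal this
    simpa [ofReal_norm] using h2

/-- J_n is a multiple of a resolvent, so it lifts to V, commutes with S and maps into the domain. -/
theorem exists_lift_approxId (hV : IsCoercive G κ ε ι) (hι : Function.Injective ι)
    (hG : IsQuasiMDissipative G κ) (hκ : 0 ≤ κ) (hε : 0 < ε)
    (hS : S.IsGeneratedBy fun x y => (x, y) ∈ G) (n : ℕ) :
    ∃ P : E →L[ℝ] V, (∀ x, ι (P x) = hG.approxId hκ n x) ∧ IsLiftedMultiplier S G ι P := by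
  obtain ⟨P, hP⟩ := hV.exists_lift_resolvent hι hG hε (IsQuasiMDissipative.lt_seq hκ n)
  have e : ∀ x, ι (((2 * κ + n + 1) • P) x) = hG.approxId hκ n x := fun x => by
    simp [hP, IsQuasiMDissipative.approxId]
  refine ⟨(2 * κ + n + 1) • P, e, fun t x ht => ?_, fun x => ?_⟩
  · rw [e, e]
    simp only [IsQuasiMDissipative.approxId, smul_apply, map_smul]
    rw [hS.op_resolvent hG _ ht]
  · rw [e]
    have h := G.smul_mem (2 * κ + n + 1) (hG.resolvent_mem (IsQuasiMDissipative.lt_seq hκ n) x)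
    rw [Prod.smul_mk] at h
    exact ⟨_, h⟩

/-- Smoothing estimate for mild solutions with right-hand side in `L¹(0, T; E)`. -/
theorem exists_lift_duhamel [CompleteSpace V] (hV : IsCoercive G κ ε ι)
    (hι : Function.Injective ι) (hG : IsQuasiMDissipative G κ) (hκ : 0 ≤ κ) (hε : 0 < ε)
    (hS : S.IsGeneratedBy fun x y => (x, y) ∈ G) (hT : 0 ≤ T) (hg : StronglyMeasurable g)
    (hgi : Integrable g (vol T)) :
    ∃ U : Lp V 2 (vol T), (∀ᵐ t ∂(vol T), S.duhamel g t = ι (U t)) ∧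
      ‖U‖ₑ ≤ ENNReal.ofReal (Real.exp (2 * κ * T) / (2 * ε)) ^ (1 / 2 : ℝ)
        * (ENNReal.ofReal 2 * ∫⁻ s, ‖g s‖ₑ ∂(vol T)) := by
  set K := ENNReal.ofReal (Real.exp (2 * κ * T) / (2 * ε)) ^ (1 / 2 : ℝ) with hK
  have hKt : K ≠ ⊤ := ENNReal.rpow_ne_top_of_nonneg (by norm_num) ENNReal.ofReal_ne_top
  choose P hP hPm using exists_lift_approxId hV hι hG hκ hε hS
  have hu := hS.continuousOn_duhamel hG hκ hg hgi
  have hmem : ∀ n, MemLp (fun t => P n (S.duhamel g t)) 2 (vol T) := by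
    intro n
    have hc : ContinuousOn (fun t => P n (S.duhamel g t)) (Icc 0 T) :=
      (P n).continuous.comp_continuousOn hu
    obtain ⟨C, hC⟩ := isCompact_Icc.exists_bound_of_continuousOn hc
    refine MemLp.of_bound ((hc.mono Ioo_subset_Icc_self).aestronglyMeasurable measurableSet_Ioo) C ?_
    filter_upwards [ae_restrict_mem measurableSet_Ioo] with t ht
    exact hC t (Ioo_subset_Icc_self ht)
  set W : ℕ → Lp V 2 (vol T) := fun n => (hmem n).toLp with hW
  set a : ℕ → ℝ≥0∞ := fun n => ∫⁻ s, ‖hG.approxId hκ n (g s) - g s‖ₑ ∂(vol T) with ha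
  have ha0 : Tendsto a atTop (𝓝 0) := tendsto_lintegral_approxId hG hκ hgi
  -- The smoothing bound for the multiplier P_n - P_m gives K ∫ ‖J_n g - J_m g‖ ≤ K (a_n + a_m).
  have hcau : CauchySeq W := by
    rw [cauchySeq_iff_tendsto_dist_atTop_0]
    simp only [dist_edist]
    refine (ENNReal.tendsto_toReal ENNReal.zero_ne_top).comp ?_
    have hlim : Tendsto (fun k : ℕ × ℕ => K * (a k.1 + a k.2)) atTop (𝓝 0) := by
      rw [← prod_atTop_atTop_eq]
      have := (ha0.comp (tendsto_fst (f := atTop) (g := (atTop : Filter ℕ)))).add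
        (ha0.comp (tendsto_snd (f := (atTop : Filter ℕ)) (g := atTop)))
      have := ENNReal.Tendsto.const_mul this (Or.inr hKt)
      simpa using this
    refine tendsto_of_tendsto_of_tendsto_of_le_of_le tendsto_const_nhds hlim (fun _ => zero_le)
      fun k => ?_
    have h1 := ((hPm k.1).sub (hPm k.2)).eLpNorm_duhamel_le hV hι hG hκ hε hS hT hg hgi
    have h2 : edist (W k.1) (W k.2)
        = eLpNorm (fun t => (P k.1 - P k.2) (S.duhamel g t)) 2 (vol T) := by
      rw [hW, Lp.edist_toLp_toLp]
      rfl
    rw [h2]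
    refine h1.trans ?_
    gcongr
    rw [← lintegral_add_left']
    · refine lintegral_mono fun s => ?_
      simp only [sub_apply, map_sub, hP]
      have : hG.approxId hκ k.1 (g s) - hG.approxId hκ k.2 (g s)
          = (hG.approxId hκ k.1 (g s) - g s) - (hG.approxId hκ k.2 (g s) - g s) := by abel
      rw [this]
      exact enorm_sub_le
    · exact (((hG.approxId hκ k.1).continuous.comp_aestronglyMeasurable
        hgi.aestronglyMeasurable).sub hgi.aestronglyMeasurable).enorm
  obtain ⟨U, hU⟩ := cauchySeq_tendsto_of_complete hcau
  refine ⟨U, ?_, ?_⟩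
  -- Along an a.e. convergent subsequence, ι (W_n(t)) = J_n u(t) tends both to ι (U(t)) and to u(t),
  -- where u is the Duhamel integral.
  · obtain ⟨ns, hns, hae⟩ := (tendstoInMeasure_of_tendsto_Lp hU).exists_seq_tendsto_ae
    have hW' : ∀ᵐ t ∂(vol T), ∀ n, W n t = P n (S.duhamel g t) :=
      ae_all_iff.2 fun n => (hmem n).coeFn_toLp
    filter_upwards [hae, hW'] with t ht htW
    have h1 := (ι.continuous.tendsto (U t)).comp ht
    have h2 : Tendsto (fun n => ι (W (ns n) t)) atTop (𝓝 (S.duhamel g t)) := by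
      simp only [htW, hP]
      exact (hG.tendsto_approxId hκ _).comp hns.tendsto_atTop
    exact tendsto_nhds_unique h2 h1
  · refine le_of_tendsto hU.enorm (Eventually.of_forall fun n => ?_)
    have h1 := (hPm n).eLpNorm_duhamel_le hV hι hG hκ hε hS hT hg hgi
    have h2 : ‖W n‖ₑ = eLpNorm (fun t => P n (S.duhamel g t)) 2 (vol T) := by
      rw [hW, Lp.enorm_toLp]
    rw [h2]
    refine h1.trans ?_
    gcongr
    rw [← lintegral_const_mul'' _ hgi.aestronglyMeasurable.enorm]
    refine lintegral_mono fun s => ?_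
    rw [hP, ← ofReal_norm, ← ofReal_norm, ← ENNReal.ofReal_mul (by norm_num)]
    exact ENNReal.ofReal_le_ofReal (hG.norm_approxId_le hκ n (g s))

/-- Well-posedness and regularity of mild solutions with right-hand side in `L¹(0, T; E)`. -/
theorem exists_mild_bound [CompleteSpace V] (hV : IsCoercive G κ ε ι)
    (hι : Function.Injective ι) (hG : IsQuasiMDissipative G κ) (hκ : 0 ≤ κ) (hε : 0 < ε)
    (hS : S.IsGeneratedBy fun x y => (x, y) ∈ G) (hT : 0 ≤ T) :
    ∃ C : ℝ, 0 < C ∧ ∀ g : Lp E 1 (vol T),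
      (∀ t ∈ Icc 0 T, IntervalIntegrable (fun s => S.op (t - s) (g s)) volume 0 t) ∧
      ContinuousOn (S.duhamel g) (Icc 0 T) ∧
      ∃ U : Lp V 2 (vol T), (∀ᵐ t ∂(vol T), S.duhamel g t = ι (U t)) ∧
        eLpNorm (S.duhamel g) ∞ (vol T) + ‖U‖ₑ ≤ ENNReal.ofReal C * ‖g‖ₑ := by
  -- The first summand bounds the sup norm in E, the second the L²(0,T;V) norm; the factor 2 is the
  -- uniform bound for J_n.
  refine ⟨Real.exp (κ * T) + (Real.exp (2 * κ * T) / (2 * ε)) ^ (1 / 2 : ℝ) * 2, by positivity,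
    fun g => ?_⟩
  have hg := Lp.stronglyMeasurable g
  have hgi : Integrable g (vol T) := L1.integrable_coeFn g
  refine ⟨fun t ht => C0Semigroup.intervalIntegrable_of_kernel ht
    (hS.integrable_kernel hG hκ hg hgi ht.2), hS.continuousOn_duhamel hG hκ hg hgi, ?_⟩
  obtain ⟨U, hU, hUn⟩ := exists_lift_duhamel hV hι hG hκ hε hS hT hg hgi
  refine ⟨U, hU, ?_⟩
  have e1 : ∫⁻ s, ‖g s‖ₑ ∂(vol T) = ‖g‖ₑ := by
    rw [Lp.enorm_def, eLpNorm_one_eq_lintegral_enorm]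
  have h1 : eLpNorm (S.duhamel g) ∞ (vol T) ≤ ENNReal.ofReal (Real.exp (κ * T)) * ‖g‖ₑ := by
    rw [eLpNorm_exponent_top]
    refine eLpNormEssSup_le_of_ae_enorm_bound ?_
    filter_upwards [ae_restrict_mem measurableSet_Ioo] with t ht
    have := hS.norm_duhamel_le hG hκ hgi (Ioo_subset_Icc_self ht)
    rw [← L1.norm_eq_integral_norm] at this
    rw [← ofReal_norm, ← ofReal_norm, ← ENNReal.ofReal_mul (by positivity)]
    exact ENNReal.ofReal_le_ofReal this
  rw [e1] at hUn
  rw [ENNReal.ofReal_add (by positivity) (by positivity), ENNReal.ofReal_mul (by positivity),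
    ← ENNReal.ofReal_rpow_of_nonneg (by positivity) (by norm_num), add_mul, mul_assoc]
  exact add_le_add h1 hUn

end MildRegularity

/-! ### The weighted energy estimate -/

/-- Integration by parts for absolutely continuous functions, stated for primitives because weak
derivatives produce that form. -/
theorem integral_mul_primitive {f g F G : ℝ → ℝ} {a b : ℝ} (hab : a ≤ b)
    (hf : IntervalIntegrable f volume a b) (hg : IntervalIntegrable g volume a b)
    (hF : ∀ x ∈ Icc a b, F x = F a + ∫ t in a..x, f t)
    (hG : ∀ x ∈ Icc a b, G x = G a + ∫ t in a..x, g t) :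
    ∫ x in a..b, F x * g x = F b * G b - F a * G a - ∫ x in a..b, f x * G x := by
  have hac : ∀ {f : ℝ → ℝ} (c : ℝ), IntervalIntegrable f volume a b →
      AbsolutelyContinuousOnInterval (fun x => c + ∫ t in a..x, f t) a b := by
    intro f c hf
    exact (contDiffOn_const (c := c)).absolutelyContinuousOnInterval.add
      (hf.absolutelyContinuousOnInterval_intervalIntegral left_mem_uIcc)
  have hder : ∀ {f : ℝ → ℝ} (c : ℝ), IntervalIntegrable f volume a b →
      ∀ᵐ x, x ∈ uIoc a b → deriv (fun x => c + ∫ t in a..x, f t) x = f x := by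
    intro f c hf
    filter_upwards [hf.ae_hasDerivAt_integral] with x hx hmem
    exact ((hx (uIoc_subset_uIcc hmem) a left_mem_uIcc).const_add c).deriv
  have key := (hac (F a) hf).integral_mul_deriv_eq_deriv_mul (hac (G a) hg)
  have e1 : ∫ x in a..b, (F a + ∫ t in a..x, f t) * deriv (fun x => G a + ∫ t in a..x, g t) x
      = ∫ x in a..b, F x * g x := by
    refine intervalIntegral.integral_congr_ae ?_
    filter_upwards [hder (G a) hg] with x hx hmem
    rw [hx hmem, hF x]
    rw [uIoc_of_le hab] at hmem
    exact Ioc_subset_Icc_self hmem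
  have e2 : ∫ x in a..b, deriv (fun x => F a + ∫ t in a..x, f t) x * (G a + ∫ t in a..x, g t)
      = ∫ x in a..b, f x * G x := by
    refine intervalIntegral.integral_congr_ae ?_
    filter_upwards [hder (F a) hf] with x hx hmem
    rw [hx hmem, hG x]
    rw [uIoc_of_le hab] at hmem
    exact Ioc_subset_Icc_self hmem
  rw [e1, e2, ← hF b (right_mem_Icc.2 hab), ← hG b (right_mem_Icc.2 hab)] at key
  simpa using key

theorem eq_add_integral_of_hasDerivAt {F f : ℝ → ℝ} {a b : ℝ}
    (hF : ∀ x ∈ Icc a b, HasDerivAt F (f x) x) (hf : ContinuousOn f (Icc a b)) :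
    ∀ x ∈ Icc a b, F x = F a + ∫ t in a..x, f t := by
  intro x hx
  have hsub : uIcc a x ⊆ Icc a b := by
    rw [uIcc_of_le hx.1]
    exact Icc_subset_Icc_right hx.2
  rw [intervalIntegral.integral_eq_sub_of_hasDerivAt (fun t ht => hF t (hsub ht))
    (hf.mono hsub).intervalIntegrable]
  ring

/-- Mean value inequality on [x, L]: vanishing at L gains one power of L - x per integration. -/
theorem abs_le_of_hasDerivAt {y z : ℝ → ℝ} {L C : ℝ} {k : ℕ} (hC : 0 ≤ C)
    (hy : ∀ x, HasDerivAt y (z x) x)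
    (h0 : y L = 0) (hz : ∀ x ∈ Icc 0 L, |z x| ≤ C * (L - x) ^ k) :
    ∀ x ∈ Icc 0 L, |y x| ≤ C * (L - x) ^ (k + 1) := by
  intro x hx
  have h1 := (convex_Icc x L).norm_image_sub_le_of_norm_hasDerivWithin_le (f := y) (f' := z)
    (C := C * (L - x) ^ k) (fun t _ => (hy t).hasDerivWithinAt) (fun t ht => by
      rw [Real.norm_eq_abs]
      refine (hz t ⟨hx.1.trans ht.1, ht.2⟩).trans ?_
      gcongr
      · linarith [ht.2]
      · exact ht.1) (right_mem_Icc.2 hx.2) (left_mem_Icc.2 hx.2)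
  rw [h0, sub_zero, Real.norm_eq_abs, Real.norm_eq_abs, abs_sub_comm,
    abs_of_nonneg (sub_nonneg.2 hx.2)] at h1
  rwa [pow_succ, ← mul_assoc]

/-- `y₀` is a function on `[0, L]` with derivatives `y₁, …, y₄` and integrable fifth derivative `h`
that satisfies the boundary conditions of the Kawahara operator. -/
structure IsRegularChain (L : ℝ) (y₀ y₁ y₂ y₃ y₄ h : ℝ → ℝ) : Prop where
  deriv₀ : ∀ x, HasDerivAt y₀ (y₁ x) x
  deriv₁ : ∀ x, HasDerivAt y₁ (y₂ x) x
  deriv₂ : ∀ x, HasDerivAt y₂ (y₃ x) x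
  deriv₃ : ∀ x, HasDerivAt y₃ (y₄ x) x
  integrable : IntegrableOn h (Icc 0 L)
  continuous : Continuous y₄
  eq_integral : ∀ x ∈ Icc 0 L, y₄ x = y₄ 0 + ∫ t in (0 : ℝ)..x, h t
  left₀ : y₀ 0 = 0
  right₀ : y₀ L = 0
  left₁ : y₁ 0 = 0
  right₁ : y₁ L = 0
  right₂ : y₂ L = 0

/-- The boundary terms in the weighted energy identity. -/
def energyFlux (σ u₀ u₁ u₂ u₃ : ℝ) : ℝ :=
  -(σ * u₁ + σ ^ 2 * u₀) * u₃ + 1 / 2 * (σ * u₂ ^ 2) + 2 * (σ ^ 2 * u₁ * u₂)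
    + 2 * (σ ^ 3 * u₀ * u₂) - 3 * (σ ^ 3 * u₁ ^ 2) - 6 * (σ ^ 4 * u₀ * u₁) + 12 * (σ ^ 5 * u₀ ^ 2)
    - σ * u₀ * u₂ + 1 / 2 * (σ * u₁ ^ 2) + σ ^ 2 * u₀ * u₁ - σ ^ 3 * u₀ ^ 2 - 1 / 2 * (σ * u₀ ^ 2)
    + 49 / 5 * (σ ^ 3 * u₁ ^ 2) + 245 / 8 * (σ ^ 4 * u₀ * u₁) + 233 / 16 * (σ ^ 5 * u₀ ^ 2)
    + 3 / 2 * (σ ^ 3 * u₀ ^ 2)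

theorem hasDerivAt_inv_sub {L x : ℝ} (hx : x < L) :
    HasDerivAt (fun x => (L - x)⁻¹) ((L - x)⁻¹ ^ 2) x := by
  have h : L - x ≠ 0 := (sub_pos.2 hx).ne'
  have := ((hasDerivAt_id' x).const_sub L).fun_inv h
  simpa [div_eq_mul_inv] using this

/-- The flux contains the boundary terms of the integrations by parts, and in its last four terms
exact derivatives that complete squares. Its derivative exceeds the energy density by a sum of
nonnegative terms, which replaces a separate Hardy inequality. Of the coefficient 5/2 of σ² u_xx²,
1/20 is kept for the V norm and 49/20 goes into the squares. -/
theorem exists_hasDerivAt_energyFlux {L x u₄ : ℝ} {y₀ y₁ y₂ y₃ : ℝ → ℝ} (hx : x < L)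
    (h₀ : HasDerivAt y₀ (y₁ x) x) (h₁ : HasDerivAt y₁ (y₂ x) x)
    (h₂ : HasDerivAt y₂ (y₃ x) x) (h₃ : HasDerivAt y₃ u₄ x) :
    ∃ d, HasDerivAt (fun x => energyFlux (L - x)⁻¹ (y₀ x) (y₁ x) (y₂ x) (y₃ x)) d x ∧
      -((L - x)⁻¹ * y₁ x + (L - x)⁻¹ ^ 2 * y₀ x) * u₄ - (L - x)⁻¹ * y₀ x * (y₃ x + y₁ x)
        + 1 / 20 * ((L - x)⁻¹ ^ 2 * y₂ x ^ 2) - 1 / 2 * ((L - x)⁻¹ * y₀ x ^ 2) ≤ d := by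
  have hs := hasDerivAt_inv_sub hx
  have hs0 : 0 < (L - x)⁻¹ := inv_pos.2 (sub_pos.2 hx)
  unfold energyFlux
  refine ⟨_, (((((((((((((((((((hs.fun_mul h₁).fun_add ((hs.fun_pow 2).fun_mul h₀)).fun_neg).fun_mul h₃).fun_add
    ((hs.fun_mul (h₂.fun_pow 2)).const_mul _)).fun_add
    ((((hs.fun_pow 2).fun_mul h₁).fun_mul h₂).const_mul _)).fun_add
    ((((hs.fun_pow 3).fun_mul h₀).fun_mul h₂).const_mul _)).fun_sub
    (((hs.fun_pow 3).fun_mul (h₁.fun_pow 2)).const_mul _)).fun_sub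
    ((((hs.fun_pow 4).fun_mul h₀).fun_mul h₁).const_mul _)).fun_add
    (((hs.fun_pow 5).fun_mul (h₀.fun_pow 2)).const_mul _)).fun_sub
    ((hs.fun_mul h₀).fun_mul h₂)).fun_add
    ((hs.fun_mul (h₁.fun_pow 2)).const_mul _)).fun_add
    (((hs.fun_pow 2).fun_mul h₀).fun_mul h₁)).fun_sub
    ((hs.fun_pow 3).fun_mul (h₀.fun_pow 2))).fun_sub
    ((hs.fun_mul (h₀.fun_pow 2)).const_mul _)).fun_add
    (((hs.fun_pow 3).fun_mul (h₁.fun_pow 2)).const_mul _)).fun_add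
    ((((hs.fun_pow 4).fun_mul h₀).fun_mul h₁).const_mul _)).fun_add
    (((hs.fun_pow 5).fun_mul (h₀.fun_pow 2)).const_mul _)).fun_add
    (((hs.fun_pow 3).fun_mul (h₀.fun_pow 2)).const_mul _)), ?_⟩
  set σ := (L - x)⁻¹
  generalize y₀ x = a, y₁ x = b, y₂ x = c, y₃ x = d
  -- The term -1/2 σ² comes from the first-order part of A; this is where κ = 1/2 suffices for every
  -- L.
  have hσ : 0 ≤ 45 / 64 * σ ^ 6 - 1 / 2 * σ ^ 2 + 1 / 2 * σ := by
    rcases le_total σ 1 with h | h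
    · have h2 : σ ^ 2 ≤ σ := by nlinarith
      have h3 : 0 ≤ σ ^ 6 := by positivity
      linarith
    · have h2 : σ ^ 2 ≤ σ ^ 6 := pow_le_pow_right₀ h (by norm_num)
      nlinarith
  -- The first two squares vanish for u = (L - x)^{5/2}, the critical power of the form. There the
  -- fifth-order form has value 45/32, and the retained 1/20 σ² u_xx² takes away 45/64, leaving
  -- 45/64. The third square is the third-order part of A.
  have key : 0 ≤ 49 / 20 * (σ * c + 4 * (σ ^ 2 * b) + 25 / 4 * (σ ^ 3 * a)) ^ 2
      + 233 / 40 * (σ ^ 2 * b + 5 / 2 * (σ ^ 3 * a)) ^ 2 + 3 / 2 * (σ * b + σ ^ 2 * a) ^ 2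
      + (45 / 64 * σ ^ 6 - 1 / 2 * σ ^ 2 + 1 / 2 * σ) * a ^ 2 := by positivity
  rw [← sub_nonneg]
  refine key.trans_eq ?_
  norm_num
  ring

/-! ### Boundary behaviour and the integrated energy inequality. -/

namespace IsRegularChain

variable {L : ℝ} {y₀ y₁ y₂ y₃ y₄ h : ℝ → ℝ}

theorem continuous₀ (H : IsRegularChain L y₀ y₁ y₂ y₃ y₄ h) : Continuous y₀ :=
  continuous_iff_continuousAt.2 fun x => (H.deriv₀ x).continuousAt

theorem continuous₁ (H : IsRegularChain L y₀ y₁ y₂ y₃ y₄ h) : Continuous y₁ :=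
  continuous_iff_continuousAt.2 fun x => (H.deriv₁ x).continuousAt

theorem continuous₂ (H : IsRegularChain L y₀ y₁ y₂ y₃ y₄ h) : Continuous y₂ :=
  continuous_iff_continuousAt.2 fun x => (H.deriv₂ x).continuousAt

theorem continuous₃ (H : IsRegularChain L y₀ y₁ y₂ y₃ y₄ h) : Continuous y₃ :=
  continuous_iff_continuousAt.2 fun x => (H.deriv₃ x).continuousAt

/-- As u, u_x and u_xx vanish at L and u_xxx is bounded, they are O((L - x)³), O((L - x)²) and O(L -
x). This makes all weighted integrals converge and kills the flux at L. -/
theorem exists_bound (H : IsRegularChain L y₀ y₁ y₂ y₃ y₄ h) :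
    ∃ C, 0 ≤ C ∧ ∀ x ∈ Ico 0 L, |(L - x)⁻¹ * y₂ x| ≤ C ∧ |(L - x)⁻¹ ^ 2 * y₁ x| ≤ C ∧
      |(L - x)⁻¹ ^ 3 * y₀ x| ≤ C := by
  obtain ⟨C, hC⟩ := (isCompact_Icc (a := 0) (b := L)).exists_bound_of_continuousOn
    H.continuous₃.continuousOn
  refine ⟨|C|, abs_nonneg C, ?_⟩
  have h2 := abs_le_of_hasDerivAt (k := 0) (abs_nonneg C) H.deriv₂ H.right₂ fun x hx => by
    have := (hC x hx).trans (le_abs_self C)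
    simpa using this
  have h1 := abs_le_of_hasDerivAt (abs_nonneg C) H.deriv₁ H.right₁ h2
  have h0 := abs_le_of_hasDerivAt (abs_nonneg C) H.deriv₀ H.right₀ h1
  intro x hx
  have hs : 0 < L - x := sub_pos.2 hx.2
  have hx' := Ico_subset_Icc_self hx
  refine ⟨?_, ?_, ?_⟩
  · rw [abs_mul, abs_of_pos (inv_pos.2 hs), inv_mul_le_iff₀ hs, mul_comm]
    simpa using h2 x hx'
  · rw [abs_mul, inv_pow, abs_of_pos (by positivity), inv_mul_le_iff₀ (by positivity), mul_comm]
    simpa using h1 x hx'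
  · rw [abs_mul, inv_pow, abs_of_pos (by positivity), inv_mul_le_iff₀ (by positivity), mul_comm]
    simpa using h0 x hx'

theorem integrableOn_sq₂ (H : IsRegularChain L y₀ y₁ y₂ y₃ y₄ h) :
    IntegrableOn (fun x => (L - x)⁻¹ ^ 2 * y₂ x ^ 2) (Ioo 0 L) := by
  obtain ⟨C, -, hC⟩ := H.exists_bound
  have hm := H.continuous₂.measurable
  refine Measure.integrableOn_of_bounded (M := C ^ 2) (by simp) (by fun_prop) ?_
  filter_upwards [ae_restrict_mem measurableSet_Ioo] with x hx
  rw [← mul_pow, norm_pow, Real.norm_eq_abs]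
  exact pow_le_pow_left₀ (abs_nonneg _) (hC x (Ioo_subset_Ico_self hx)).1 2

theorem abs_inv_mul_le {C x : ℝ} (hC : 0 ≤ C) (hx : x ∈ Ico 0 L)
    (hb : |(L - x)⁻¹ ^ 3 * y₀ x| ≤ C) : |(L - x)⁻¹ * y₀ x| ≤ C * L ^ 2 := by
  have hs : 0 < L - x := sub_pos.2 hx.2
  have e : (L - x)⁻¹ * y₀ x = ((L - x)⁻¹ ^ 3 * y₀ x) * (L - x) ^ 2 := by field_simp
  rw [e, abs_mul, abs_of_nonneg (by positivity : 0 ≤ (L - x) ^ 2)]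
  gcongr
  linarith [hx.1]

theorem integrableOn_mul (H : IsRegularChain L y₀ y₁ y₂ y₃ y₄ h) {f : ℝ → ℝ}
    (hf : IntegrableOn f (Ioo 0 L)) :
    IntegrableOn (fun x => (L - x)⁻¹ * y₀ x * f x) (Ioo 0 L) := by
  obtain ⟨C, hC0, hC⟩ := H.exists_bound
  have hm := H.continuous₀.measurable
  refine Integrable.bdd_mul (c := C * L ^ 2) hf (by fun_prop) ?_
  filter_upwards [ae_restrict_mem measurableSet_Ioo] with x hx
  exact abs_inv_mul_le hC0 (Ioo_subset_Ico_self hx) (hC x (Ioo_subset_Ico_self hx)).2.2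

theorem integrableOn_rhs (H : IsRegularChain L y₀ y₁ y₂ y₃ y₄ h) :
    IntegrableOn (fun x => h x - y₃ x - y₁ x) (Ioo 0 L) :=
  ((H.integrable.mono_set Ioo_subset_Icc_self).sub
    (H.continuous₃.integrableOn_Icc.mono_set Ioo_subset_Icc_self)).sub
    (H.continuous₁.integrableOn_Icc.mono_set Ioo_subset_Icc_self)

theorem integrableOn_sq₀ (H : IsRegularChain L y₀ y₁ y₂ y₃ y₄ h) :
    IntegrableOn (fun x => (L - x)⁻¹ * y₀ x ^ 2) (Ioo 0 L) := by
  have := H.integrableOn_mul (H.continuous₀.integrableOn_Icc.mono_set Ioo_subset_Icc_self)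
  simpa only [sq, mul_assoc] using this

theorem tendsto_flux (hL : 0 < L) (H : IsRegularChain L y₀ y₁ y₂ y₃ y₄ h) :
    Tendsto (fun x => (L - x)⁻¹ * y₀ x * y₄ x
      + energyFlux (L - x)⁻¹ (y₀ x) (y₁ x) (y₂ x) (y₃ x)) (𝓝[<] L) (𝓝 0) := by
  obtain ⟨C, hC0, hC⟩ := H.exists_bound
  have hmem : ∀ᶠ x in 𝓝[<] L, x ∈ Ioo 0 L := Ioo_mem_nhdsLT hL
  have hbig : ∀ u : ℝ → ℝ, (∀ x ∈ Ico 0 L, |u x| ≤ C) → u =O[𝓝[<] L] fun _ => (1 : ℝ) := by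
    intro u hu
    refine Asymptotics.IsBigO.of_bound C ?_
    filter_upwards [hmem] with x hx
    simpa using hu x (Ioo_subset_Ico_self hx)
  have hp := hbig _ fun x hx => (hC x hx).1
  have hq := hbig _ fun x hx => (hC x hx).2.1
  have hr := hbig _ fun x hx => (hC x hx).2.2
  have hcont : ∀ u : ℝ → ℝ, Continuous u → u =O[𝓝[<] L] fun _ => (1 : ℝ) := fun u hu =>
    ((hu.tendsto L).mono_left nhdsWithin_le_nhds).isBigO_one ℝ
  have h3 := hcont _ H.continuous₃
  have h4 := hcont _ H.continuous
  have hs := hcont (fun x => L - x) (by fun_prop)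
  have hs0 : Tendsto (fun x => L - x) (𝓝[<] L) (𝓝 0) := by
    have : Tendsto (fun x => L - x) (𝓝 L) (𝓝 (L - L)) :=
      (continuous_const.sub continuous_id).tendsto L
    rw [sub_self] at this
    exact this.mono_left nhdsWithin_le_nhds
  set p := fun x => (L - x)⁻¹ * y₂ x with hpdef
  set q := fun x => (L - x)⁻¹ ^ 2 * y₁ x with hqdef
  set r := fun x => (L - x)⁻¹ ^ 3 * y₀ x with hrdef
  have mul1 : ∀ {u v : ℝ → ℝ}, u =O[𝓝[<] L] (fun _ => (1 : ℝ)) → v =O[𝓝[<] L] (fun _ => (1 : ℝ)) →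
      (fun x => u x * v x) =O[𝓝[<] L] fun _ => (1 : ℝ) := fun hu hv => by
    simpa using hu.mul hv
  have hB : (fun x => (L - x) * (r x * y₄ x) + (-(q x + r x)) * y₃ x + 1 / 2 * (p x * p x)
      + 2 * (q x * p x) + 2 * (r x * p x) + 34 / 5 * (q x * q x) + 197 / 8 * (r x * q x)
      + 425 / 16 * (r x * r x) + (L - x) * (L - x) * (-(r x * p x) + 1 / 2 * (q x * q x) + r x * q x
        + 1 / 2 * (r x * r x))
      + (L - x) * (L - x) * ((L - x) * (L - x)) * (-1 / 2 * (r x * r x)))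
      =O[𝓝[<] L] fun _ => (1 : ℝ) := by
    have hss := mul1 hs hs
    exact ((((((((((mul1 hs (mul1 hr h4)).add (mul1 (hq.add hr).neg_left h3)).add
      ((mul1 hp hp).const_mul_left _)).add ((mul1 hq hp).const_mul_left _)).add
      ((mul1 hr hp).const_mul_left _)).add ((mul1 hq hq).const_mul_left _)).add
      ((mul1 hr hq).const_mul_left _)).add ((mul1 hr hr).const_mul_left _)).add
      (mul1 hss (((((mul1 hr hp).neg_left).add ((mul1 hq hq).const_mul_left _)).add
        (mul1 hr hq)).add ((mul1 hr hr).const_mul_left _)))).add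
      (mul1 (mul1 hss hss) ((mul1 hr hr).const_mul_left _)))
  have h0 := hs0.zero_mul_isBoundedUnder_le ((Asymptotics.isBigO_one_iff ℝ).1 hB)
  refine h0.congr' ?_
  filter_upwards [hmem] with x hx
  have hsx : L - x ≠ 0 := (sub_pos.2 hx.2).ne'
  simp only [hpdef, hqdef, hrdef, energyFlux]
  field_simp
  ring

/-- The weight is singular at L, so integrate over [0, b] with b < L and let b → L. The
highest-order term needs integration by parts for absolutely continuous functions, since h is only
integrable; afterwards the flux inequality is classical. -/
theorem integral_energy_le (hL : 0 < L) (H : IsRegularChain L y₀ y₁ y₂ y₃ y₄ h) :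
    ∫ x in Ioo 0 L, ((L - x)⁻¹ * y₀ x * (h x - y₃ x - y₁ x)
      + 1 / 20 * ((L - x)⁻¹ ^ 2 * y₂ x ^ 2) - 1 / 2 * ((L - x)⁻¹ * y₀ x ^ 2)) ≤ 0 := by
  set Φ : ℝ → ℝ := fun x => (L - x)⁻¹ * y₀ x * (h x - y₃ x - y₁ x)
      + 1 / 20 * ((L - x)⁻¹ ^ 2 * y₂ x ^ 2) - 1 / 2 * ((L - x)⁻¹ * y₀ x ^ 2) with hΦ
  have hΦi : IntegrableOn Φ (Icc 0 L) := by
    rw [integrableOn_Icc_iff_integrableOn_Ioo]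
    exact ((H.integrableOn_mul H.integrableOn_rhs).add (H.integrableOn_sq₂.const_mul _)).sub
      (H.integrableOn_sq₀.const_mul _)
  have c0 := H.continuous₀
  have c1 := H.continuous₁
  have c2 := H.continuous₂
  have c3 := H.continuous₃
  have c4 := H.continuous
  have hle : ∀ b ∈ Ioo 0 L, ∫ x in (0 : ℝ)..b, Φ x ≤ (L - b)⁻¹ * y₀ b * y₄ b
      + energyFlux (L - b)⁻¹ (y₀ b) (y₁ b) (y₂ b) (y₃ b) := by
    intro b hb
    have hsub : ∀ x ∈ Icc 0 b, x < L := fun x hx => hx.2.trans_lt hb.2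
    have hσc : ContinuousOn (fun x => (L - x)⁻¹) (Icc 0 b) := fun x hx =>
      (hasDerivAt_inv_sub (hsub x hx)).continuousAt.continuousWithinAt
    have hh : IntervalIntegrable h volume 0 b := by
      rw [intervalIntegrable_iff_integrableOn_Icc_of_le hb.1.le]
      exact H.integrable.mono_set (Icc_subset_Icc_right hb.2.le)
    have hfc : ContinuousOn (fun x => (L - x)⁻¹ ^ 2 * y₀ x + (L - x)⁻¹ * y₁ x) (Icc 0 b) := by
      fun_prop
    have hint : ∀ {u : ℝ → ℝ}, ContinuousOn u (Icc 0 b) → IntervalIntegrable u volume 0 b :=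
      fun hu => ContinuousOn.intervalIntegrable (by rwa [uIcc_of_le hb.1.le])
    have ibp := integral_mul_primitive (F := fun x => (L - x)⁻¹ * y₀ x) (G := y₄) hb.1.le
      (hint hfc) hh
      (eq_add_integral_of_hasDerivAt
        (fun x hx => (hasDerivAt_inv_sub (hsub x hx)).fun_mul (H.deriv₀ x)) hfc)
      (fun x hx => H.eq_integral x ⟨hx.1, hx.2.trans hb.2.le⟩)
    simp only [H.left₀, mul_zero, zero_mul, sub_zero] at ibp
    set Q : ℝ → ℝ := fun x => -((L - x)⁻¹ * y₁ x + (L - x)⁻¹ ^ 2 * y₀ x) * y₄ x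
        - (L - x)⁻¹ * y₀ x * (y₃ x + y₁ x)
        + 1 / 20 * ((L - x)⁻¹ ^ 2 * y₂ x ^ 2) - 1 / 2 * ((L - x)⁻¹ * y₀ x ^ 2) with hQ
    have hQc : ContinuousOn Q (Icc 0 b) := by fun_prop
    have e1 : ∫ x in (0 : ℝ)..b, Φ x
        = (L - b)⁻¹ * y₀ b * y₄ b + ∫ x in (0 : ℝ)..b, Q x := by
      have e2 : ∀ x, Φ x = ((L - x)⁻¹ * y₀ x) * h x
          + (((L - x)⁻¹ ^ 2 * y₀ x + (L - x)⁻¹ * y₁ x) * y₄ x + Q x) := fun x => by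
        simp only [hΦ, hQ]
        ring
      have hi1 : IntervalIntegrable (fun x => ((L - x)⁻¹ * y₀ x) * h x) volume 0 b :=
        hh.continuousOn_mul (by rw [uIcc_of_le hb.1.le]; fun_prop)
      have hi2 : IntervalIntegrable
          (fun x => ((L - x)⁻¹ ^ 2 * y₀ x + (L - x)⁻¹ * y₁ x) * y₄ x) volume 0 b :=
        hint (by fun_prop)
      simp only [e2]
      rw [intervalIntegral.integral_add hi1 (hi2.add (hint hQc)),
        intervalIntegral.integral_add hi2 (hint hQc), ibp]
      ring
    have hd := fun x (hx : x < L) => exists_hasDerivAt_energyFlux hx (H.deriv₀ x) (H.deriv₁ x)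
      (H.deriv₂ x) (H.deriv₃ x)
    set Ψ : ℝ → ℝ := fun x => energyFlux (L - x)⁻¹ (y₀ x) (y₁ x) (y₂ x) (y₃ x) with hΨ
    have hΨc : ContinuousOn Ψ (Icc 0 b) := fun x hx => by
      obtain ⟨d, hd, -⟩ := hd x (hsub x hx)
      exact hd.continuousAt.continuousWithinAt
    have e3 : ∫ x in (0 : ℝ)..b, Q x ≤ Ψ b - Ψ 0 := by
      have hQd : ∀ x ∈ Ioo 0 b, HasDerivAt (fun x => ∫ t in (0 : ℝ)..x, Q t) (Q x) x := by
        intro x hx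
        refine intervalIntegral.integral_hasDerivAt_right
          (hint hQc |>.mono_set ?_)
          (hQc.stronglyMeasurableAtFilter_nhdsWithin measurableSet_Icc x |>.filter_mono ?_)
          (hQc.continuousAt (Icc_mem_nhds hx.1 hx.2))
        · rw [uIcc_of_le hx.1.le, uIcc_of_le hb.1.le]
          exact Icc_subset_Icc_right hx.2.le
        · rw [nhdsWithin_eq_nhds.2 (Icc_mem_nhds hx.1 hx.2)]
      have hmono : MonotoneOn (fun x => Ψ x - ∫ t in (0 : ℝ)..x, Q t) (Icc 0 b) := by
        refine monotoneOn_of_deriv_nonneg (convex_Icc 0 b) (hΨc.sub ?_) ?_ ?_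
        · have := intervalIntegral.continuousOn_primitive_interval (μ := volume) (f := Q) (a := 0)
            (b := b) (by rw [uIcc_of_le hb.1.le]; exact hQc.integrableOn_Icc)
          rwa [uIcc_of_le hb.1.le] at this
        · rw [interior_Icc]
          intro x hx
          obtain ⟨d, hd, -⟩ := hd x (hsub x (Ioo_subset_Icc_self hx))
          exact (hd.sub (hQd x hx)).differentiableAt.differentiableWithinAt
        · rw [interior_Icc]
          intro x hx
          obtain ⟨d, hd, hle⟩ := hd x (hsub x (Ioo_subset_Icc_self hx))
          have e := (hd.sub (hQd x hx)).deriv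
          have e' : deriv (fun x => Ψ x - ∫ t in (0 : ℝ)..x, Q t) x = d - Q x := e
          rw [e', sub_nonneg]
          exact hle
      have := hmono (left_mem_Icc.2 hb.1.le) (right_mem_Icc.2 hb.1.le) hb.1.le
      simp only [intervalIntegral.integral_same, sub_zero] at this
      linarith
    -- With u(0) = u_x(0) = 0 only σ u_xx(0)²/2 survives in the flux at 0; no condition on u_xx(0)
    -- is needed.
    have e4 : 0 ≤ Ψ 0 := by
      simp only [hΨ, energyFlux, H.left₀, H.left₁]
      have : 0 ≤ 1 / 2 * ((L - 0)⁻¹ * y₂ 0 ^ 2) := by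
        have : 0 ≤ (L - 0)⁻¹ := by simpa using hL.le
        positivity
      linarith
    rw [e1]
    linarith
  have hlim : Tendsto (fun b => ∫ x in (0 : ℝ)..b, Φ x) (𝓝[<] L) (𝓝 (∫ x in (0 : ℝ)..L, Φ x)) := by
    have := intervalIntegral.continuousOn_primitive_interval (μ := volume) (f := Φ) (a := 0)
      (b := L) (by rwa [uIcc_of_le hL.le])
    rw [uIcc_of_le hL.le] at this
    have h2 := this L (right_mem_Icc.2 hL.le)
    rw [ContinuousWithinAt, ← nhdsWithin_Ioo_eq_nhdsLT hL] at *
    exact h2.mono_left (nhdsWithin_mono _ Ioo_subset_Icc_self)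
  have := le_of_tendsto_of_tendsto hlim (H.tendsto_flux hL)
    (by filter_upwards [Ioo_mem_nhdsLT hL] with b hb using hle b hb)
  rwa [intervalIntegral.integral_of_le hL.le, integral_Ioc_eq_integral_Ioo] at this

end IsRegularChain

variable {L : ℝ}

/-! ### Weak derivatives and primitives -/

theorem L2.integrable (f : L2 L) : Integrable (f : ℝ → ℝ) (vol L) :=
  (Lp.memLp f).integrable (by norm_num)

theorem integral_vol_eq (hL : 0 < L) (f : ℝ → ℝ) : ∫ x, f x ∂(vol L) = ∫ x in (0 : ℝ)..L, f x := by
  rw [intervalIntegral.integral_of_le hL.le, integral_Ioc_eq_integral_Ioo]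

theorem intervalIntegrable_of_vol (hL : 0 < L) {f : ℝ → ℝ} (hf : Integrable f (vol L)) :
    IntervalIntegrable f volume 0 L := by
  rw [intervalIntegrable_iff_integrableOn_Ioo_of_le hL.le]
  exact hf

theorem IsTest.eq_zero_of_notMem {φ : ℝ → ℝ} (hφ : IsTest L φ) {x : ℝ} (hx : x ∉ Ioo 0 L) :
    φ x = 0 :=
  image_eq_zero_of_notMem_tsupport fun h => hx (hφ.2.2 h)

theorem hasWeakDeriv_of_primitive (hL : 0 < L) {f g : L2 L} {F G : ℝ → ℝ} (hfF : f =ᵐ[vol L] F)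
    (hgG : g =ᵐ[vol L] G) (hG : IntervalIntegrable G volume 0 L)
    (hF : ∀ x ∈ Icc 0 L, F x = F 0 + ∫ t in (0 : ℝ)..x, G t) : HasWeakDeriv f g := by
  intro φ hφ
  have e1 : ∫ x, f x * deriv φ x ∂(vol L) = ∫ x, F x * deriv φ x ∂(vol L) :=
    integral_congr_ae (by filter_upwards [hfF] with x hx; rw [hx])
  have e2 : ∫ x, g x * φ x ∂(vol L) = ∫ x, G x * φ x ∂(vol L) :=
    integral_congr_ae (by filter_upwards [hgG] with x hx; rw [hx])
  rw [e1, e2, integral_vol_eq hL, integral_vol_eq hL]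
  have hd : ∀ x, HasDerivAt φ (deriv φ x) x := fun x =>
    ((hφ.1.differentiable (by simp)) x).hasDerivAt
  rw [integral_mul_primitive hL.le hG (hφ.continuous_deriv.intervalIntegrable _ _) hF
    (eq_add_integral_of_hasDerivAt (fun x _ => hd x) hφ.continuous_deriv.continuousOn),
    hφ.eq_zero_of_notMem (x := L) (by simp), hφ.eq_zero_of_notMem (x := 0) (by simp)]
  simp

theorem continuousOn_primitive (hL : 0 < L) {G : ℝ → ℝ} (hG : IntervalIntegrable G volume 0 L)
    (c : ℝ) : ContinuousOn (fun x => c + ∫ t in (0 : ℝ)..x, G t) (Icc 0 L) := by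
  have := intervalIntegral.continuousOn_primitive_interval' hG left_mem_uIcc
  rw [uIcc_of_le hL.le] at this
  exact continuousOn_const.add this

theorem memLp_of_continuousOn {F : ℝ → ℝ} (hF : ContinuousOn F (Icc 0 L)) : MemLp F 2 (vol L) := by
  obtain ⟨C, hC⟩ := isCompact_Icc.exists_bound_of_continuousOn hF
  refine MemLp.of_bound ((hF.mono Ioo_subset_Icc_self).aestronglyMeasurable measurableSet_Ioo) C ?_
  filter_upwards [ae_restrict_mem measurableSet_Ioo] with t ht
  exact hC t (Ioo_subset_Icc_self ht)

theorem HasWeakDeriv.sub {f g f' g' : L2 L} (h : HasWeakDeriv f g)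
    (h' : HasWeakDeriv f' g') : HasWeakDeriv (f - f') (g - g') := by
  have := h.add (h'.smul (-1))
  simpa [sub_eq_add_neg] using this

/-- The difference of f and a primitive of g has zero weak derivative, hence is constant. -/
theorem HasWeakDeriv.exists_primitive (hL : 0 < L) {f g : L2 L} (h : HasWeakDeriv f g) :
    ∃ c : ℝ, f =ᵐ[vol L] fun x => c + ∫ t in (0 : ℝ)..x, g t := by
  have hg := intervalIntegrable_of_vol hL (L2.integrable g)
  have hm := memLp_of_continuousOn (continuousOn_primitive hL hg 0)
  have hp : HasWeakDeriv hm.toLp g := hasWeakDeriv_of_primitive hL hm.coeFn_toLp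
    (ae_eq_refl _) hg (by simp)
  have h0 := h.sub hp
  rw [sub_self] at h0
  obtain ⟨c, hc⟩ := h0.ae_const
  refine ⟨c, ?_⟩
  filter_upwards [hc, Lp.coeFn_sub f hm.toLp, hm.coeFn_toLp] with x h1 h2 h3
  rw [h2, Pi.sub_apply, h3] at h1
  linarith

theorem HasWeakDeriv.exists_hasDerivAt (hL : 0 < L) {f g : L2 L} (h : HasWeakDeriv f g)
    {z : ℝ → ℝ} (hz : Continuous z) (hgz : g =ᵐ[vol L] z) :
    ∃ y : ℝ → ℝ, (∀ x, HasDerivAt y (z x) x) ∧ f =ᵐ[vol L] y := by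
  obtain ⟨c, hc⟩ := h.exists_primitive hL
  refine ⟨fun x => c + ∫ t in (0 : ℝ)..x, z t, fun x => ?_, ?_⟩
  · exact (intervalIntegral.integral_hasDerivAt_right (hz.intervalIntegrable _ _)
      (hz.stronglyMeasurableAtFilter _ _) hz.continuousAt).const_add _
  · filter_upwards [hc, ae_restrict_mem measurableSet_Ioo] with x hx hmem
    rw [hx]
    congr 1
    rw [intervalIntegral.integral_of_le hmem.1.le, intervalIntegral.integral_of_le hmem.1.le,
      integral_Ioc_eq_integral_Ioo, integral_Ioc_eq_integral_Ioo]
    exact integral_congr_ae (ae_restrict_of_ae_restrict_of_subset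
      (Ioo_subset_Ioo_right hmem.2.le) hgz)

/-- Two continuous representatives agree on (0, L), hence on its closure. -/
theorem HasTrace.eq_of_ae_eq (hL : 0 < L) {f : L2 L} {a c : ℝ} (h : HasTrace f a c)
    (ha : a ∈ Icc 0 L) {y : ℝ → ℝ} (hy : ContinuousOn y (Icc 0 L)) (hfy : f =ᵐ[vol L] y) :
    y a = c := by
  obtain ⟨g, hg, hgf, rfl⟩ := h
  have hEq : EqOn g y (Ioo 0 L) :=
    Measure.eqOn_open_of_ae_eq (hgf.trans hfy) isOpen_Ioo (hg.mono Ioo_subset_Icc_self)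
      (hy.mono Ioo_subset_Icc_self)
  exact (hEq.of_subset_closure hg hy Ioo_subset_Icc_self (by rw [closure_Ioo hL.ne]) ha).symm

theorem HasWeakDeriv.eq_zero_of_zero {g : L2 L} (h : HasWeakDeriv 0 g) : g = 0 := by
  have key := isOpen_Ioo.ae_eq_zero_of_integral_contDiff_smul_eq_zero (U := Ioo 0 L) (f := g)
    (show IntegrableOn g (Ioo 0 L) volume from L2.integrable g).locallyIntegrableOn (by
    intro ψ h1 h2 h3
    have hψ : IsTest L ψ := ⟨h1, h2, h3⟩
    have h4 := h ψ hψ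
    have h5 : ∫ x, (0 : L2 L) x * deriv ψ x ∂(vol L) = 0 := by
      refine integral_eq_zero_of_ae ?_
      filter_upwards [Lp.coeFn_zero ℝ 2 (vol L)] with x hx
      rw [hx, Pi.zero_apply, zero_mul]
    rw [h5, setIntegral_mul_test _ hψ] at h4
    simpa [smul_eq_mul] using h4.symm)
  refine Lp.ext (Filter.EventuallyEq.trans ?_ (Lp.coeFn_zero ℝ 2 (vol L)).symm)
  rw [Filter.EventuallyEq, ae_restrict_iff' measurableSet_Ioo]
  filter_upwards [key] with x hx hmem
  exact hx hmem

/-! ### The weighted spaces -/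

/-- A positive weight has the same null sets as Lebesgue measure on (0, L), so a.e. statements pass
freely between L² and the weighted spaces. -/
theorem vol_absolutelyContinuous_weighted {w : ℝ → ℝ} (hw : Measurable w)
    (h0 : ∀ x ∈ Ioo 0 L, 0 < w x) : vol L ≪ weighted L w := by
  refine withDensity_absolutelyContinuous' (by fun_prop) ?_
  filter_upwards [ae_restrict_mem measurableSet_Ioo] with x hx
  rw [Ne, ENNReal.ofReal_eq_zero, not_le]
  exact h0 x hx

theorem vol_absolutelyContinuous_H (L : ℝ) : vol L ≪ weighted L (fun x => 1 / (L - x)) :=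
  vol_absolutelyContinuous_weighted (by fun_prop) fun x hx => by
    have : 0 < L - x := sub_pos.2 hx.2
    positivity

theorem weighted_absolutelyContinuous (w : ℝ → ℝ) : weighted L w ≪ vol L :=
  withDensity_absolutelyContinuous _ _

theorem integral_weighted {w : ℝ → ℝ} (hw : Measurable w) (h0 : ∀ x ∈ Ioo 0 L, 0 ≤ w x)
    (F : ℝ → ℝ) : ∫ x, F x ∂(weighted L w) = ∫ x in Ioo 0 L, w x * F x := by
  rw [integral_withDensity_eq_integral_toReal_smul (by fun_prop) (by simp)]
  refine setIntegral_congr_fun measurableSet_Ioo fun x hx => ?_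
  simp [ENNReal.toReal_ofReal (h0 x hx)]

theorem H.inner_eq (u f : H L) {y k : ℝ → ℝ} (hu : u =ᵐ[vol L] y) (hf : f =ᵐ[vol L] k) :
    inner ℝ f u = ∫ x in Ioo 0 L, (L - x)⁻¹ * y x * k x := by
  rw [L2.inner_def, integral_weighted (by fun_prop) fun x hx => by
    have : 0 < L - x := sub_pos.2 hx.2
    positivity]
  refine integral_congr_ae ?_
  filter_upwards [hu, hf] with x hx hx'
  rw [hx, hx', RCLike.inner_apply, conj_trivial, one_div]
  ring

theorem H.norm_sq_eq (u : H L) {y : ℝ → ℝ} (hu : u =ᵐ[vol L] y) :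
    ‖u‖ ^ 2 = ∫ x in Ioo 0 L, (L - x)⁻¹ * y x ^ 2 := by
  rw [← real_inner_self_eq_norm_sq, H.inner_eq u u hu hu]
  simp only [sq, mul_assoc]

theorem V.norm_eq (v : V L) : ‖v‖ = ‖V.wxx L v‖ := rfl

theorem V.wxx_ae_eq (v : V L) : V.wxx L v =ᵐ[vol L] v.dxx :=
  (vol_absolutelyContinuous L).ae_le v.memLp_dxx.coeFn_toLp

theorem Z.norm_sq_eq (z : Z L) {y : ℝ → ℝ} (hz : z =ᵐ[vol L] y) :
    ‖z‖ ^ 2 = ∫ x in Ioo 0 L, (L - x)⁻¹ ^ 2 * y x ^ 2 := by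
  rw [← real_inner_self_eq_norm_sq, L2.inner_def, integral_weighted (by fun_prop) fun x hx => by
    have : 0 < L - x := sub_pos.2 hx.2
    positivity]
  refine integral_congr_ae ?_
  filter_upwards [hz] with x hx
  rw [hx, real_inner_self_eq_norm_sq, Real.norm_eq_abs, sq_abs, one_div, inv_pow]

theorem V.norm_sq_eq (v : V L) {y : ℝ → ℝ} (hv : v.dxx =ᵐ[vol L] y) :
    ‖v‖ ^ 2 = ∫ x in Ioo 0 L, (L - x)⁻¹ ^ 2 * y x ^ 2 := by
  rw [V.norm_eq, Z.norm_sq_eq _ (v.wxx_ae_eq.trans hv)]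

theorem memLp_weighted_iff {w y : ℝ → ℝ} (hw : Measurable w) (h0 : ∀ x ∈ Ioo 0 L, 0 ≤ w x)
    (hy : AEStronglyMeasurable y (vol L)) :
    MemLp y 2 (weighted L w) ↔ IntegrableOn (fun x => w x * y x ^ 2) (Ioo 0 L) := by
  rw [memLp_two_iff_integrable_sq (hy.mono_ac (weighted_absolutelyContinuous w)),
    integrable_withDensity_iff_integrable_smul₀' (by fun_prop) (by simp)]
  refine integrable_congr ?_
  filter_upwards [ae_restrict_mem measurableSet_Ioo] with x hx
  simp [ENNReal.toReal_ofReal (h0 x hx)]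

/-! ### Coercivity of the Kawahara operator -/

theorem KawaharaGraph.exists_chain (hL : 0 < L) {u f : H L} (h : KawaharaGraph u f) :
    ∃ (y₀ y₁ y₂ y₃ y₄ k : ℝ → ℝ) (v : L2 L × L2 L × L2 L), IsRegularChain L y₀ y₁ y₂ y₃ y₄ k ∧
      u =ᵐ[vol L] y₀ ∧ f =ᵐ[vol L] (fun x => k x - y₃ x - y₁ x) ∧
      IsH20 v.1 v.2.1 v.2.2 ∧ v.1 =ᵐ[vol L] y₀ ∧ v.2.2 =ᵐ[vol L] y₂ := by
  obtain ⟨D, hu, hD, h20, htr, hf⟩ := h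
  have hi5 := intervalIntegrable_of_vol hL (L2.integrable (D 5))
  obtain ⟨c, hc⟩ := (hD 4).exists_primitive hL
  -- Constant extension outside [0, L] makes the fourth derivative continuous on ℝ, so the lower
  -- ones are classical everywhere.
  set Y : ℝ → ℝ := IccExtend hL.le ((Icc 0 L).domRestrict fun x => c + ∫ t in (0 : ℝ)..x, D 5 t)
    with hY
  have hYc : Continuous Y := (continuousOn_primitive hL hi5 c).domRestrict.Icc_extend'
  have hYeq : ∀ x ∈ Icc 0 L, Y x = c + ∫ t in (0 : ℝ)..x, D 5 t := fun x hx => by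
    rw [hY, IccExtend_of_mem _ _ hx]
    rfl
  have hD4 : D 4 =ᵐ[vol L] Y := by
    filter_upwards [hc, ae_restrict_mem measurableSet_Ioo] with x hx hmem
    rw [hYeq x (Ioo_subset_Icc_self hmem)]
    exact hx
  obtain ⟨y₃, hy₃, hD3⟩ := (hD 3).exists_hasDerivAt hL hYc hD4
  have hc3 : Continuous y₃ := continuous_iff_continuousAt.2 fun x => (hy₃ x).continuousAt
  obtain ⟨y₂, hy₂, hD2⟩ := (hD 2).exists_hasDerivAt hL hc3 hD3
  have hc2 : Continuous y₂ := continuous_iff_continuousAt.2 fun x => (hy₂ x).continuousAt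
  obtain ⟨y₁, hy₁, hD1⟩ := (hD 1).exists_hasDerivAt hL hc2 hD2
  have hc1 : Continuous y₁ := continuous_iff_continuousAt.2 fun x => (hy₁ x).continuousAt
  obtain ⟨y₀, hy₀, hD0⟩ := (hD 0).exists_hasDerivAt hL hc1 hD1
  have hc0 : Continuous y₀ := continuous_iff_continuousAt.2 fun x => (hy₀ x).continuousAt
  have m0 : (0 : ℝ) ∈ Icc 0 L := left_mem_Icc.2 hL.le
  have mL : L ∈ Icc 0 L := right_mem_Icc.2 hL.le
  refine ⟨y₀, y₁, y₂, y₃, Y, D 5, (D 0, D 1, D 2), ?_, hu.trans hD0, ?_, h20, hD0, hD2⟩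
  · refine ⟨hy₀, hy₁, hy₂, hy₃, ?_, hYc, fun x hx => ?_, h20.left₀.eq_of_ae_eq hL m0 hc0.continuousOn hD0,
      h20.right₀.eq_of_ae_eq hL mL hc0.continuousOn hD0,
      h20.left₁.eq_of_ae_eq hL m0 hc1.continuousOn hD1,
      h20.right₁.eq_of_ae_eq hL mL hc1.continuousOn hD1,
      htr.eq_of_ae_eq hL mL hc2.continuousOn hD2⟩
    · rw [integrableOn_Icc_iff_integrableOn_Ioo]
      exact L2.integrable (D 5)
    · rw [hYeq x hx, hYeq 0 m0]
      simp
  · filter_upwards [hf, hD3, hD1] with x h1 h2 h3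
    rw [h1]
    exact congrArg₂ _ (congrArg₂ _ rfl h2) h3

/-- The integrated energy inequality, read in the norms of H and V; the O(L - x) bound for u_xx puts
u in V. -/
theorem KawaharaGraph.exists_coercive (hL : 0 < L) {u f : H L} (h : KawaharaGraph u f) :
    ∃ v : V L, v.fn =ᵐ[vol L] u ∧ inner ℝ f u + 1 / 20 * ‖v‖ ^ 2 ≤ 1 / 2 * ‖u‖ ^ 2 := by
  obtain ⟨y₀, y₁, y₂, y₃, y₄, k, w, hch, hu, hf, h20, hw0, hw2⟩ := h.exists_chain hL
  have hmem : MemLp w.2.2 2 (weighted L (fun x => 1 / (L - x) ^ 2)) := by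
    rw [memLp_weighted_iff (by fun_prop) (fun x hx => by positivity)
      (Lp.aestronglyMeasurable _)]
    refine hch.integrableOn_sq₂.congr ?_
    filter_upwards [hw2] with x hx
    rw [hx, one_div, inv_pow]
  let v : V L := ⟨w, h20, hmem⟩
  have hv2 : v.dxx =ᵐ[vol L] y₂ := hw2
  have hv0 : v.fn =ᵐ[vol L] y₀ := hw0
  refine ⟨v, hv0.trans hu.symm, ?_⟩
  rw [H.inner_eq u f hu hf, H.norm_sq_eq u hu, V.norm_sq_eq v hv2]
  have key := hch.integral_energy_le hL
  have i1 := hch.integrableOn_mul hch.integrableOn_rhs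
  have i2 := hch.integrableOn_sq₂
  have i3 := hch.integrableOn_sq₀
  have i12 : IntegrableOn (fun x => (L - x)⁻¹ * y₀ x * (k x - y₃ x - y₁ x)
      + 1 / 20 * ((L - x)⁻¹ ^ 2 * y₂ x ^ 2)) (Ioo 0 L) := i1.add (i2.const_mul _)
  rw [integral_sub i12 (i3.const_mul _), integral_add i1 (i2.const_mul _),
    integral_const_mul, integral_const_mul] at key
  linarith

/-! ### Pointwise bounds for elements of `V` -/

/-- Nonnegativity of the variance of w on [a, b]. -/
theorem sq_integral_le_of_sq_integrable {a b : ℝ} (hab : a < b) {w : ℝ → ℝ}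
    (hw : IntervalIntegrable w volume a b) (hw2 : IntervalIntegrable (fun x => w x ^ 2) volume a b) :
    (∫ x in a..b, w x) ^ 2 ≤ (b - a) * ∫ x in a..b, w x ^ 2 := by
  have hl : 0 < b - a := sub_pos.2 hab
  set m := (∫ x in a..b, w x) / (b - a) with hm
  have h0 : 0 ≤ ∫ x in a..b, (w x - m) ^ 2 :=
    intervalIntegral.integral_nonneg hab.le fun x _ => sq_nonneg _
  have e : ∫ x in a..b, (w x - m) ^ 2
      = (∫ x in a..b, w x ^ 2) - 2 * m * (∫ x in a..b, w x) + (b - a) * m ^ 2 := by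
    have e1 : ∀ x, (w x - m) ^ 2 = w x ^ 2 - 2 * m * w x + m ^ 2 := fun x => by ring
    simp only [e1]
    rw [intervalIntegral.integral_add (hw2.sub (hw.const_mul _)) (by simp),
      intervalIntegral.integral_sub hw2 (hw.const_mul _), intervalIntegral.integral_const_mul,
      intervalIntegral.integral_const, smul_eq_mul]
  rw [e] at h0
  have hm' : ∫ x in a..b, w x = m * (b - a) := by rw [hm, div_mul_cancel₀ _ hl.ne']
  rw [hm'] at h0 ⊢
  nlinarith

theorem V.integrableOn_sq (v : V L) :
    IntegrableOn (fun x => (L - x)⁻¹ ^ 2 * v.dxx x ^ 2) (Ioo 0 L) := by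
  have := (memLp_weighted_iff (by fun_prop) (fun x hx => by positivity)
    (Lp.aestronglyMeasurable v.dxx)).1 v.memLp_dxx
  simpa only [one_div, inv_pow] using this

theorem V.exists_primitives (hL : 0 < L) (v : V L) :
    ∃ y₀ y₁ : ℝ → ℝ, ContinuousOn y₀ (Icc 0 L) ∧ ContinuousOn y₁ (Icc 0 L) ∧
      v.fn =ᵐ[vol L] y₀ ∧ v.dx =ᵐ[vol L] y₁ ∧
      (∀ x ∈ Icc 0 L, y₀ x = ∫ t in (0 : ℝ)..x, y₁ t) ∧
      (∀ x ∈ Icc 0 L, y₁ x = ∫ t in (0 : ℝ)..x, v.dxx t) ∧ y₀ L = 0 ∧ y₁ L = 0 := by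
  have h20 := v.isH20
  have m0 : (0 : ℝ) ∈ Icc 0 L := left_mem_Icc.2 hL.le
  have mL : L ∈ Icc 0 L := right_mem_Icc.2 hL.le
  have hi2 := intervalIntegrable_of_vol hL (L2.integrable v.dxx)
  obtain ⟨c₁, h₁⟩ := h20.weak₂.exists_primitive hL
  have hc₁ := continuousOn_primitive hL hi2 c₁
  have z₁ := h20.left₁.eq_of_ae_eq hL m0 hc₁ h₁
  simp only [intervalIntegral.integral_same, add_zero] at z₁
  subst z₁
  simp only [zero_add] at h₁ hc₁
  obtain ⟨c₀, h₀⟩ := h20.weak₁.exists_primitive hL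
  have hi1 := intervalIntegrable_of_vol hL (L2.integrable v.dx)
  have hc₀ := continuousOn_primitive hL hi1 c₀
  have z₀ := h20.left₀.eq_of_ae_eq hL m0 hc₀ h₀
  simp only [intervalIntegral.integral_same, add_zero] at z₀
  subst z₀
  simp only [zero_add] at h₀ hc₀
  refine ⟨_, _, hc₀, hc₁, h₀, h₁, fun x hx => ?_, fun x _ => rfl,
    h20.right₀.eq_of_ae_eq hL mL hc₀ h₀, h20.right₁.eq_of_ae_eq hL mL hc₁ h₁⟩
  rw [intervalIntegral.integral_of_le hx.1, intervalIntegral.integral_of_le hx.1,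
    integral_Ioc_eq_integral_Ioo, integral_Ioc_eq_integral_Ioo]
  exact integral_congr_ae (ae_restrict_of_ae_restrict_of_subset (Ioo_subset_Ioo_right hx.2) h₁)

/-- Since v_x(L) = 0, |v_x(x)| ≤ ∫ |v_xx| ≤ (L - x) ∫ |v_xx|/(L - t), both integrals over (x, L),
and Cauchy–Schwarz gains a further (L - x)^{1/2}. Another integration from L treats v. -/
theorem V.ae_bound (hL : 0 < L) (v : V L) :
    ∀ᵐ x ∂(vol L), v.dx x ^ 2 ≤ (L - x) ^ 3 * ‖v‖ ^ 2 ∧ v.fn x ^ 2 ≤ (L - x) ^ 5 * ‖v‖ ^ 2 := by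
  obtain ⟨y₀, y₁, hc₀, hc₁, h₀, h₁, hy₀, hy₁, e₀, e₁⟩ := v.exists_primitives hL
  have mL : L ∈ Icc 0 L := right_mem_Icc.2 hL.le
  have hi2 := intervalIntegrable_of_vol hL (L2.integrable v.dxx)
  have hi1 : IntervalIntegrable y₁ volume 0 L :=
    ContinuousOn.intervalIntegrable (by rwa [uIcc_of_le hL.le])
  have sub : ∀ {u : ℝ → ℝ} {x : ℝ}, x ∈ Icc 0 L → IntervalIntegrable u volume 0 L →
      IntervalIntegrable u volume 0 x ∧ IntervalIntegrable u volume x L := fun hx hu =>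
    ⟨hu.mono_set (by rw [uIcc_of_le hx.1, uIcc_of_le hL.le]; exact Icc_subset_Icc_right hx.2),
      hu.mono_set (by rw [uIcc_of_le hx.2, uIcc_of_le hL.le]; exact Icc_subset_Icc_left hx.1)⟩
  have hw2 := intervalIntegrable_of_vol hL v.integrableOn_sq
  have hwm : AEStronglyMeasurable (fun x => (L - x)⁻¹ * |v.dxx x|) (vol L) := by
    have h1 : Measurable fun x : ℝ => (L - x)⁻¹ := by fun_prop
    exact h1.aestronglyMeasurable.mul (Lp.aestronglyMeasurable v.dxx).norm
  have ew : ∀ x, ((L - x)⁻¹ * |v.dxx x|) ^ 2 = (L - x)⁻¹ ^ 2 * v.dxx x ^ 2 := fun x => by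
    rw [mul_pow, sq_abs]
  have hw : IntervalIntegrable (fun x => (L - x)⁻¹ * |v.dxx x|) volume 0 L := by
    refine intervalIntegrable_of_vol hL (MemLp.integrable (q := 2) (by norm_num) ?_)
    rw [memLp_two_iff_integrable_sq hwm]
    simp only [ew]
    exact v.integrableOn_sq
  have b1 : ∀ x ∈ Ico 0 L, |y₁ x| ≤ (L - x) * (√(L - x) * ‖v‖) := by
    intro x hx
    have hx' := Ico_subset_Icc_self hx
    have hs : 0 < L - x := sub_pos.2 hx.2
    have e : y₁ x = -∫ t in x..L, v.dxx t := by
      have := intervalIntegral.integral_add_adjacent_intervals (sub hx' hi2).1 (sub hx' hi2).2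
      rw [← hy₁ x hx', ← hy₁ L mL, e₁] at this
      linarith
    have h2 : |y₁ x| ≤ ∫ t in x..L, (L - x) * ((L - t)⁻¹ * |v.dxx t|) := by
      rw [e, abs_neg]
      refine (intervalIntegral.abs_integral_le_integral_abs hx.2.le).trans ?_
      refine intervalIntegral.integral_mono_on_of_le_Ioo hx.2.le (sub hx' hi2).2.abs
        ((sub hx' hw).2.const_mul _) fun t ht => ?_
      have ht' : 0 < L - t := sub_pos.2 ht.2
      rw [← mul_assoc]
      refine le_mul_of_one_le_left (abs_nonneg _) ?_
      rw [← div_eq_mul_inv, one_le_div ht']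
      linarith [ht.1]
    rw [intervalIntegral.integral_const_mul] at h2
    refine h2.trans ?_
    gcongr
    refine abs_le_of_sq_le_sq' ?_ (by positivity) |>.2
    refine (sq_integral_le_of_sq_integrable hx.2 (sub hx' hw).2
      (by simpa only [ew] using (sub hx' hw2).2)).trans ?_
    rw [mul_pow, Real.sq_sqrt hs.le]
    gcongr
    simp only [ew]
    rw [V.norm_sq_eq v (ae_eq_refl _), intervalIntegral.integral_of_le hx.2.le,
      integral_Ioc_eq_integral_Ioo]
    refine setIntegral_mono_set v.integrableOn_sq (ae_of_all _ fun x => by positivity)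
      (Ioo_subset_Ioo_left hx.1).eventuallyLE
  have b0 : ∀ x ∈ Ico 0 L, |y₀ x| ≤ (L - x) ^ 2 * (√(L - x) * ‖v‖) := by
    intro x hx
    have hx' := Ico_subset_Icc_self hx
    have e : y₀ x = -∫ t in x..L, y₁ t := by
      have := intervalIntegral.integral_add_adjacent_intervals (sub hx' hi1).1 (sub hx' hi1).2
      rw [← hy₀ x hx', ← hy₀ L mL, e₀] at this
      linarith
    have h2 := intervalIntegral.norm_integral_le_of_norm_le_const_ae (a := x) (b := L) (f := y₁)
      (C := (L - x) * (√(L - x) * ‖v‖)) (by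
        have hne : ∀ᵐ t : ℝ, t ≠ L := Measure.ae_ne _ _
        filter_upwards [hne] with t hne ht
        rw [uIoc_of_le hx.2.le] at ht
        have ht2 := lt_of_le_of_ne ht.2 hne
        refine (b1 t ⟨hx.1.trans ht.1.le, ht2⟩).trans ?_
        have := sub_pos.2 ht2
        have hle : L - t ≤ L - x := by linarith [ht.1]
        have hs := sub_pos.2 hx.2
        gcongr)
    rw [e, abs_neg]
    refine h2.trans_eq ?_
    rw [abs_of_pos (sub_pos.2 hx.2)]
    ring
  filter_upwards [h₀, h₁, ae_restrict_mem measurableSet_Ioo] with x hx0 hx1 hmem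
  have hs : 0 < L - x := sub_pos.2 hmem.2
  have hx := Ioo_subset_Ico_self hmem
  rw [hx0, hx1]
  refine ⟨?_, ?_⟩
  · rw [← sq_abs]
    refine (pow_le_pow_left₀ (abs_nonneg _) (b1 x hx) 2).trans_eq ?_
    rw [mul_pow, mul_pow, Real.sq_sqrt hs.le]
    ring
  · rw [← sq_abs]
    refine (pow_le_pow_left₀ (abs_nonneg _) (b0 x hx) 2).trans_eq ?_
    rw [mul_pow, mul_pow, Real.sq_sqrt hs.le]
    ring

/-! ### The embedding of `V` in `H` and the product -/

theorem memLp_H_of_bound {f : ℝ → ℝ} (hf : AEStronglyMeasurable f (vol L)) {C : ℝ}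
    (hC : ∀ᵐ x ∂(vol L), f x ^ 2 ≤ (L - x) * C ^ 2) :
    MemLp f 2 (weighted L (fun x => 1 / (L - x))) := by
  rw [memLp_weighted_iff (by fun_prop) (fun x hx => by
    have : 0 < L - x := sub_pos.2 hx.2
    positivity) hf]
  have hm : Measurable fun x : ℝ => 1 / (L - x) := by fun_prop
  have hm' : AEStronglyMeasurable (fun x => 1 / (L - x) * f x ^ 2) (vol L) :=
    hm.aestronglyMeasurable.mul (hf.pow 2)
  refine Integrable.of_bound hm' (C ^ 2) ?_
  filter_upwards [hC, ae_restrict_mem measurableSet_Ioo] with x hx hmem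
  have hs : 0 < L - x := sub_pos.2 hmem.2
  rw [Real.norm_of_nonneg (by positivity), one_div, inv_mul_le_iff₀ hs]
  exact hx

theorem norm_toLp_H_le (hL : 0 < L) {f : ℝ → ℝ} {C : ℝ} (hC0 : 0 ≤ C)
    (h : MemLp f 2 (weighted L (fun x => 1 / (L - x))))
    (hC : ∀ᵐ x ∂(vol L), f x ^ 2 ≤ (L - x) * C ^ 2) : ‖h.toLp‖ ≤ √L * C := by
  refine abs_le_of_sq_le_sq' ?_ (by positivity) |>.2
  rw [H.norm_sq_eq h.toLp ((vol_absolutelyContinuous_H L).ae_le h.coeFn_toLp), mul_pow,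
    Real.sq_sqrt hL.le]
  have h1 := norm_setIntegral_le_of_norm_le_const_ae' (μ := volume) (s := Ioo 0 L) (C := C ^ 2)
    (f := fun x => (L - x)⁻¹ * f x ^ 2) (by simp) (by
      rw [ae_restrict_iff' measurableSet_Ioo] at hC
      filter_upwards [hC] with x hx hmem
      have hs : 0 < L - x := sub_pos.2 hmem.2
      rw [Real.norm_of_nonneg (by positivity), inv_mul_le_iff₀ hs]
      exact hx hmem)
  refine (Real.le_norm_self _).trans (h1.trans_eq ?_)
  rw [Real.volume_real_Ioo_of_le hL.le, sub_zero, mul_comm]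

theorem V.fn_sq_le (hL : 0 < L) (v : V L) :
    ∀ᵐ x ∂(vol L), v.fn x ^ 2 ≤ (L - x) * (L ^ 2 * ‖v‖) ^ 2 := by
  filter_upwards [v.ae_bound hL, ae_restrict_mem measurableSet_Ioo] with x hx hmem
  have hs : 0 < L - x := sub_pos.2 hmem.2
  refine hx.2.trans ?_
  have h1 : (L - x) ^ 4 ≤ L ^ 4 := pow_le_pow_left₀ hs.le (by linarith [hmem.1]) 4
  calc (L - x) ^ 5 * ‖v‖ ^ 2 = (L - x) * ((L - x) ^ 4 * ‖v‖ ^ 2) := by ring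
    _ ≤ (L - x) * (L ^ 4 * ‖v‖ ^ 2) := by gcongr
    _ = _ := by ring

/-- The decay exponents add to 5 + 3 = 8; one power pays for the weight of H and seven are bounded
by L⁷. -/
theorem V.mul_sq_le (hL : 0 < L) (u v : V L) :
    ∀ᵐ x ∂(vol L), (u.fn x * v.dx x) ^ 2 ≤ (L - x) * (L ^ 3 * √L * ‖u‖ * ‖v‖) ^ 2 := by
  filter_upwards [u.ae_bound hL, v.ae_bound hL, ae_restrict_mem measurableSet_Ioo] with x hu hv hmem
  have hs : 0 < L - x := sub_pos.2 hmem.2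
  rw [mul_pow]
  have h1 : (L - x) ^ 7 ≤ L ^ 7 := pow_le_pow_left₀ hs.le (by linarith [hmem.1]) 7
  calc u.fn x ^ 2 * v.dx x ^ 2 ≤ ((L - x) ^ 5 * ‖u‖ ^ 2) * ((L - x) ^ 3 * ‖v‖ ^ 2) :=
        mul_le_mul hu.2 hv.1 (sq_nonneg _) (by positivity)
    _ = (L - x) * ((L - x) ^ 7 * ‖u‖ ^ 2 * ‖v‖ ^ 2) := by ring
    _ ≤ (L - x) * (L ^ 7 * ‖u‖ ^ 2 * ‖v‖ ^ 2) := by gcongr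
    _ = (L - x) * (L ^ 6 * L * ‖u‖ ^ 2 * ‖v‖ ^ 2) := by ring
    _ = _ := by
      rw [mul_pow, mul_pow, mul_pow, Real.sq_sqrt hL.le]
      ring

theorem V.memLp_fn (hL : 0 < L) (v : V L) : MemLp v.fn 2 (weighted L (fun x => 1 / (L - x))) :=
  memLp_H_of_bound (Lp.aestronglyMeasurable _) (v.fn_sq_le hL)

theorem V.memLp_mul (hL : 0 < L) (u v : V L) :
    MemLp (fun x => u.fn x * v.dx x) 2 (weighted L (fun x => 1 / (L - x))) :=
  memLp_H_of_bound ((Lp.aestronglyMeasurable _).mul (Lp.aestronglyMeasurable _)) (u.mul_sq_le hL v)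

theorem H.ext {f g : H L} (h : f =ᵐ[vol L] g) : f = g :=
  Lp.ext ((weighted_absolutelyContinuous _).ae_le h)

theorem H.coeFn_toLp {f : ℝ → ℝ} (h : MemLp f 2 (weighted L (fun x => 1 / (L - x)))) :
    h.toLp =ᵐ[vol L] f :=
  (vol_absolutelyContinuous_H L).ae_le h.coeFn_toLp

theorem H.coeFn_add (f g : H L) : (f + g : H L) =ᵐ[vol L] f + g :=
  (vol_absolutelyContinuous_H L).ae_le (Lp.coeFn_add f g)

theorem H.coeFn_smul (c : ℝ) (f : H L) : (c • f : H L) =ᵐ[vol L] c • (f : ℝ → ℝ) :=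
  (vol_absolutelyContinuous_H L).ae_le (Lp.coeFn_smul c f)

theorem V.fn_add (u v : V L) : (u + v).fn = u.fn + v.fn := rfl

theorem V.fn_smul (k : ℝ) (u : V L) : (k • u).fn = k • u.fn := rfl

theorem V.dx_add (u v : V L) : (u + v).dx = u.dx + v.dx := rfl

theorem V.dx_smul (k : ℝ) (u : V L) : (k • u).dx = k • u.dx := rfl

/-- The embedding of `V` in `H`. -/
def V.toH (hL : 0 < L) : V L →L[ℝ] H L :=
  LinearMap.mkContinuous
    { toFun := fun v => (v.memLp_fn hL).toLp
      map_add' := fun u v => H.ext <| by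
        filter_upwards [H.coeFn_toLp (u.memLp_fn hL), H.coeFn_toLp (v.memLp_fn hL),
          H.coeFn_toLp ((u + v).memLp_fn hL), Lp.coeFn_add u.fn v.fn,
          H.coeFn_add (u.memLp_fn hL).toLp (v.memLp_fn hL).toLp] with x h1 h2 h3 h4 h5
        rw [h3, h5, Pi.add_apply, h1, h2, V.fn_add, h4, Pi.add_apply]
      map_smul' := fun k u => H.ext <| by
        filter_upwards [H.coeFn_toLp (u.memLp_fn hL), H.coeFn_toLp ((k • u).memLp_fn hL),
          Lp.coeFn_smul k u.fn, H.coeFn_smul k (u.memLp_fn hL).toLp] with x h1 h2 h3 h4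
        rw [RingHom.id_apply, h2, h4, Pi.smul_apply, h1, V.fn_smul, h3, Pi.smul_apply] }
    (√L * L ^ 2) fun v => by
      rw [mul_assoc]
      exact norm_toLp_H_le hL (by positivity) (v.memLp_fn hL) (v.fn_sq_le hL)

theorem V.toH_ae_eq (hL : 0 < L) (v : V L) : V.toH hL v =ᵐ[vol L] v.fn :=
  H.coeFn_toLp (v.memLp_fn hL)

/-- Elements of V carry their derivatives, but weak derivatives are determined by the function. -/
theorem V.toH_injective (hL : 0 < L) : Function.Injective (V.toH hL) := by
  rw [injective_iff_map_eq_zero]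
  intro v hv
  have h0 : v.fn = 0 := by
    refine Lp.ext (Filter.EventuallyEq.trans ?_ (Lp.coeFn_zero ℝ 2 (vol L)).symm)
    refine (V.toH_ae_eq hL v).symm.trans ?_
    rw [hv]
    exact (vol_absolutelyContinuous_H L).ae_le (Lp.coeFn_zero ℝ 2 _)
  have hH := v.isH20
  have hw₁ := hH.weak₁
  rw [h0] at hw₁
  have h1 := hw₁.eq_zero_of_zero
  have hw₂ := hH.weak₂
  rw [h1] at hw₂
  exact V.ext h0 h1 hw₂.eq_zero_of_zero

/-- The bilinear map `(u, v) ↦ u v_x` from `V × V` to `H`. -/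
def V.mulDeriv (hL : 0 < L) : V L →L[ℝ] V L →L[ℝ] H L :=
  LinearMap.mkContinuous₂
    (LinearMap.mk₂ ℝ (fun u v => (u.memLp_mul hL v).toLp)
      (fun u u' v => H.ext <| by
        filter_upwards [H.coeFn_toLp (u.memLp_mul hL v), H.coeFn_toLp (u'.memLp_mul hL v),
          H.coeFn_toLp ((u + u').memLp_mul hL v), Lp.coeFn_add u.fn u'.fn,
          H.coeFn_add (u.memLp_mul hL v).toLp (u'.memLp_mul hL v).toLp] with x h1 h2 h3 h4 h5
        rw [h3, h5, Pi.add_apply, h1, h2, V.fn_add, h4, Pi.add_apply, add_mul])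
      (fun k u v => H.ext <| by
        filter_upwards [H.coeFn_toLp (u.memLp_mul hL v), H.coeFn_toLp ((k • u).memLp_mul hL v),
          Lp.coeFn_smul k u.fn, H.coeFn_smul k (u.memLp_mul hL v).toLp] with x h1 h2 h3 h4
        rw [h2, h4, Pi.smul_apply, h1, V.fn_smul, h3, Pi.smul_apply, smul_mul_assoc])
      (fun u v v' => H.ext <| by
        filter_upwards [H.coeFn_toLp (u.memLp_mul hL v), H.coeFn_toLp (u.memLp_mul hL v'),
          H.coeFn_toLp (u.memLp_mul hL (v + v')), Lp.coeFn_add v.dx v'.dx,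
          H.coeFn_add (u.memLp_mul hL v).toLp (u.memLp_mul hL v').toLp] with x h1 h2 h3 h4 h5
        rw [h3, h5, Pi.add_apply, h1, h2, V.dx_add, h4, Pi.add_apply, mul_add])
      (fun k u v => H.ext <| by
        filter_upwards [H.coeFn_toLp (u.memLp_mul hL v), H.coeFn_toLp (u.memLp_mul hL (k • v)),
          Lp.coeFn_smul k v.dx, H.coeFn_smul k (u.memLp_mul hL v).toLp] with x h1 h2 h3 h4
        rw [h2, h4, Pi.smul_apply, h1, V.dx_smul, h3, Pi.smul_apply, mul_smul_comm]))
    (√L * (L ^ 3 * √L)) fun u v => by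
      have := norm_toLp_H_le hL (by positivity) (u.memLp_mul hL v) (u.mul_sq_le hL v)
      simp only [mul_assoc] at this ⊢
      exact this

theorem V.mulDeriv_ae_eq (hL : 0 < L) (u v : V L) :
    V.mulDeriv hL u v =ᵐ[vol L] fun x => u.fn x * v.dx x :=
  H.coeFn_toLp (u.memLp_mul hL v)

/-! ### Completeness of `V` -/

/-- Integration by parts without boundary terms: y vanishes at 0 and L - x vanishes at L. -/
theorem integral_primitive_eq (hL : 0 < L) {z y : ℝ → ℝ} (hz : IntervalIntegrable z volume 0 L)
    (hy : ∀ x ∈ Icc 0 L, y x = ∫ t in (0 : ℝ)..x, z t) :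
    ∫ x in (0 : ℝ)..L, (L - x) * z x = ∫ x in (0 : ℝ)..L, y x := by
  have h0 : y 0 = 0 := by rw [hy 0 (left_mem_Icc.2 hL.le), intervalIntegral.integral_same]
  have := integral_mul_primitive (F := fun x => L - x) (f := fun _ => -1) (G := y) hL.le
    (by simp) hz (fun x _ => by simp; ring) (fun x hx => by rw [h0, hy x hx, zero_add])
  rw [this, h0]
  simp

/-- The moment is the inner product with (L - x)^{k+2}, since the weight removes two powers. -/
theorem Z.exists_continuous_moment (L : ℝ) (k : ℕ) :
    ∃ ℓ : Z L → ℝ, Continuous ℓ ∧ ∀ z : Z L, ℓ z = ∫ x in Ioo 0 L, (L - x) ^ k * z x := by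
  have hm : MemLp (fun x : ℝ => (L - x) ^ (k + 2)) 2 (weighted L (fun x => 1 / (L - x) ^ 2)) := by
    rw [memLp_weighted_iff (by fun_prop) (fun x hx => by positivity)
      (Continuous.aestronglyMeasurable (by fun_prop))]
    have : IntegrableOn (fun x : ℝ => (L - x) ^ (2 * k + 2)) (Ioo 0 L) :=
      (Continuous.integrableOn_Icc (by fun_prop)).mono_set Ioo_subset_Icc_self
    refine this.congr_fun (fun x hx => ?_) measurableSet_Ioo
    have : L - x ≠ 0 := (sub_pos.2 hx.2).ne'
    field_simp
    ring
  refine ⟨fun z => inner ℝ z hm.toLp, by fun_prop, fun z => ?_⟩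
  dsimp only
  rw [L2.inner_def, integral_weighted (by fun_prop) fun x hx => by positivity]
  refine integral_congr_ae ?_
  filter_upwards [(vol_absolutelyContinuous L).ae_le hm.coeFn_toLp,
    ae_restrict_mem measurableSet_Ioo] with x hx hmem
  have : L - x ≠ 0 := (sub_pos.2 hmem.2).ne'
  rw [hx, RCLike.inner_apply, conj_trivial]
  field_simp
  ring

/-- The two moments are u_x(L) and u(L) for the double primitive u of z from 0, so their vanishing
is exactly the boundary condition on the right. -/
theorem V.mem_range_wxx_iff (hL : 0 < L) (z : Z L) :
    z ∈ range (V.wxx L) ↔ ∫ x in Ioo 0 L, (L - x) ^ 0 * z x = 0 ∧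
      ∫ x in Ioo 0 L, (L - x) ^ 1 * z x = 0 := by
  simp only [pow_zero, one_mul, pow_one]
  rw [integral_vol_eq hL (fun x => z x), integral_vol_eq hL (fun x => (L - x) * z x)]
  have mL : L ∈ Icc 0 L := right_mem_Icc.2 hL.le
  constructor
  · rintro ⟨v, rfl⟩
    obtain ⟨y₀, y₁, hc₀, hc₁, h₀, h₁, hy₀, hy₁, e₀, e₁⟩ := v.exists_primitives hL
    have hi2 := intervalIntegrable_of_vol hL (L2.integrable v.dxx)
    have hae := v.wxx_ae_eq
    have e1 : ∫ x in (0 : ℝ)..L, V.wxx L v x = ∫ x in (0 : ℝ)..L, v.dxx x := by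
      rw [← integral_vol_eq hL, ← integral_vol_eq hL]
      exact integral_congr_ae hae
    have e2 : ∫ x in (0 : ℝ)..L, (L - x) * V.wxx L v x
        = ∫ x in (0 : ℝ)..L, (L - x) * v.dxx x := by
      rw [← integral_vol_eq hL, ← integral_vol_eq hL]
      exact integral_congr_ae (by filter_upwards [hae] with x hx; rw [hx])
    rw [e1, e2, ← hy₁ L mL, integral_primitive_eq hL hi2 hy₁, ← hy₀ L mL]
    exact ⟨e₁, e₀⟩
  · rintro ⟨hz0, hz1⟩
    have hzm : AEStronglyMeasurable z (vol L) :=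
      (Lp.aestronglyMeasurable z).mono_ac (vol_absolutelyContinuous L)
    have hzZ : MemLp z 2 (weighted L (fun x => 1 / (L - x) ^ 2)) := Lp.memLp z
    have hz2 : MemLp z 2 (vol L) := by
      rw [memLp_two_iff_integrable_sq hzm]
      have h1 := ((memLp_weighted_iff (by fun_prop) (fun x hx => by positivity) hzm).1 hzZ).const_mul
        (L ^ 2)
      refine Integrable.mono' h1 (hzm.pow 2) ?_
      filter_upwards [ae_restrict_mem measurableSet_Ioo] with x hx
      have hs : 0 < L - x := sub_pos.2 hx.2
      rw [Real.norm_of_nonneg (sq_nonneg _), ← mul_assoc]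
      refine le_mul_of_one_le_left (sq_nonneg _) ?_
      rw [mul_one_div, one_le_div (by positivity)]
      exact pow_le_pow_left₀ hs.le (by linarith [hx.1]) 2
    have hzi : IntervalIntegrable z volume 0 L :=
      intervalIntegrable_of_vol hL (hz2.integrable (by norm_num))
    set y₁ : ℝ → ℝ := fun x => ∫ t in (0 : ℝ)..x, z t with hy₁
    have hc₁ : ContinuousOn y₁ (Icc 0 L) := by simpa using continuousOn_primitive hL hzi 0
    have hi1 : IntervalIntegrable y₁ volume 0 L :=
      ContinuousOn.intervalIntegrable (by rwa [uIcc_of_le hL.le])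
    set y₀ : ℝ → ℝ := fun x => ∫ t in (0 : ℝ)..x, y₁ t with hy₀
    have hc₀ : ContinuousOn y₀ (Icc 0 L) := by simpa using continuousOn_primitive hL hi1 0
    have hm₁ := memLp_of_continuousOn hc₁
    have hm₀ := memLp_of_continuousOn hc₀
    have h20 : IsH20 hm₀.toLp hm₁.toLp hz2.toLp := by
      refine ⟨hasWeakDeriv_of_primitive hL hm₀.coeFn_toLp hm₁.coeFn_toLp hi1 (by simp [hy₀]),
        hasWeakDeriv_of_primitive hL hm₁.coeFn_toLp hz2.coeFn_toLp hzi (by simp [hy₁]),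
        ⟨y₀, hc₀, hm₀.coeFn_toLp.symm, by simp [hy₀]⟩, ⟨y₀, hc₀, hm₀.coeFn_toLp.symm, ?_⟩,
        ⟨y₁, hc₁, hm₁.coeFn_toLp.symm, by simp [hy₁]⟩, ⟨y₁, hc₁, hm₁.coeFn_toLp.symm, hz0⟩⟩
      rw [← hz1, integral_primitive_eq hL hzi (fun x _ => rfl)]
    have hmem : MemLp hz2.toLp 2 (weighted L (fun x => 1 / (L - x) ^ 2)) :=
      (memLp_congr_ae ((weighted_absolutelyContinuous _).ae_le hz2.coeFn_toLp)).2 hzZ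
    let v : V L := ⟨(hm₀.toLp, hm₁.toLp, hz2.toLp), h20, hmem⟩
    refine ⟨v, Lp.ext ((weighted_absolutelyContinuous _).ae_le ?_)⟩
    exact v.wxx_ae_eq.trans hz2.coeFn_toLp

/-- V is isometric to the common kernel of two continuous functionals on the complete space Z. -/
theorem V.completeSpace (hL : 0 < L) : CompleteSpace (V L) := by
  have hiso : Isometry (V.wxx L) :=
    AddMonoidHomClass.isometry_of_norm (V.wxx L) fun v => (V.norm_eq v).symm
  rw [completeSpace_iff_isComplete_range hiso.isUniformInducing]
  obtain ⟨ℓ₀, hc₀, h₀⟩ := Z.exists_continuous_moment L 0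
  obtain ⟨ℓ₁, hc₁, h₁⟩ := Z.exists_continuous_moment L 1
  have e : range (V.wxx L) = {z | ℓ₀ z = 0} ∩ {z | ℓ₁ z = 0} := by
    ext z
    rw [V.mem_range_wxx_iff hL, ← h₀, ← h₁]
    rfl
  rw [e]
  exact ((isClosed_eq hc₀ continuous_const).inter (isClosed_eq hc₁ continuous_const)).isComplete

/-! ### The graph of the Kawahara operator -/

theorem KawaharaGraph.zero : KawaharaGraph (0 : H L) 0 := by
  have h0 := (vol_absolutelyContinuous_H L).ae_le (Lp.coeFn_zero ℝ 2 (weighted L fun x => 1 / (L - x)))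
  have h2 := Lp.coeFn_zero ℝ 2 (vol L)
  refine ⟨fun _ => 0, Filter.EventuallyEq.trans h0 h2.symm, fun _ => .zero, .zero, .zero _, ?_⟩
  filter_upwards [h0, h2] with x h0 h2
  rw [h0, h2]
  simp

theorem KawaharaGraph.add {u f u' f' : H L} (h : KawaharaGraph u f) (h' : KawaharaGraph u' f') :
    KawaharaGraph (u + u') (f + f') := by
  obtain ⟨D, hu, hD, h20, htr, hf⟩ := h
  obtain ⟨D', hu', hD', h20', htr', hf'⟩ := h'
  refine ⟨fun j => D j + D' j, ?_, fun j => (hD j).add (hD' j), h20.add h20',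
    by simpa using htr.add htr', ?_⟩
  · filter_upwards [hu, hu', H.coeFn_add u u', Lp.coeFn_add (D 0) (D' 0)] with x h1 h2 h3 h4
    rw [h3, h4, Pi.add_apply, Pi.add_apply, h1, h2]
  · filter_upwards [hf, hf', H.coeFn_add f f', Lp.coeFn_add (D 5) (D' 5),
      Lp.coeFn_add (D 3) (D' 3), Lp.coeFn_add (D 1) (D' 1)] with x h1 h2 h3 h4 h5 h6
    rw [h3, h4, h5, h6, Pi.add_apply, Pi.add_apply, Pi.add_apply, Pi.add_apply, h1, h2]
    ring

theorem KawaharaGraph.smul {u f : H L} (c : ℝ) (h : KawaharaGraph u f) :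
    KawaharaGraph (c • u) (c • f) := by
  obtain ⟨D, hu, hD, h20, htr, hf⟩ := h
  refine ⟨fun j => c • D j, ?_, fun j => (hD j).smul c, h20.smul c, by simpa using htr.smul c, ?_⟩
  · filter_upwards [hu, H.coeFn_smul c u, Lp.coeFn_smul c (D 0)] with x h1 h2 h3
    rw [h2, h3, Pi.smul_apply, Pi.smul_apply, h1]
  · filter_upwards [hf, H.coeFn_smul c f, Lp.coeFn_smul c (D 5), Lp.coeFn_smul c (D 3),
      Lp.coeFn_smul c (D 1)] with x h1 h2 h3 h4 h5
    rw [h2, h3, h4, h5, Pi.smul_apply, Pi.smul_apply, Pi.smul_apply, Pi.smul_apply, h1]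
    simp only [smul_eq_mul]
    ring

/-- The graph of the Kawahara operator as a subspace of `H × H`. -/
def kawaharaGraph (L : ℝ) : Submodule ℝ (H L × H L) where
  carrier := {p | KawaharaGraph p.1 p.2}
  add_mem' h h' := h.add h'
  zero_mem' := KawaharaGraph.zero
  smul_mem' c _ h := h.smul c

theorem KawaharaGraph.eq_zero_of_zero {f : H L} (h : KawaharaGraph 0 f) : f = 0 := by
  obtain ⟨D, hu, hD, -, -, hf⟩ := h
  have h0 : D 0 = 0 := by
    refine Lp.ext (hu.symm.trans ?_)
    exact Filter.EventuallyEq.trans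
      ((vol_absolutelyContinuous_H L).ae_le (Lp.coeFn_zero ℝ 2 _)) (Lp.coeFn_zero ℝ 2 (vol L)).symm
  have step : ∀ j : Fin 5, D j.castSucc = 0 → D j.succ = 0 := fun j hj => by
    have := hD j
    rw [hj] at this
    exact this.eq_zero_of_zero
  have h1 : D 1 = 0 := step 0 h0
  have h2 : D 2 = 0 := step 1 h1
  have h3 : D 3 = 0 := step 2 h2
  have h4 : D 4 = 0 := step 3 h3
  have h5 : D 5 = 0 := step 4 h4
  rw [h1, h3, h5] at hf
  refine H.ext (hf.trans ?_)
  filter_upwards [Lp.coeFn_zero ℝ 2 (vol L),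
    (vol_absolutelyContinuous_H L).ae_le (Lp.coeFn_zero ℝ 2 (weighted L fun x => 1 / (L - x)))]
    with x hx hx'
  rw [hx, hx']
  simp

theorem kawaharaGraph_isCoercive (hL : 0 < L) :
    IsCoercive (kawaharaGraph L) (1 / 2) (1 / 20) (V.toH hL) := by
  intro p hp
  obtain ⟨v, hv, hv'⟩ := KawaharaGraph.exists_coercive hL hp
  exact ⟨v, H.ext ((V.toH_ae_eq hL v).trans hv), hv'⟩

theorem kawaharaGraph_inner_le (hL : 0 < L) {p : H L × H L} (hp : p ∈ kawaharaGraph L) :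
    inner ℝ p.2 p.1 ≤ 1 / 2 * ‖p.1‖ ^ 2 := by
  obtain ⟨v, -, hv'⟩ := KawaharaGraph.exists_coercive hL hp
  have : 0 ≤ 1 / 20 * ‖v‖ ^ 2 := by positivity
  linarith

/-! ### Regular chains as elements of the graph. -/

namespace IsRegularChain

variable {y₀ y₁ y₂ y₃ y₄ k : ℝ → ℝ}

theorem memLp_H (H : IsRegularChain L y₀ y₁ y₂ y₃ y₄ k) :
    MemLp y₀ 2 (weighted L (fun x => 1 / (L - x))) := by
  rw [memLp_weighted_iff (by fun_prop) (fun x hx => by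
    have : 0 < L - x := sub_pos.2 hx.2
    positivity) H.continuous₀.aestronglyMeasurable]
  simpa only [one_div] using H.integrableOn_sq₀

theorem kawaharaGraph (hL : 0 < L) (H : IsRegularChain L y₀ y₁ y₂ y₃ y₄ k)
    (hk : MemLp k 2 (vol L)) {u f : Kawahara.H L} (hu : u =ᵐ[vol L] y₀)
    (hf : f =ᵐ[vol L] fun x => k x - y₃ x - y₁ x) : KawaharaGraph u f := by
  have c0 := H.continuous₀
  have c1 := H.continuous₁
  have c2 := H.continuous₂
  have c3 := H.continuous₃
  have m0 := memLp_of_continuousOn (L := L) c0.continuousOn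
  have m1 := memLp_of_continuousOn (L := L) c1.continuousOn
  have m2 := memLp_of_continuousOn (L := L) c2.continuousOn
  have m3 := memLp_of_continuousOn (L := L) c3.continuousOn
  have m4 := memLp_of_continuousOn (L := L) H.continuous.continuousOn
  have weak : ∀ {F G : ℝ → ℝ} (hF : MemLp F 2 (vol L)) (hG : MemLp G 2 (vol L)),
      (∀ x, HasDerivAt F (G x) x) → Continuous G → HasWeakDeriv hF.toLp hG.toLp :=
    fun hF hG hd hc => hasWeakDeriv_of_primitive hL hF.coeFn_toLp hG.coeFn_toLp
      (hc.intervalIntegrable _ _)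
      (eq_add_integral_of_hasDerivAt (fun x _ => hd x) hc.continuousOn)
  have trace : ∀ {F : ℝ → ℝ} (hF : MemLp F 2 (vol L)) {a : ℝ}, Continuous F → F a = 0 →
      HasTrace hF.toLp a 0 := fun hF _ hc h0 => ⟨_, hc.continuousOn, hF.coeFn_toLp.symm, h0⟩
  have w0 := weak m0 m1 H.deriv₀ c1
  have w1 := weak m1 m2 H.deriv₁ c2
  have w2 := weak m2 m3 H.deriv₂ c3
  have w3 := weak m3 m4 H.deriv₃ H.continuous
  have w4 : HasWeakDeriv m4.toLp hk.toLp :=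
    hasWeakDeriv_of_primitive hL m4.coeFn_toLp hk.coeFn_toLp
      (intervalIntegrable_of_vol hL (hk.integrable (by norm_num))) H.eq_integral
  refine ⟨![m0.toLp, m1.toLp, m2.toLp, m3.toLp, m4.toLp, hk.toLp], hu.trans m0.coeFn_toLp.symm,
    ?_, ⟨w0, w1, trace m0 c0 H.left₀, trace m0 c0 H.right₀, trace m1 c1 H.left₁,
      trace m1 c1 H.right₁⟩, trace m2 c2 H.right₂, ?_⟩
  · intro j
    fin_cases j
    · exact w0
    · exact w1
    · exact w2
    · exact w3
    · exact w4
  · filter_upwards [hf, m1.coeFn_toLp, m3.coeFn_toLp, hk.coeFn_toLp] with x h1 h2 h3 h4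
    rw [h1, ← h2, ← h3, ← h4]
    rfl

end IsRegularChain

/-! ### Solvability of the resolvent equation -/

section LinearODE

open NormedSpace (exp)

variable {W : Type*} [NormedAddCommGroup W] [NormedSpace ℝ W] [CompleteSpace W]

/-- Variation of constants. -/
theorem exists_hasDerivAt_linear (M : W →L[ℝ] W) {b : ℝ → W} (hb : Continuous b) :
    ∃ Y : ℝ → W, Y 0 = 0 ∧ ∀ x, HasDerivAt Y (M (Y x) + b x) x := by
  have hexp : Continuous fun x : ℝ => exp (x • M) :=
    continuous_iff_continuousAt.2 fun x => (hasDerivAt_exp_smul_const M x).continuousAt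
  have hc : Continuous fun t : ℝ => exp ((-t) • M) (b t) :=
    (hexp.comp continuous_neg).clm_apply hb
  refine ⟨fun x => exp (x • M) (∫ t in (0 : ℝ)..x, exp ((-t) • M) (b t)), by simp, fun x => ?_⟩
  have h1 := (hasDerivAt_exp_smul_const' M x).clm_apply
    (intervalIntegral.integral_hasDerivAt_right (hc.intervalIntegrable 0 x)
      (hc.stronglyMeasurableAtFilter _ _) hc.continuousAt)
  have e : exp (x • M) (exp ((-x) • M) (b x)) = b x := by
    let _ : NormedAlgebra ℚ (W →L[ℝ] W) := NormedAlgebra.restrictScalars ℚ ℝ _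
    have h2 := NormedSpace.exp_add_of_commute
      (((Commute.refl M).smul_left x).smul_right (-x))
    rw [← add_smul, add_neg_cancel, zero_smul, NormedSpace.exp_zero] at h2
    exact (congrArg (fun T : W →L[ℝ] W => T (b x)) h2).symm
  rw [e] at h1
  exact h1

end LinearODE

/-- The companion matrix of `u_xxxxx = μ u + u_xxx + u_x`. -/
def companion (μ : ℝ) : (Fin 5 → ℝ) →L[ℝ] (Fin 5 → ℝ) :=
  LinearMap.toContinuousLinearMap
    { toFun := fun y => ![y 1, y 2, y 3, y 4, μ * y 0 + y 3 + y 1]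
      map_add' := fun y z => by
        ext j
        fin_cases j <;> simp <;> ring
      map_smul' := fun c y => by
        ext j
        fin_cases j <;> simp <;> ring }

theorem companion_apply (μ : ℝ) (y : Fin 5 → ℝ) :
    companion μ y = ![y 1, y 2, y 3, y 4, μ * y 0 + y 3 + y 1] := rfl

/-- A solution of the companion system satisfying the boundary conditions is a regular chain. -/
theorem isRegularChain_of_hasDerivAt (hL : 0 < L) {μ : ℝ} {Y : ℝ → Fin 5 → ℝ} {f F : ℝ → ℝ}
    (hf : IntegrableOn f (Icc 0 L)) (hFc : Continuous F)
    (hF : ∀ x ∈ Icc 0 L, F x = ∫ t in (0 : ℝ)..x, f t)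
    (hY : ∀ x, HasDerivAt Y (companion μ (Y x) + ![0, 0, 0, -F x, 0]) x)
    (hl₀ : Y 0 0 = 0) (hl₁ : Y 0 1 = 0) (hr₀ : Y L 0 = 0) (hr₁ : Y L 1 = 0) (hr₂ : Y L 2 = 0) :
    IsRegularChain L (fun x => Y x 0) (fun x => Y x 1) (fun x => Y x 2) (fun x => Y x 3)
      (fun x => Y x 4 - F x) (fun x => μ * Y x 0 + Y x 3 + Y x 1 - f x) := by
  have hd : ∀ j x, HasDerivAt (fun x => Y x j)
      ((companion μ (Y x) + ![0, 0, 0, -F x, 0]) j) x := fun j x => hasDerivAt_pi.1 (hY x) j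
  have hc : ∀ j, Continuous fun x => Y x j := fun j =>
    continuous_iff_continuousAt.2 fun x => (hd j x).continuousAt
  have h0 : ∀ x, HasDerivAt (fun x => Y x 0) (Y x 1) x := fun x => by
    simpa [companion_apply] using hd 0 x
  have h1 : ∀ x, HasDerivAt (fun x => Y x 1) (Y x 2) x := fun x => by
    simpa [companion_apply] using hd 1 x
  have h2 : ∀ x, HasDerivAt (fun x => Y x 2) (Y x 3) x := fun x => by
    simpa [companion_apply] using hd 2 x
  -- The fifth component stands for u_xxxx + F with F' = f, so f enters only through the continuous
  -- function F and the system has classical solutions although f is merely integrable.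
  have h3 : ∀ x, HasDerivAt (fun x => Y x 3) (Y x 4 - F x) x := fun x => by
    simpa [companion_apply, sub_eq_add_neg] using hd 3 x
  have h4 : ∀ x, HasDerivAt (fun x => Y x 4) (μ * Y x 0 + Y x 3 + Y x 1) x := fun x => by
    simpa [companion_apply] using hd 4 x
  have c0 := hc 0
  have c1 := hc 1
  have c3 := hc 3
  have c4 := hc 4
  have hgc : Continuous fun x => μ * Y x 0 + Y x 3 + Y x 1 := by fun_prop
  refine ⟨h0, h1, h2, h3, (hgc.integrableOn_Icc).sub hf, by fun_prop, fun x hx => ?_, hl₀, hr₀,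
    hl₁, hr₁, hr₂⟩
  have hfi : IntervalIntegrable f volume 0 x := by
    rw [intervalIntegrable_iff_integrableOn_Icc_of_le hx.1]
    exact hf.mono_set (Icc_subset_Icc_right hx.2)
  rw [intervalIntegral.integral_sub (hgc.intervalIntegrable _ _) hfi, ← hF x hx,
    intervalIntegral.integral_eq_sub_of_hasDerivAt (fun t _ => h4 t) (hgc.intervalIntegrable _ _),
    hF 0 (left_mem_Icc.2 hL.le), intervalIntegral.integral_same]
  ring

/-- The boundary data of the solution of the homogeneous companion system. -/
def boundaryMap (L μ : ℝ) : (Fin 5 → ℝ) →ₗ[ℝ] (Fin 5 → ℝ) where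
  toFun w := ![w 0, w 1, NormedSpace.exp (L • companion μ) w 0,
    NormedSpace.exp (L • companion μ) w 1, NormedSpace.exp (L • companion μ) w 2]
  map_add' v w := by
    ext j
    fin_cases j <;> simp
  map_smul' c w := by
    ext j
    fin_cases j <;> simp

/-- A kernel element is initial data of a solution of A u = μ u with all boundary conditions;
dissipativity with μ > 1/2 forces u = 0, hence all components of Y vanish, including at 0. -/
theorem boundaryMap_injective (hL : 0 < L) {μ : ℝ} (hμ : 1 / 2 < μ) :
    Function.Injective (boundaryMap L μ) := by
  rw [injective_iff_map_eq_zero]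
  intro w hw
  set Y : ℝ → Fin 5 → ℝ := fun x => NormedSpace.exp (x • companion μ) w with hYdef
  have hY0 : Y 0 = w := by simp [hYdef]
  have hd0 : ∀ x, HasDerivAt Y (companion μ (Y x)) x := hasDerivAt_exp_smul_apply _ _
  have hd : ∀ x, HasDerivAt Y (companion μ (Y x) + ![0, 0, 0, -(fun _ : ℝ => (0 : ℝ)) x, 0]) x := by
    intro x
    have e : (![0, 0, 0, -(fun _ : ℝ => (0 : ℝ)) x, 0] : Fin 5 → ℝ) = 0 := by
      ext j
      fin_cases j <;> simp
    rw [e, add_zero]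
    exact hd0 x
  have hb : ∀ j, boundaryMap L μ w j = 0 := fun j => by rw [hw]; rfl
  have hch := isRegularChain_of_hasDerivAt hL (f := fun _ => 0) (by simp) continuous_const
    (fun x _ => by simp) hd (by rw [hY0]; exact hb 0) (by rw [hY0]; exact hb 1) (hb 2) (hb 3) (hb 4)
  simp only [sub_zero] at hch
  have hkm : MemLp (fun x => μ * Y x 0 + Y x 3 + Y x 1) 2 (vol L) := by
    refine memLp_of_continuousOn (Continuous.continuousOn ?_)
    have := hch.continuous₀
    have := hch.continuous₁
    have := hch.continuous₃
    fun_prop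
  have hu := H.coeFn_toLp hch.memLp_H
  set u : H L := hch.memLp_H.toLp with hudef
  have hg : KawaharaGraph u (μ • u) := by
    refine hch.kawaharaGraph hL hkm hu ?_
    filter_upwards [hu, H.coeFn_smul μ u] with x h1 h2
    rw [h2, Pi.smul_apply, h1, smul_eq_mul]
    ring
  have h1 := kawaharaGraph_inner_le hL (p := (u, μ • u)) hg
  dsimp only at h1
  rw [real_inner_smul_left, real_inner_self_eq_norm_sq] at h1
  have h2 : ‖u‖ ^ 2 ≤ 0 := by
    by_contra hc
    nlinarith [not_le.1 hc]
  have h3 : u = 0 :=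
    norm_eq_zero.1 (pow_eq_zero_iff two_ne_zero |>.1 (le_antisymm h2 (sq_nonneg _)))
  have h4 : (fun x => Y x 0) =ᵐ[vol L] fun _ => (0 : ℝ) := by
    refine hu.symm.trans ?_
    rw [h3]
    exact (vol_absolutelyContinuous_H L).ae_le (Lp.coeFn_zero ℝ 2 _)
  have h5 : EqOn (fun x => Y x 0) (fun _ => 0) (Ioo 0 L) :=
    Measure.eqOn_open_of_ae_eq h4 isOpen_Ioo hch.continuous₀.continuousOn continuousOn_const
  have hzero : ∀ {y z : ℝ → ℝ}, (∀ x, HasDerivAt y (z x) x) → EqOn y (fun _ => 0) (Ioo 0 L) →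
      EqOn z (fun _ => 0) (Ioo 0 L) := by
    intro y z hyz hy x hx
    have h6 : HasDerivAt y 0 x := (hasDerivAt_const x (0 : ℝ)).congr_of_eventuallyEq
      (hy.eventuallyEq_of_mem (isOpen_Ioo.mem_nhds hx))
    exact (hyz x).unique h6
  have h6 := hzero hch.deriv₀ h5
  have h7 := hzero hch.deriv₁ h6
  have h8 := hzero hch.deriv₂ h7
  have h9 := hzero hch.deriv₃ h8
  have h10 : EqOn Y (fun _ => 0) (Ioo 0 L) := by
    intro x hx
    ext j
    fin_cases j
    · exact h5 hx
    · exact h6 hx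
    · exact h7 hx
    · exact h8 hx
    · exact h9 hx
  have hYc : Continuous Y := continuous_iff_continuousAt.2 fun x => (hd0 x).continuousAt
  have h11 : EqOn Y (fun _ => 0) (Icc 0 L) :=
    h10.of_subset_closure hYc.continuousOn continuousOn_const Ioo_subset_Icc_self
      (by rw [closure_Ioo hL.ne])
  rw [← hY0]
  exact h11 (left_mem_Icc.2 hL.le)

theorem H.memLp_vol (f : H L) : MemLp f 2 (vol L) := by
  have hm : AEStronglyMeasurable f (vol L) :=
    (Lp.aestronglyMeasurable f).mono_ac (vol_absolutelyContinuous_H L)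
  rw [memLp_two_iff_integrable_sq hm]
  have h1 := ((memLp_weighted_iff (by fun_prop) (fun x hx => by
    have : 0 < L - x := sub_pos.2 hx.2
    positivity) hm).1 (Lp.memLp f)).const_mul L
  refine Integrable.mono' h1 (hm.pow 2) ?_
  filter_upwards [ae_restrict_mem measurableSet_Ioo] with x hx
  have hs : 0 < L - x := sub_pos.2 hx.2
  rw [Real.norm_of_nonneg (sq_nonneg _), ← mul_assoc]
  refine le_mul_of_one_le_left (sq_nonneg _) ?_
  rw [mul_one_div, one_le_div hs]
  linarith [hx.1]

theorem kawaharaGraph_exists_resolvent (hL : 0 < L) {μ : ℝ} (hμ : 1 / 2 < μ) (f : H L) :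
    ∃ p ∈ kawaharaGraph L, μ • p.1 - p.2 = f := by
  have hfm := f.memLp_vol
  have hfi : Integrable f (vol L) := hfm.integrable (by norm_num)
  have hfI := intervalIntegrable_of_vol hL hfi
  have hfc := continuousOn_primitive hL hfI 0
  simp only [zero_add] at hfc
  set F : ℝ → ℝ := IccExtend hL.le ((Icc 0 L).domRestrict fun x => ∫ t in (0 : ℝ)..x, f t)
    with hFdef
  have hFc : Continuous F := hfc.domRestrict.Icc_extend'
  have hF : ∀ x ∈ Icc 0 L, F x = ∫ t in (0 : ℝ)..x, f t := fun x hx => by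
    rw [hFdef, IccExtend_of_mem _ _ hx]
    rfl
  have hbc : Continuous fun x => (![0, 0, 0, -F x, 0] : Fin 5 → ℝ) := by
    refine continuous_pi fun j => ?_
    fin_cases j
    · exact continuous_const
    · exact continuous_const
    · exact continuous_const
    · exact hFc.neg
    · exact continuous_const
  obtain ⟨Z, hZ0, hZ⟩ := exists_hasDerivAt_linear (companion μ) hbc
  -- In dimension five injectivity gives surjectivity, so a homogeneous solution can cancel the
  -- boundary values of `Z` at L while keeping those at 0.
  obtain ⟨w, hw⟩ := (LinearMap.injective_iff_surjective.1 (boundaryMap_injective hL hμ))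
    ![0, 0, -Z L 0, -Z L 1, -Z L 2]
  set Y : ℝ → Fin 5 → ℝ := fun x => Z x + NormedSpace.exp (x • companion μ) w with hYdef
  have hY : ∀ x, HasDerivAt Y (companion μ (Y x) + ![0, 0, 0, -F x, 0]) x := by
    intro x
    have := (hZ x).add (hasDerivAt_exp_smul_apply (companion μ) w x)
    have e : companion μ (Z x) + ![0, 0, 0, -F x, 0]
        + companion μ (NormedSpace.exp (x • companion μ) w)
        = companion μ (Y x) + ![0, 0, 0, -F x, 0] := by
      rw [hYdef, map_add]
      abel
    rw [e] at this
    exact this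
  have hY0 : Y 0 = w := by simp [hYdef, hZ0]
  have hb := fun j => congrFun hw j
  have hr : ∀ {a b : ℝ}, b = -a → a + b = 0 := fun h => by rw [h, add_neg_cancel]
  have hch := isRegularChain_of_hasDerivAt hL
    (by rw [integrableOn_Icc_iff_integrableOn_Ioo]; exact hfi) hFc hF hY
    (by rw [hY0]; exact hb 0) (by rw [hY0]; exact hb 1) (hr (hb 2)) (hr (hb 3)) (hr (hb 4))
  have hkm : MemLp (fun x => μ * Y x 0 + Y x 3 + Y x 1 - f x) 2 (vol L) := by
    refine MemLp.sub (memLp_of_continuousOn (Continuous.continuousOn ?_)) hfm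
    have := hch.continuous₀
    have := hch.continuous₁
    have := hch.continuous₃
    fun_prop
  have hu := H.coeFn_toLp hch.memLp_H
  set u : H L := hch.memLp_H.toLp with hudef
  refine ⟨(u, μ • u - f), ?_, by simp⟩
  refine hch.kawaharaGraph hL hkm hu ?_
  filter_upwards [hu, H.coeFn_smul μ u,
    (vol_absolutelyContinuous_H L).ae_le (Lp.coeFn_sub (μ • u) f)] with x h1 h2 h3
  rw [h3, Pi.sub_apply, h2, Pi.smul_apply, h1, smul_eq_mul]
  ring

theorem kawaharaGraph_isQuasiMDissipative (hL : 0 < L) :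
    IsQuasiMDissipative (kawaharaGraph L) (1 / 2) where
  inner_le _ hp := kawaharaGraph_inner_le hL hp
  exists_resolvent _ hμ f := kawaharaGraph_exists_resolvent hL hμ f
  eq_zero_of_zero _ h := KawaharaGraph.eq_zero_of_zero h

end Kawahara

end

/-! ### The product estimate and the mild solution. -/

theorem mainTheorem9 (L T : ℝ) (hL : 0 < L) (hT : 0 < T) :
    -- (i) the product map `(u, v) ↦ u v_x` from `L²(0,T;V)²` to `L¹(0,T;H)`
    (∃ B : Lp (Kawahara.V L) 2 (Kawahara.vol T) → Lp (Kawahara.V L) 2 (Kawahara.vol T) →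
          Lp (Kawahara.H L) 1 (Kawahara.vol T),
      (∀ u v, ∀ᵐ t ∂(Kawahara.vol T),
        B u v t =ᵐ[Kawahara.vol L] fun x => (u t).fn x * (v t).dx x) ∧
      Continuous (fun p : Lp (Kawahara.V L) 2 (Kawahara.vol T) ×
        Lp (Kawahara.V L) 2 (Kawahara.vol T) => B p.1 p.2) ∧
      ∃ c : ℝ, 0 < c ∧ ∀ u v, ‖B u v‖ ≤ c * ‖u‖ * ‖v‖) ∧
    -- (ii) the semigroup of the linear system exists, and the mild solution has the regularity
    (∃ S : Kawahara.C0Semigroup (Kawahara.H L), S.IsGeneratedBy Kawahara.KawaharaGraph) ∧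
    ∀ S : Kawahara.C0Semigroup (Kawahara.H L), S.IsGeneratedBy Kawahara.KawaharaGraph →
      ∃ C : ℝ, 0 < C ∧ ∀ g : Lp (Kawahara.H L) 1 (Kawahara.vol T),
        (∀ t ∈ Icc 0 T, IntervalIntegrable (fun s => S.op (t - s) (g s)) volume 0 t) ∧
        ContinuousOn (S.duhamel g) (Icc 0 T) ∧
        ∃ U : Lp (Kawahara.V L) 2 (Kawahara.vol T),
          (∀ᵐ t ∂(Kawahara.vol T), S.duhamel g t =ᵐ[Kawahara.vol L] (U t).fn) ∧
          eLpNorm (S.duhamel g) ∞ (Kawahara.vol T) + ‖U‖ₑ ≤ ENNReal.ofReal C * ‖g‖ₑ := by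
  have := Kawahara.V.completeSpace hL
  have hG := Kawahara.kawaharaGraph_isQuasiMDissipative hL
  refine ⟨?_, hG.exists_semigroup, fun S hS => ?_⟩
  · let b := Kawahara.V.mulDeriv hL
    -- The bilinear map is applied pointwise in t, and Hölder with 1/2 + 1/2 = 1 gives the bound
    -- ‖b‖; adding 1 keeps the constant positive.
    refine ⟨fun u v => b.holder 1 u v, fun u v => ?_, ?_, ‖b‖ + 1, by positivity, fun u v => ?_⟩
    · filter_upwards [b.coeFn_holder (r := 1) u v] with t ht
      rw [ht]
      exact Kawahara.V.mulDeriv_ae_eq hL (u t) (v t)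
    · exact (b.holderL (Kawahara.vol T) 2 2 1).continuous₂
    · refine (b.norm_holder_apply_apply_le u v).trans ?_
      gcongr
      linarith
  · obtain ⟨C, hC, h⟩ := Kawahara.exists_mild_bound (Kawahara.kawaharaGraph_isCoercive hL)
      (Kawahara.V.toH_injective hL) hG (by norm_num) (by norm_num) hS hT.le
    refine ⟨C, hC, fun g => ?_⟩
    obtain ⟨h1, h2, U, hU, hUC⟩ := h g
    refine ⟨h1, h2, U, ?_, hUC⟩
    filter_upwards [hU] with t ht
    rw [ht]
    exact Kawahara.V.toH_ae_eq hL (U t)
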